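/- **Setting.** Let $(T,\boldsymbol X,Y)$ be a random vector with $T\in\{0,1\}$, $\boldsymbol X=(\boldsymbol X_1,\boldsymbol X_2)\in\mathbb R^{r}$, $Y\in\mathbb R$, and put $\boldsymbol Z=(\boldsymbol X,Y)$. Let $\pi(\boldsymbol z;\gamma)$ and $U(\boldsymbol z)$ be known functions, $\gamma_0\in\mathbb R^p$, $\theta_0=\mathbb E[U(\boldsymbol Z)]$, where $U(\boldsymbol Z)$ is square integrable and not almost surely constant. For every integer $K\ge p$ let $u_K=(u_{1K},\dots,u_{KK})^\top$ be a vector of measurable functions with $\mathbb E\|u_K(\boldsymbol X)\|^2<\infty$. Put $$g_K(T,\boldsymbol Z;\gamma,\theta)=\Big(\big[1-\tfrac{T}{\pi(\boldsymbol Z;\gamma)}\big]u_K(\boldsymbol X)^\top,\ \theta-\tfrac{T}{\pi(\boldsymbol Z;\gamma)}U(\boldsymbol Z)\Big)^\top,\qquad D_K=\mathbb E\big[g_K g_K^\top\big]\Big|_{(\gamma_0,\theta_0)},$$ $$B_K=\begin{pmatrix}\mathbb E\big[u_K(\boldsymbol X)\frac{\nabla_\gamma\pi(\boldsymbol Z;\gamma_0)^\top}{\pi(\boldsymbol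 Z;\gamma_0)}\big]&0\\[1mm] \mathbb E\big[U(\boldsymbol Z)\frac{\nabla_\gamma\pi(\boldsymbol Z;\gamma_0)^\top}{\pi(\boldsymbol Z;\gamma_0)}\big]&1\end{pmatrix},\qquad V_K=\{B_K^\top D_K^{-1}B_K\}^{-1}.$$ **Assumptions.** 1. $\mathbb P(T=1\mid \boldsymbol X,Y)=\pi(\boldsymbol Z;\gamma_0)$; $\boldsymbol X_2$ is independent of $T$ given $(\boldsymbol X_1,Y)$; $\boldsymbol X_2$ and $Y$ are not independent. 2. $\Gamma\subset\mathbb R^p$ and $\Theta\subset\mathbb R$ are compact, $\gamma_0$ and $\theta_0$ lie in their interiors, and $\gamma_0$ is the only $\gamma\in\Gamma$ with $\mathbb E[1-T/\pi(\boldsymbol Z;\gamma)\mid\boldsymbol X]=0$ almost surely. 3. The support $\mathcal X$ of $\boldsymbol X$ is a Cartesian product of $r$ compact intervals. 4. There are constants $0<\underline a\le\overline a<\infty$ such that all eigenvalues of $\mathbb E[u_K(\boldsymbol X)u_K(\boldsymbol X)^\top]$ lie in $[\underline a,\overline a]$ for all $K\ge p$; and every square integrable function of $\boldsymbol X$ is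 a mean-square limit, as $K\to\infty$, of linear combinations of $u_{1K},\dots,u_{KK}$. 5. There are constants $0<\underline c\le\overline c<1$ with $\underline c\le\pi(\boldsymbol x,y;\gamma)\le\overline c$ for all $\gamma\in\Gamma$, $(\boldsymbol x,y)\in\mathcal X\times\mathbb R$. For $(\boldsymbol x,y)\in\mathcal X\times\mathbb R$, $\pi(\boldsymbol x,y;\cdot)$ is twice continuously differentiable on $\Gamma$, with first and second derivatives bounded uniformly in $(\boldsymbol x,y)$ and in $\gamma$ in the interior of $\Gamma$. For some $s=s_0+\delta$ ($s_0\ge 0$ an integer, $0<\delta\le1$) the functions $\mathbb E[1-T/\pi(\boldsymbol Z;\gamma)\mid\boldsymbol X=\boldsymbol x]$ ($\gamma\in\Gamma$) and $\mathbb E[\nabla_\gamma\pi(\boldsymbol Z;\gamma)/\pi(\boldsymbol Z;\gamma)\mid\boldsymbol X=\boldsymbol x]$ ($\gamma$ in the interior of $\Gamma$) have versions on $\mathcal X$ that are $s_0$ times continuously differentiable with derivatives of order $s_0$ that are Hölder continuous with exponent $\delta$. 6. For all sufficiently large $K$, the matrix $B_K^\top D_K^{-1}B_K$ is well defined and nonsingular,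 so that $V_K$ exists. 7. $(T_i,\boldsymbol Z_i)_{i\ge1}$ are i.i.d. copies of $(T,\boldsymbol Z)$, and $K=K(N)$ satisfies $K\to\infty$ and $K^3/N\to0$ as $N\to\infty$. **Theorem 2.** Let $\boldsymbol G_{K}(\gamma,\theta)=\sum_{i=1}^N g_{K}(T_i,\boldsymbol Z_i;\gamma,\theta)$ and let $(\overline\gamma,\overline\theta)$ be random vectors that almost surely minimize $\boldsymbol G_K(\gamma,\theta)^\top D_K^{-1}\boldsymbol G_K(\gamma,\theta)$ over $\Gamma\times\Theta$, with $K=K(N)$. Then, as $N\to\infty$, $$V_K^{-1/2}\begin{pmatrix}\sqrt N(\overline\gamma-\gamma_0)\\ \sqrt N(\overline\theta-\theta_0)\end{pmatrix}\longrightarrow N\big(0,I_{(p+1)\times(p+1)}\big)\quad\text{in distribution.}$$ -/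

import Mathlib

open MeasureTheory ProbabilityTheory Filter Topology
open scoped MatrixOrder

noncomputable section

namespace MNAR

/-- Values of the covariate vector `X = (X₁, X₂)`, with `X₁ ∈ ℝ^{r₁}` and `X₂ ∈ ℝ^{r₂}`. -/
abbrev Cov (r₁ r₂ : ℕ) : Type := Fin r₁ ⊕ Fin r₂ → ℝ

/-- Values of `Z = (X, Y)`. -/
abbrev ZVal (r₁ r₂ : ℕ) : Type := Cov r₁ r₂ × ℝ

/-- Values of the full-data vector `(T, Z) = (T, X, Y)`; `true` stands for `T = 1`. -/
abbrev Obs (r₁ r₂ : ℕ) : Type := Bool × ZVal r₁ r₂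

/-- The space `ℝ^p` of the propensity parameter `γ`. -/
abbrev Par (p : ℕ) : Type := EuclideanSpace ℝ (Fin p)

/-- The space `ℝ^{p+1}` of `(γ, θ)`. -/
abbrev FullPar (p : ℕ) : Type := EuclideanSpace ℝ (Fin p ⊕ Unit)

section Observation
variable {r₁ r₂ : ℕ}

/-- The numerical value `T ∈ {0, 1}` of the response indicator. -/
def Obs.T (w : Obs r₁ r₂) : ℝ := if w.1 then 1 else 0
/-- The vector `Z = (X, Y)`. -/
def Obs.Z (w : Obs r₁ r₂) : ZVal r₁ r₂ := w.2
/-- The covariates `X`. -/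
def Obs.X (w : Obs r₁ r₂) : Cov r₁ r₂ := w.2.1
/-- The outcome `Y`. -/
def Obs.Y (w : Obs r₁ r₂) : ℝ := w.2.2
/-- The first block `X₁` of the covariates. -/
def Obs.X₁ (w : Obs r₁ r₂) : Fin r₁ → ℝ := fun i => w.2.1 (Sum.inl i)
/-- The second block `X₂` of the covariates (the nonresponse instrument). -/
def Obs.X₂ (w : Obs r₁ r₂) : Fin r₂ → ℝ := fun i => w.2.1 (Sum.inr i)

/-- `σ(X)` -/
abbrev sigmaX (r₁ r₂ : ℕ) : MeasurableSpace (Obs r₁ r₂) :=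
  MeasurableSpace.comap (Obs.X (r₁ := r₁) (r₂ := r₂)) inferInstance
/-- `σ(X, Y)` -/
abbrev sigmaZ (r₁ r₂ : ℕ) : MeasurableSpace (Obs r₁ r₂) :=
  MeasurableSpace.comap (Obs.Z (r₁ := r₁) (r₂ := r₂)) inferInstance
/-- `σ(X₁, Y)` -/
abbrev sigmaX₁Y (r₁ r₂ : ℕ) : MeasurableSpace (Obs r₁ r₂) :=
  MeasurableSpace.comap (fun w : Obs r₁ r₂ => (Obs.X₁ w, Obs.Y w)) inferInstance

lemma sigmaX₁Y_le : sigmaX₁Y r₁ r₂ ≤ (inferInstance : MeasurableSpace (Obs r₁ r₂)) := by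
  apply Measurable.comap_le
  unfold Obs.X₁ Obs.Y
  fun_prop

end Observation

/-- `f` is `s`-smooth on `S` with `s = s₀ + δ`: it is `s₀` times continuously differentiable on `S`
and its derivatives of order `s₀` are Hölder continuous on `S` with exponent `δ`. -/
def SSmooth {ι : Type} [Fintype ι] (s₀ : ℕ) (δ : ℝ) (S : Set (ι → ℝ)) (f : (ι → ℝ) → ℝ) : Prop :=
  ∃ q : (ι → ℝ) → FormalMultilinearSeries ℝ (ι → ℝ) ℝ,
    HasFTaylorSeriesUpToOn (s₀ : ℕ∞) f q S ∧
    ∃ L : ℝ, 0 < L ∧ ∀ x ∈ S, ∀ x' ∈ S, ‖q x s₀ - q x' s₀‖ ≤ L * ‖x - x'‖ ^ δ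

/-- The data of the model: the joint law of `(T, X, Y)`, the parametric propensity score
`π(z; γ)`, the function `U`, the basis functions `u_K = (u_{1K}, …, u_{KK})`, the parameter spaces
`Γ` and `Θ`, and the true values `γ₀` and `θ₀`. -/
structure Model (p r₁ r₂ : ℕ) where
  law : Measure (Obs r₁ r₂)
  π : ZVal r₁ r₂ → Par p → ℝ
  U : ZVal r₁ r₂ → ℝ
  u : (K : ℕ) → Fin K → Cov r₁ r₂ → ℝ
  Γ : Set (Par p)
  Θ : Set ℝ
  γ₀ : Par p
  θ₀ : ℝ

namespace Model
variable {p r₁ r₂ : ℕ} (M : Model p r₁ r₂)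

/-- The law of `X`. -/
def lawX : Measure (Cov r₁ r₂) := M.law.map Obs.X

/-- The support of `X`. -/
def suppX : Set (Cov r₁ r₂) := M.lawX.support

/-- `1 - T / π(Z; γ)` -/
def rho (γ : Par p) (w : Obs r₁ r₂) : ℝ := 1 - w.T / M.π w.Z γ

/-- The `j`-th coordinate of `∇_γ π(Z; γ) / π(Z; γ)`. -/
def score (γ : Par p) (j : Fin p) (w : Obs r₁ r₂) : ℝ :=
  gradient (M.π w.Z) γ j / M.π w.Z γ

/-- The moment function `g_K(T, Z; γ, θ) ∈ ℝ^{K+1}`. -/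
def g (K : ℕ) (γ : Par p) (θ : ℝ) (w : Obs r₁ r₂) : Fin K ⊕ Unit → ℝ :=
  Sum.elim (fun k => M.rho γ w * M.u K k w.X) (fun _ => θ - w.T / M.π w.Z γ * M.U w.Z)

/-- `E[u_K(X) u_K(X)ᵀ]` -/
def gram (K : ℕ) : Matrix (Fin K) (Fin K) ℝ :=
  Matrix.of fun k l => ∫ w, M.u K k w.X * M.u K l w.X ∂M.law

/-- The matrix `D = E[g_K(T, Z; γ₀, θ₀) g_K(T, Z; γ₀, θ₀)ᵀ]`. -/
def D (K : ℕ) : Matrix (Fin K ⊕ Unit) (Fin K ⊕ Unit) ℝ :=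
  Matrix.of fun a b => ∫ w, M.g K M.γ₀ M.θ₀ w a * M.g K M.γ₀ M.θ₀ w b ∂M.law

/-- The `(K+1) × (p+1)` matrix `B`, with blocks `E[u_K(X) ∇_γ π(Z; γ₀)ᵀ / π(Z; γ₀)]`, `0`,
`E[U(Z) ∇_γ π(Z; γ₀)ᵀ / π(Z; γ₀)]` and `1`. -/
def B (K : ℕ) : Matrix (Fin K ⊕ Unit) (Fin p ⊕ Unit) ℝ :=
  Matrix.fromBlocks
    (Matrix.of fun k j => ∫ w, M.u K k w.X * M.score M.γ₀ j w ∂M.law) 0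
    (Matrix.of fun _ j => ∫ w, M.U w.Z * M.score M.γ₀ j w ∂M.law) 1

/-- The information matrix `Bᵀ D⁻¹ B`. -/
def info (K : ℕ) : Matrix (Fin p ⊕ Unit) (Fin p ⊕ Unit) ℝ :=
  (M.B K).transpose * (M.D K)⁻¹ * M.B K

/-- `V_K = (Bᵀ D⁻¹ B)⁻¹` -/
def V (K : ℕ) : Matrix (Fin p ⊕ Unit) (Fin p ⊕ Unit) ℝ := (M.info K)⁻¹

/-- `V_K^{-1/2}`, the inverse of the positive semidefinite square root of `V_K`. -/
def invSqrtV (K : ℕ) : Matrix (Fin p ⊕ Unit) (Fin p ⊕ Unit) ℝ := (CFC.sqrt (M.V K))⁻¹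

/-- `G_K(γ, θ) = ∑_{i ≤ N} g_K(T_i, Z_i; γ, θ)`, for the first `N` terms of a sample `w`. -/
def G (K N : ℕ) (w : ℕ → Obs r₁ r₂) (γ : Par p) (θ : ℝ) : Fin K ⊕ Unit → ℝ :=
  ∑ i ∈ Finset.range N, M.g K γ θ (w i)

/-- The optimally weighted GMM criterion `G_K(γ, θ)ᵀ D⁻¹ G_K(γ, θ)`. -/
def criterion (K N : ℕ) (w : ℕ → Obs r₁ r₂) (γ : Par p) (θ : ℝ) : ℝ :=
  dotProduct (M.G K N w γ θ) ((M.D K)⁻¹.mulVec (M.G K N w γ θ))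

/-- `(γ, θ)` minimizes the optimally weighted GMM criterion over `Γ × Θ`. -/
def IsBestGMM (K N : ℕ) (w : ℕ → Obs r₁ r₂) (γ : Par p) (θ : ℝ) : Prop :=
  γ ∈ M.Γ ∧ θ ∈ M.Θ ∧ ∀ γ' ∈ M.Γ, ∀ θ' ∈ M.Θ, M.criterion K N w γ θ ≤ M.criterion K N w γ' θ'

/-- The model and the parameter of interest: the propensity score is `π(Z; γ₀)`, the instrument
`X₂` is conditionally independent of `T` given `(X₁, Y)`, and `θ₀ = E[U(Z)]`, where `U(Z)` is a
nondegenerate square integrable random variable. -/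
structure Basic [IsProbabilityMeasure M.law] : Prop where
  measurable_pi : ∀ γ ∈ M.Γ, Measurable fun z => M.π z γ
  measurable_U : Measurable M.U
  propensity : M.law[Obs.T | sigmaZ r₁ r₂] =ᵐ[M.law] fun w => M.π w.Z M.γ₀
  exclusion : CondIndepFun (sigmaX₁Y r₁ r₂) sigmaX₁Y_le
    (Obs.X₂ (r₁ := r₁) (r₂ := r₂)) (Obs.T (r₁ := r₁) (r₂ := r₂)) M.law
  memLp_U : MemLp (fun w : Obs r₁ r₂ => M.U w.Z) 2 M.law
  var_U_pos : 0 < Var[fun w : Obs r₁ r₂ => M.U w.Z; M.law]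
  theta_eq : M.θ₀ = ∫ w, M.U w.Z ∂M.law

/-- Compact parameter spaces with the true values in their interiors; `γ₀` is the only `γ ∈ Γ`
that solves the conditional moment restriction `E[1 - T / π(Z; γ) | X] = 0`. -/
structure Identification : Prop where
  isCompact_Γ : IsCompact M.Γ
  γ₀_mem : M.γ₀ ∈ interior M.Γ
  isCompact_Θ : IsCompact M.Θ
  θ₀_mem : M.θ₀ ∈ interior M.Θ
  unique : ∀ γ ∈ M.Γ, M.law[M.rho γ | sigmaX r₁ r₂] =ᵐ[M.law] 0 → γ = M.γ₀

/-- The instrument `X₂` and the outcome `Y` are dependent (which is weaker than a nonzero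
correlation). -/
def InstrumentRelevant : Prop :=
  ¬ IndepFun (Obs.X₂ (r₁ := r₁) (r₂ := r₂)) (Obs.Y (r₁ := r₁) (r₂ := r₂)) M.law

/-- The support of `X` is a Cartesian product of compact intervals. -/
def BoxSupport : Prop := ∃ a b : Cov r₁ r₂, M.suppX = Set.Icc a b

/-- The basis functions are square integrable, the eigenvalues of `E[u_K(X) u_K(X)ᵀ]` are bounded
away from zero and infinity uniformly in `K ≥ p`, and linear combinations of `u_{1K}, …, u_{KK}`
can approximate every square integrable function of `X` in mean square as `K → ∞`. -/
structure Basis : Prop where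
  measurable : ∀ K, p ≤ K → ∀ k, Measurable (M.u K k)
  memLp : ∀ K, p ≤ K → ∀ k, MemLp (M.u K k) 2 M.lawX
  eigen : ∃ a A : ℝ, 0 < a ∧ ∀ K, p ≤ K → ∀ μ ∈ spectrum ℝ (M.gram K), a ≤ μ ∧ μ ≤ A
  span : ∀ f : Cov r₁ r₂ → ℝ, MemLp f 2 M.lawX → ∀ ε : ℝ, 0 < ε → ∀ᶠ K in atTop,
    ∃ c : Fin K → ℝ, ∫ x, (f x - ∑ k, c k * M.u K k x) ^ 2 ∂M.lawX < ε

/-- Regularity of the propensity score. The gradient and the bounds on the derivatives in `γ` are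
only used at interior points of `Γ`, where the derivatives are unambiguous. -/
structure Propensity : Prop where
  bounds : ∃ c C : ℝ, 0 < c ∧ C < 1 ∧ ∀ γ ∈ M.Γ, ∀ x ∈ M.suppX, ∀ y : ℝ,
    c ≤ M.π (x, y) γ ∧ M.π (x, y) γ ≤ C
  contDiff : ∀ x ∈ M.suppX, ∀ y : ℝ, ContDiffOn ℝ 2 (M.π (x, y)) M.Γ
  deriv_bounds : ∃ C : ℝ, ∀ γ ∈ interior M.Γ, ∀ x ∈ M.suppX, ∀ y : ℝ,
    ‖iteratedFDeriv ℝ 1 (M.π (x, y)) γ‖ ≤ C ∧ ‖iteratedFDeriv ℝ 2 (M.π (x, y)) γ‖ ≤ C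
  smooth : ∃ (s₀ : ℕ) (δ : ℝ), 0 < δ ∧ δ ≤ 1 ∧
    (∀ γ ∈ M.Γ, ∃ f, SSmooth s₀ δ M.suppX f ∧
      M.law[M.rho γ | sigmaX r₁ r₂] =ᵐ[M.law] fun w => f w.X) ∧
    (∀ γ ∈ interior M.Γ, ∀ j, ∃ f, SSmooth s₀ δ M.suppX f ∧
      M.law[M.score γ j | sigmaX r₁ r₂] =ᵐ[M.law] fun w => f w.X)

end Model

/-- The vector `√N (γ - γ₀, θ - θ₀)` multiplied by `V_K^{-1/2}`. -/
def Model.standardized {p r₁ r₂ : ℕ} (M : Model p r₁ r₂) (K N : ℕ) (γ : Par p) (θ : ℝ) :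
    FullPar p :=
  WithLp.toLp 2 ((M.invSqrtV K).mulVec
    (Sum.elim (fun j => √(N : ℝ) * (γ j - M.γ₀ j)) (fun _ => √(N : ℝ) * (θ - M.θ₀))))

end MNAR

end

set_option linter.unusedSectionVars false

/-! The criterion is a squared length in one fixed Hilbert space. The map `embed`, `v ↦ ∑ (D⁻¹v)_a
g_a`, carries `ℝ^{K+1}` with the inner product of `D⁻¹` isometrically onto the span of the moment
functions in `L²` of the law, so the criterion is `(N ‖embed (moment)‖)²` (`criterion_eq`). The
matrix `B` acquires a meaning that does not change with `K`: there are fixed functions `psi j` with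
`E[psi j · g_a] = B a j` for every `K` (`integral_psi_mul_g`). Hence `embed (B e_j)` is the
projection of `psi j` onto the span (`embed_B_eq`), and the information matrix is the Gram matrix of
these projections.

Because the basis is complete in mean square, the projections converge strongly to an operator `Q`
that dominates them in norm (`exists_limit_projection`). Invertibility of the information matrix at
a single `K ≥ p` then forces the `Q (psi j)` to be linearly independent, which yields a uniform
lower bound for the derivatives and a positive definite limit of the information matrices
(`exists_deriv_lower`, `exists_limit_sqrt`). The limit law comes from the fixed functions `Q (psi
j)`, so the classical central limit theorem is enough and the dependence of the moments on `K` only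
produces an error of vanishing variance.

Consistency of `γ` is obtained without a uniform law of large numbers over a growing class
(`tendsto_measure_lt_dist`): a wrong parameter is detected by one function of `X`, this function is
approximated by the basis, and its empirical correlation with `1 - T/π` is bounded by the square
root of the criterion. Consistency of `θ` is never needed, since the moments are affine in `θ`.

For the rate, `embed_moment` writes the embedded moments as `x + β d + R d` with `β` linear and `R`
a small remainder, and `exists_integral_noise_le` bounds all random constants in expectation. In
norm, `R` costs a factor `√K`, but its component along the range of `β` does not, because the
vectors `D⁻¹ B e_j` are bounded in `K`. Testing with `β d` therefore turns mere consistency into `d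
= O(√(K/N))`. A comparison with the linear minimizer `linEst` then leaves an error of order
`K^{3/2}/N` (`norm_sub_linear_minimizer_le`, `exists_rate`), which is negligible against `1/√N`
exactly when `K³/N → 0`. Slutsky's theorem concludes. -/

namespace MNAR

/-! ### Empirical means of an i.i.d. sample: expectation and variance. -/

section EmpiricalMean

variable {𝒲 Ω : Type*}

/-- The empirical mean of `f` over the first `N` terms of the sample `w`. -/
noncomputable def emean (f : 𝒲 → ℝ) (N : ℕ) (w : ℕ → 𝒲) : ℝ :=
  (N : ℝ)⁻¹ * ∑ i ∈ Finset.range N, f (w i)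

lemma emean_add (f g : 𝒲 → ℝ) (N : ℕ) (w : ℕ → 𝒲) :
    emean (fun x => f x + g x) N w = emean f N w + emean g N w := by
  simp only [emean, Finset.sum_add_distrib, mul_add]

lemma emean_sub (f g : 𝒲 → ℝ) (N : ℕ) (w : ℕ → 𝒲) :
    emean (fun x => f x - g x) N w = emean f N w - emean g N w := by
  simp only [emean, Finset.sum_sub_distrib, mul_sub]

lemma emean_const_mul (c : ℝ) (f : 𝒲 → ℝ) (N : ℕ) (w : ℕ → 𝒲) :
    emean (fun x => c * f x) N w = c * emean f N w := by
  simp only [emean, ← Finset.mul_sum]; ring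

lemma emean_sum {ι : Type*} (s : Finset ι) (f : ι → 𝒲 → ℝ) (N : ℕ) (w : ℕ → 𝒲) :
    emean (fun x => ∑ j ∈ s, f j x) N w = ∑ j ∈ s, emean (f j) N w := by
  simp only [emean, Finset.mul_sum]
  rw [Finset.sum_comm]

lemma emean_const (c : ℝ) {N : ℕ} (hN : N ≠ 0) (w : ℕ → 𝒲) :
    emean (fun _ => c) N w = c := by
  have : (N : ℝ) ≠ 0 := by exact_mod_cast hN
  simp [emean, this]

lemma emean_nonneg {f : 𝒲 → ℝ} (hf : ∀ x, 0 ≤ f x) (N : ℕ) (w : ℕ → 𝒲) : 0 ≤ emean f N w :=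
  mul_nonneg (by positivity) (Finset.sum_nonneg fun _ _ => hf _)

lemma emean_mono {f g : 𝒲 → ℝ} {N : ℕ} {w : ℕ → 𝒲} (h : ∀ i, f (w i) ≤ g (w i)) :
    emean f N w ≤ emean g N w :=
  mul_le_mul_of_nonneg_left (Finset.sum_le_sum fun i _ => h i) (by positivity)

lemma sq_emean_le (f : 𝒲 → ℝ) (N : ℕ) (w : ℕ → 𝒲) :
    emean f N w ^ 2 ≤ emean (fun x => f x ^ 2) N w := by
  rcases Nat.eq_zero_or_pos N with rfl | hN
  · simp [emean]
  have hN' : (0 : ℝ) < N := by exact_mod_cast hN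
  have h := sq_sum_le_card_mul_sum_sq (s := Finset.range N) (f := fun i => f (w i))
  rw [Finset.card_range] at h
  rw [emean, emean, mul_pow]
  calc (N : ℝ)⁻¹ ^ 2 * (∑ i ∈ Finset.range N, f (w i)) ^ 2
      ≤ (N : ℝ)⁻¹ ^ 2 * (N * ∑ i ∈ Finset.range N, f (w i) ^ 2) := by gcongr
    _ = _ := by field_simp

variable [MeasurableSpace 𝒲] [MeasurableSpace Ω] {μ : Measure 𝒲} {P : Measure Ω} {W : ℕ → Ω → 𝒲}

lemma HasLaw.integral_comp' {i : ℕ} (hlaw : ∀ i, HasLaw (W i) μ P) {f : 𝒲 → ℝ}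
    (hf : AEStronglyMeasurable f μ) : ∫ ω, f (W i ω) ∂P = ∫ x, f x ∂μ :=
  (hlaw i).integral_comp hf

lemma HasLaw.integrable_comp' {i : ℕ} (hlaw : ∀ i, HasLaw (W i) μ P) {f : 𝒲 → ℝ}
    (hf : Integrable f μ) : Integrable (fun ω => f (W i ω)) P := by
  have h := (hlaw i).map_eq ▸ hf
  exact h.comp_aemeasurable (hlaw i).aemeasurable

lemma HasLaw.memLp_comp' {i : ℕ} (hlaw : ∀ i, HasLaw (W i) μ P) {f : 𝒲 → ℝ}
    (hf : MemLp f 2 μ) : MemLp (fun ω => f (W i ω)) 2 P := by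
  have h := (hlaw i).map_eq ▸ hf
  exact h.comp_of_map (hlaw i).aemeasurable

lemma integrable_emean (hlaw : ∀ i, HasLaw (W i) μ P) {f : 𝒲 → ℝ} (hf : Integrable f μ) (N : ℕ) :
    Integrable (fun ω => emean f N (fun i => W i ω)) P :=
  (integrable_finsetSum _ fun _ _ => HasLaw.integrable_comp' hlaw hf).const_mul _

lemma integral_emean (hlaw : ∀ i, HasLaw (W i) μ P) {f : 𝒲 → ℝ} (hf : Integrable f μ) {N : ℕ}
    (hN : N ≠ 0) : ∫ ω, emean f N (fun i => W i ω) ∂P = ∫ x, f x ∂μ := by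
  have : (N : ℝ) ≠ 0 := by exact_mod_cast hN
  simp only [emean]
  rw [integral_const_mul, integral_finsetSum _ fun _ _ => HasLaw.integrable_comp' hlaw hf]
  simp [HasLaw.integral_comp' hlaw hf.aestronglyMeasurable, this]

lemma memLp_emean (hlaw : ∀ i, HasLaw (W i) μ P) {f : 𝒲 → ℝ} (hf : MemLp f 2 μ) (N : ℕ) :
    MemLp (fun ω => emean f N (fun i => W i ω)) 2 P :=
  (memLp_finsetSum _ fun _ _ => HasLaw.memLp_comp' hlaw hf).const_mul _

/-- Variances of independent summands add, and a variance is at most a second moment. All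
concentration in the proof is this bound combined with Markov's inequality; since `f` enters only
through its second moment, `f` may vary with `N`. -/
lemma integral_emean_sub_sq_le [IsProbabilityMeasure μ] [IsProbabilityMeasure P]
    (hlaw : ∀ i, HasLaw (W i) μ P)
    (hindep : iIndepFun W P) {f : 𝒲 → ℝ} (hf : MemLp f 2 μ) {N : ℕ} (hN : N ≠ 0) :
    ∫ ω, (emean f N (fun i => W i ω) - ∫ x, f x ∂μ) ^ 2 ∂P ≤ (∫ x, f x ^ 2 ∂μ) / N := by
  have hN' : (N : ℝ) ≠ 0 := by exact_mod_cast hN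
  have hind : iIndepFun (fun i ω => f (W i ω)) P :=
    hindep.comp₀ (fun _ => f) (fun i => (hlaw i).aemeasurable)
      (fun i => (hlaw i).map_eq ▸ hf.aemeasurable)
  have hvar : ∀ i, Var[fun ω => f (W i ω); P] = Var[f; μ] := fun i => by
    rw [← (hlaw i).map_eq, variance_map ((hlaw i).map_eq ▸ hf.aemeasurable) (hlaw i).aemeasurable]
    rfl
  have h1 := IndepFun.variance_sum (s := Finset.range N) (X := fun i ω => f (W i ω)) (μ := P)
    (fun i _ => HasLaw.memLp_comp' hlaw hf) (fun i _ j _ hij => hind.indepFun hij)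
  simp only [hvar, Finset.sum_const, Finset.card_range, nsmul_eq_mul] at h1
  have h2 : ∫ ω, (emean f N (fun i => W i ω) - ∫ x, f x ∂μ) ^ 2 ∂P
      = Var[fun ω => emean f N (fun i => W i ω); P] := by
    rw [variance_eq_integral (memLp_emean hlaw hf N).aemeasurable,
      integral_emean hlaw (hf.integrable one_le_two) hN]
  have h3 : Var[fun ω => emean f N (fun i => W i ω); P] = Var[f; μ] / N := by
    have : (fun ω => emean f N (fun i => W i ω)) =
        fun ω => (N : ℝ)⁻¹ * (∑ i ∈ Finset.range N, fun ω => f (W i ω)) ω := by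
      ext ω; simp [emean]
    rw [this, variance_const_mul, h1]; field_simp
  rw [h2, h3]
  gcongr
  exact variance_le_expectation_sq hf.aestronglyMeasurable

end EmpiricalMean

/-! ### The multivariate central limit theorem by the Cramér–Wold device. -/

section CLT

variable {ι 𝒲 Ω : Type*} [Fintype ι] [MeasurableSpace 𝒲] [MeasurableSpace Ω]
  {μ : Measure 𝒲} [IsProbabilityMeasure μ] {P : Measure Ω} [IsProbabilityMeasure P]
  {W : ℕ → Ω → 𝒲}

/-- The multivariate central limit theorem for standardized vectors. -/
theorem tendstoInDistribution_stdGaussian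
    (hlaw : ∀ i, HasLaw (W i) μ P) (hindep : iIndepFun W P) (F : 𝒲 → EuclideanSpace ℝ ι)
    (hF : ∀ j, MemLp (fun x => F x j) 2 μ) (h0 : ∀ j, ∫ x, F x j ∂μ = 0)
    (h1 : ∀ t : EuclideanSpace ℝ ι, ∫ x, (inner ℝ (F x) t) ^ 2 ∂μ = ‖t‖ ^ 2) :
    TendstoInDistribution
      (fun (N : ℕ) (ω : Ω) => (√(N : ℝ))⁻¹ • ∑ i ∈ Finset.range N, F (W i ω)) atTop
      (id : EuclideanSpace ℝ ι → EuclideanSpace ℝ ι) (fun _ => P)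
      (stdGaussian (EuclideanSpace ℝ ι)) := by
  have hFm : AEMeasurable F μ := by
    have : AEMeasurable (fun x => WithLp.toLp 2 (fun j => F x j)) μ :=
      (WithLp.measurable_toLp 2 (ι → ℝ)).comp_aemeasurable
        (aemeasurable_pi_lambda _ fun j => (hF j).aemeasurable)
    exact this
  have hFW : ∀ i, AEMeasurable (fun ω => F (W i ω)) P := fun i =>
    ((hlaw i).map_eq ▸ hFm).comp_aemeasurable (hlaw i).aemeasurable
  have hm : ∀ N : ℕ, AEMeasurable
      (fun ω => (√(N : ℝ))⁻¹ • ∑ i ∈ Finset.range N, F (W i ω)) P := fun N => by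
    change AEMeasurable ((√(N : ℝ))⁻¹ • fun ω => ∑ i ∈ Finset.range N, F (W i ω)) P
    exact (Finset.aemeasurable_fun_sum _ fun i _ => hFW i).const_smul _
  refine ⟨hm, aemeasurable_id, ?_⟩
  refine ProbabilityMeasure.tendsto_iff_tendsto_charFun.2 fun t => ?_
  have hft : MemLp (fun x => inner ℝ (F x) t) 2 μ := by
    have : (fun x => inner ℝ (F x) t) = fun x => ∑ j, t j * F x j := by
      ext x; simp [PiLp.inner_apply]
    rw [this]
    exact memLp_finsetSum _ fun j _ => (hF j).const_mul _
  have hmean : ∫ x, inner ℝ (F x) t ∂μ = 0 := by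
    have : (fun x => inner ℝ (F x) t) = fun x => ∑ j, t j * F x j := by
      ext x; simp [PiLp.inner_apply]
    rw [this, integral_finsetSum _ fun j _ => ((hF j).integrable one_le_two).const_mul _]
    simp [integral_const_mul, h0]
  set X : ℕ → Ω → ℝ := fun i ω => inner ℝ (F (W i ω)) t with hX
  have hXl : ∀ i, HasLaw (X i) (μ.map fun x => inner ℝ (F x) t) P := fun i => by
    refine ⟨(HasLaw.memLp_comp' hlaw hft).aemeasurable, ?_⟩
    rw [← (hlaw i).map_eq, AEMeasurable.map_map_of_aemeasurable
      ((hlaw i).map_eq ▸ hft.aemeasurable) (hlaw i).aemeasurable]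
    rfl
  have hvar : Var[X 0; P] = ‖t‖ ^ 2 := by
    rw [variance_eq_integral (hXl 0).aemeasurable]
    have e : ∫ ω, X 0 ω ∂P = 0 := by
      rw [← hmean]; exact HasLaw.integral_comp' hlaw hft.aestronglyMeasurable
    rw [e]
    simp only [sub_zero]
    rw [← h1 t]
    exact HasLaw.integral_comp' (f := fun x => (inner ℝ (F x) t) ^ 2) hlaw
      (hft.aestronglyMeasurable.pow 2)
  have e0 : ∫ ω, X 0 ω ∂P = 0 := by
    rw [← hmean]; exact HasLaw.integral_comp' hlaw hft.aestronglyMeasurable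
  -- The one-dimensional theorem for the projections on `t`. The characteristic function of the
  -- projected sum at `1` is that of the vector sum at `t`, so evaluating the limit at `1` settles
  -- the vector case.
  have hclt := tendstoInDistribution_inv_sqrt_mul_sum_sub (P := P) (X := X)
    (P' := gaussianReal 0 Var[X 0; P].toNNReal) (Y := id) HasLaw.id
    (HasLaw.memLp_comp' hlaw hft)
    (hindep.comp₀ (fun _ x => inner ℝ (F x) t) (fun i => (hlaw i).aemeasurable)
      (fun i => (hlaw i).map_eq ▸ hft.aemeasurable))
    (fun i => (hXl i).identDistrib (hXl 0))
  have hc := ProbabilityMeasure.tendsto_iff_tendsto_charFun.1 hclt.tendsto 1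
  simp only [ProbabilityMeasure.coe_mk, Measure.map_id] at hc ⊢
  rw [charFun_gaussianReal, hvar] at hc
  rw [charFun_stdGaussian]
  have hv : (((‖t‖ ^ 2).toNNReal : ℝ) : ℂ) = ((‖t‖ : ℝ) : ℂ) ^ 2 := by
    rw [Real.coe_toNNReal _ (by positivity)]; norm_cast
  have hexp : Complex.exp ((1 : ℝ) * ((0 : ℝ) : ℂ) * Complex.I
      - (((‖t‖ ^ 2).toNNReal : ℝ) : ℂ) * ((1 : ℝ) : ℂ) ^ 2 / 2)
      = Complex.exp (-((‖t‖ : ℝ) : ℂ) ^ 2 / 2) := by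
    rw [hv]; congr 1; push_cast; ring
  rw [hexp] at hc
  refine hc.congr fun N => ?_
  rw [charFun_apply, charFun_apply, integral_map (hm N) (by fun_prop),
    integral_map (hclt.forall_aemeasurable N) (by fun_prop)]
  congr 1
  ext ω
  congr 3
  rw [e0, real_inner_smul_left, sum_inner]
  simp [hX]

end CLT

/-! ### Strong limits of orthogonal projections. -/

section Projection

variable {ℋ : Type*} [NormedAddCommGroup ℋ] [InnerProductSpace ℝ ℋ] [CompleteSpace ℋ]

/-- If the projections onto `S k` eventually reproduce every element of every `S k`, they converge
strongly to a projection. -/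
lemma tendsto_starProjection (S : ℕ → Submodule ℝ ℋ) [∀ k, (S k).HasOrthogonalProjection] (k₀ : ℕ)
    (hS : ∀ k, k₀ ≤ k → ∀ s ∈ S k, Tendsto (fun l => (S l).starProjection s) atTop (𝓝 s)) :
    ∃ Q : ℋ →L[ℝ] ℋ, (∀ v, Tendsto (fun k => (S k).starProjection v) atTop (𝓝 (Q v))) ∧
      ∀ k, k₀ ≤ k → ∀ v, ‖(S k).starProjection v‖ ≤ ‖Q v‖ := by
  -- The vectors reproduced in the limit form a subspace, closed because projections are
  -- contractions. It therefore contains the closure `H` of the sum of all `S k` with `k ≥ k₀`,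
  -- although the `S k` need not be nested.
  let A : Submodule ℝ ℋ :=
    { carrier := {v | Tendsto (fun l => (S l).starProjection v) atTop (𝓝 v)}
      add_mem' := fun {a b} ha hb => by
        simpa only [Set.mem_ofPred_eq, map_add] using Tendsto.add ha hb
      zero_mem' := by simp
      smul_mem' := fun c a ha => by
        simpa only [Set.mem_ofPred_eq, map_smul] using Tendsto.const_smul ha c }
  have hA : IsClosed (A : Set ℋ) := by
    refine isClosed_of_closure_subset fun v hv => ?_
    change Tendsto (fun l => (S l).starProjection v) atTop (𝓝 v)
    rw [Metric.tendsto_atTop]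
    intro ε hε
    obtain ⟨a, ha, hva⟩ := Metric.mem_closure_iff.1 hv (ε / 3) (by positivity)
    obtain ⟨n, hn⟩ := Metric.tendsto_atTop.1 (show Tendsto _ _ _ from ha) (ε / 3) (by positivity)
    refine ⟨n, fun l hl => ?_⟩
    have h1 : dist ((S l).starProjection v) ((S l).starProjection a) ≤ dist v a := by
      rw [dist_eq_norm, dist_eq_norm, ← map_sub]
      exact (S l).norm_starProjection_apply_le _
    have h2 := hn l hl
    have h3 := dist_triangle4 ((S l).starProjection v) ((S l).starProjection a) a v
    rw [dist_comm a v] at h3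
    linarith
  set H : Submodule ℝ ℋ := (⨆ k : {k // k₀ ≤ k}, S k).topologicalClosure with hH
  have : CompleteSpace H := by
    rw [hH]; exact IsClosed.completeSpace_coe (hs := Submodule.isClosed_topologicalClosure _)
  have hHA : H ≤ A := Submodule.topologicalClosure_minimal _
    (iSup_le fun k s hs => hS k k.2 s hs) hA
  have hSH : ∀ k, k₀ ≤ k → S k ≤ H := fun k hk =>
    (le_iSup (fun k : {k // k₀ ≤ k} => S k) ⟨k, hk⟩).trans (Submodule.le_topologicalClosure _)
  -- Projecting onto `S k` factors through `H`. This gives convergence for arbitrary vectors and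
  -- also the domination in norm.
  have hcomp : ∀ k, k₀ ≤ k → ∀ v, (S k).starProjection (H.starProjection v)
      = (S k).starProjection v := fun k hk v => by
    have h := Submodule.starProjection_comp_starProjection_of_le (hSH k hk)
    exact congrArg (fun L : ℋ →L[ℝ] ℋ => L v) h
  refine ⟨H.starProjection, fun v => ?_, fun k hk v => ?_⟩
  · have h : Tendsto (fun l => (S l).starProjection (H.starProjection v)) atTop
        (𝓝 (H.starProjection v)) := hHA (H.starProjection_apply_mem v)
    refine h.congr' ?_
    filter_upwards [eventually_ge_atTop k₀] with k hk using hcomp k hk v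
  · rw [← hcomp k hk v]
    exact (S k).norm_starProjection_apply_le _

end Projection

/-! ### Continuity of the positive semidefinite square root. -/

section MatrixSqrt

variable {n : Type*} [Fintype n]

lemma posSemidef_of_tendsto {A : ℕ → Matrix n n ℝ} {B : Matrix n n ℝ}
    (hA : ∀ᶠ k in atTop, (A k).PosSemidef) (hB : Tendsto A atTop (𝓝 B)) : B.PosSemidef := by
  refine Matrix.PosSemidef.of_dotProduct_mulVec_nonneg ?_ fun x => ?_
  · have h1 : Tendsto (fun k => (A k).conjTranspose) atTop (𝓝 B.conjTranspose) :=
      (continuous_id.matrix_conjTranspose.tendsto B).comp hB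
    refine tendsto_nhds_unique (h1.congr' ?_) hB
    filter_upwards [hA] with k hk using hk.1
  · have h1 : Tendsto (fun k => dotProduct (star x) ((A k).mulVec x)) atTop
        (𝓝 (dotProduct (star x) (B.mulVec x))) := by
      have : Continuous fun M : Matrix n n ℝ => dotProduct (star x) (M.mulVec x) := by fun_prop
      exact (this.tendsto B).comp hB
    refine ge_of_tendsto h1 ?_
    filter_upwards [hA] with k hk using hk.dotProduct_mulVec_nonneg x

variable [DecidableEq n]

/-- A diagonal entry of `A` is the sum of squares of a row of its symmetric square root. Hence the
roots of a bounded sequence stay in a compact set. -/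
lemma sq_sqrt_apply_le {A : Matrix n n ℝ} (hA : A.PosSemidef) (i j : n) :
    (CFC.sqrt A) i j ^ 2 ≤ A i i := by
  have h1 : CFC.sqrt A * CFC.sqrt A = A := CFC.sqrt_mul_sqrt_self A hA.nonneg
  have h2 : (CFC.sqrt A).PosSemidef := Matrix.nonneg_iff_posSemidef.1 (CFC.sqrt_nonneg A)
  have h3 : A i i = ∑ l, (CFC.sqrt A) i l ^ 2 := by
    conv_lhs => rw [← h1]
    rw [Matrix.mul_apply]
    refine Finset.sum_congr rfl fun l _ => ?_
    have := h2.1.apply i l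
    simp only [star_trivial] at this
    rw [this]; ring
  rw [h3]
  exact Finset.single_le_sum (f := fun l => (CFC.sqrt A) i l ^ 2) (fun _ _ => sq_nonneg _)
    (Finset.mem_univ j)

/-- Compactness and uniqueness: every subsequence of the roots has a convergent further subsequence,
whose limit is positive semidefinite and squares to `B`, so it is the root of `B`. -/
lemma tendsto_matrix_sqrt {A : ℕ → Matrix n n ℝ} {B : Matrix n n ℝ}
    (hA : ∀ᶠ k in atTop, (A k).PosSemidef) (hB : Tendsto A atTop (𝓝 B)) :
    Tendsto (fun k => CFC.sqrt (A k)) atTop (𝓝 (CFC.sqrt B)) := by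
  have hBp := posSemidef_of_tendsto hA hB
  refine tendsto_of_subseq_tendsto fun ns hns => ?_
  have hbd : ∀ᶠ k in atTop, CFC.sqrt (A k) ∈
      (Set.univ.pi fun i => Set.univ.pi fun _ => Set.Icc (-(B i i + 2)) (B i i + 2) :
        Set (n → n → ℝ)) := by
    have hd : ∀ᶠ k in atTop, ∀ i, A k i i ≤ B i i + 1 := by
      rw [eventually_all]
      intro i
      have : Tendsto (fun k => A k i i) atTop (𝓝 (B i i)) :=
        tendsto_pi_nhds.1 (tendsto_pi_nhds.1 hB i) i
      exact this.eventually_le_const (by linarith)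
    filter_upwards [hA, hd] with k hk hd
    intro i _ j _
    have h1 := sq_sqrt_apply_le hk i j
    have h2 := hd i
    have h3 : 0 ≤ A k i i := (sq_nonneg _).trans h1
    rw [Set.mem_Icc, ← abs_le]
    refine abs_le_of_sq_le_sq (h1.trans (h2.trans ?_)) (by linarith)
    nlinarith
  have hcpt : IsCompact (Set.univ.pi fun i => Set.univ.pi fun _ =>
      Set.Icc (-(B i i + 2)) (B i i + 2) : Set (n → n → ℝ)) :=
    isCompact_univ_pi fun i => isCompact_univ_pi fun _ => isCompact_Icc
  obtain ⟨C, ms, hms, hC'⟩ : ∃ (C : Matrix n n ℝ) (ms : ℕ → ℕ), StrictMono ms ∧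
      Tendsto (fun k => CFC.sqrt (A (ns (ms k)))) atTop (𝓝 C) := by
    obtain ⟨C, -, ms, hms, hC⟩ := hcpt.tendsto_subseq' ((hns.eventually hbd).frequently)
    exact ⟨C, ms, hms, hC⟩
  refine ⟨ms, ?_⟩
  have hsub : Tendsto (fun k => ns (ms k)) atTop atTop := hns.comp hms.tendsto_atTop
  have hCp : C.PosSemidef := posSemidef_of_tendsto
    (Eventually.of_forall fun k => Matrix.nonneg_iff_posSemidef.1 (CFC.sqrt_nonneg _)) hC'
  have hCC : C * C = B := by
    have h1 : Tendsto (fun k => CFC.sqrt (A (ns (ms k))) * CFC.sqrt (A (ns (ms k)))) atTop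
        (𝓝 (C * C)) := hC'.mul hC'
    refine tendsto_nhds_unique (h1.congr' ?_) (hB.comp hsub)
    filter_upwards [hsub.eventually hA] with k hk
    exact CFC.sqrt_mul_sqrt_self _ hk.nonneg
  rw [CFC.sqrt_unique hCC hCp.nonneg]

  exact hC'

end MatrixSqrt

end MNAR

/-! ### Measurability and bounds for the propensity score and its gradient. -/

namespace MNAR

section Measurability
variable {r₁ r₂ : ℕ}

@[fun_prop]
lemma Obs.measurable_T : Measurable (Obs.T (r₁ := r₁) (r₂ := r₂)) := by
  have h : Measurable fun b : Bool => (if b then (1 : ℝ) else 0) := measurable_of_countable _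
  exact h.comp measurable_fst

@[fun_prop]
lemma Obs.measurable_Z : Measurable (Obs.Z (r₁ := r₁) (r₂ := r₂)) := measurable_snd

@[fun_prop]
lemma Obs.measurable_X : Measurable (Obs.X (r₁ := r₁) (r₂ := r₂)) :=
  measurable_fst.comp measurable_snd

lemma Obs.T_eq (w : Obs r₁ r₂) : w.T = 0 ∨ w.T = 1 := by
  unfold Obs.T; split_ifs <;> simp

lemma Obs.T_mul_self (w : Obs r₁ r₂) : w.T * w.T = w.T := by
  rcases w.T_eq with h | h <;> simp [h]

lemma Obs.abs_T_le (w : Obs r₁ r₂) : |w.T| ≤ 1 := by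
  rcases w.T_eq with h | h <;> simp [h]

end Measurability

/-- A bounded multiple of a square integrable function is square integrable. -/
lemma memLp_bdd_mul {α : Type*} [MeasurableSpace α] {μ : Measure α} {b f : α → ℝ} {C : ℝ}
    (hb : AEStronglyMeasurable b μ) (hC : ∀ᵐ x ∂μ, |b x| ≤ C) (hf : MemLp f 2 μ) :
    MemLp (fun x => b x * f x) 2 μ := by
  refine hf.of_le_mul (c := C) (hb.mul hf.aestronglyMeasurable) ?_
  filter_upwards [hC] with x hx
  rw [norm_mul]
  exact mul_le_mul_of_nonneg_right hx (norm_nonneg _)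

lemma integrable_bdd_mul {α : Type*} [MeasurableSpace α] {μ : Measure α} {b f : α → ℝ} {C : ℝ}
    (hb : AEStronglyMeasurable b μ) (hC : ∀ᵐ x ∂μ, |b x| ≤ C) (hf : Integrable f μ) :
    Integrable (fun x => b x * f x) μ :=
  hf.bdd_mul hb hC

namespace Model
variable {p r₁ r₂ : ℕ} (M : Model p r₁ r₂)

/-- The functions of `Z` that multiply `1 - T / π` in the moment function. -/
def phi (K : ℕ) (a : Fin K ⊕ Unit) (z : ZVal r₁ r₂) : ℝ :=
  Sum.elim (fun k => M.u K k z.1) (fun _ => M.U z) a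

/-- The `j`-th coordinate of the gradient of the propensity score at `γ₀`. -/
noncomputable def grad (j : Fin p) (z : ZVal r₁ r₂) : ℝ := gradient (M.π z) M.γ₀ j

/-- The `j`-th coordinate of the gradient of `1 - T / π` at `γ₀`. -/
noncomputable def slope (j : Fin p) (w : Obs r₁ r₂) : ℝ := w.T * (M.grad j w.Z / M.π w.Z M.γ₀ ^ 2)

/-- Square integrable functions whose inner products with the moment functions are the entries
of `B`. -/
noncomputable def psi (j : Fin p ⊕ Unit) (w : Obs r₁ r₂) : ℝ :=
  Sum.elim (fun j => M.rho M.γ₀ w * (M.grad j w.Z / (1 - M.π w.Z M.γ₀)))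
    (fun _ => (M.θ₀ - M.U w.Z) / Var[fun w : Obs r₁ r₂ => M.U w.Z; M.law]) j

/-- The indicator of the last coordinate. -/
def lastInd {κ : Type*} (a : κ ⊕ Unit) : ℝ := Sum.elim (fun _ => 0) (fun _ => 1) a

/-- Adding and subtracting `U` gives the last moment the same shape as the others. All dependence on
`γ` sits in the scalar `rho`, and what remains is affine in `θ`. -/
lemma g_eq (K : ℕ) (γ : Par p) (θ : ℝ) (w : Obs r₁ r₂) (a : Fin K ⊕ Unit) :
    M.g K γ θ w a = M.rho γ w * M.phi K a w.Z + lastInd a * (θ - M.U w.Z) := by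
  rcases a with k | _
  · simp [g, phi, lastInd, Obs.X, Obs.Z]
  · simp [g, phi, lastInd, rho]; ring

lemma score_eq (j : Fin p) (w : Obs r₁ r₂) :
    M.score M.γ₀ j w = M.grad j w.Z / M.π w.Z M.γ₀ := rfl

section Facts
variable {M} [IsProbabilityMeasure M.law]

lemma ae_X_mem_suppX : ∀ᵐ w ∂M.law, w.X ∈ M.suppX := by
  have h : ∀ᵐ x ∂M.lawX, x ∈ M.suppX := Measure.support_mem_ae
  exact ae_of_ae_map Obs.measurable_X.aemeasurable h

lemma ae_map_Z_fst_mem_suppX : ∀ᵐ z ∂(M.law.map Obs.Z), z.1 ∈ M.suppX := by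
  have h : ∀ᵐ x ∂M.lawX, x ∈ M.suppX := Measure.support_mem_ae
  have e : M.lawX = (M.law.map Obs.Z).map Prod.fst := by
    rw [Measure.map_map measurable_fst Obs.measurable_Z]; rfl
  rw [e] at h
  exact ae_of_ae_map measurable_fst.aemeasurable h

lemma Identification.γ₀_mem_Γ (hi : M.Identification) : M.γ₀ ∈ M.Γ := interior_subset hi.γ₀_mem

lemma measurable_pi₀ (hb : M.Basic) (hi : M.Identification) : Measurable fun z => M.π z M.γ₀ :=
  hb.measurable_pi _ hi.γ₀_mem_Γ

lemma measurable_rho (hb : M.Basic) {γ : Par p} (hγ : γ ∈ M.Γ) : Measurable (M.rho γ) := by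
  have := (hb.measurable_pi γ hγ).comp (Obs.measurable_Z (r₁ := r₁) (r₂ := r₂))
  exact measurable_const.sub (Obs.measurable_T.div this)

/-- Conditioning on `Z` replaces `T` by the propensity score. Almost everywhere measurability of `f`
is allowed because the gradient of `π` is only known to be measurable in that sense. -/
lemma integral_T_mul (hb : M.Basic) {f : ZVal r₁ r₂ → ℝ}
    (hf : AEStronglyMeasurable f (M.law.map Obs.Z))
    (hfi : Integrable (fun w => f w.Z) M.law) :
    ∫ w, w.T * f w.Z ∂M.law = ∫ w, M.π w.Z M.γ₀ * f w.Z ∂M.law := by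
  -- A genuinely measurable version is needed: pulling `f` out of the conditional expectation
  -- requires measurability with respect to `σ(Z)` itself.
  set f' := hf.mk f with hf'
  have hm : StronglyMeasurable f' := hf.stronglyMeasurable_mk
  have hae : (fun w : Obs r₁ r₂ => f w.Z) =ᵐ[M.law] fun w => f' w.Z :=
    ae_of_ae_map Obs.measurable_Z.aemeasurable hf.ae_eq_mk
  have hfi' : Integrable (fun w => f' w.Z) M.law := hfi.congr hae
  have hle : sigmaZ r₁ r₂ ≤ (inferInstance : MeasurableSpace (Obs r₁ r₂)) :=
    Obs.measurable_Z.comap_le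
  have hTi : Integrable (Obs.T (r₁ := r₁) (r₂ := r₂)) M.law :=
    Integrable.of_bound Obs.measurable_T.aestronglyMeasurable 1
      (Eventually.of_forall fun w => w.abs_T_le)
  have hmZ : StronglyMeasurable[sigmaZ r₁ r₂] (fun w : Obs r₁ r₂ => f' w.Z) :=
    hm.comp_measurable (comap_measurable _)
  have hTf : Integrable (Obs.T * fun w => f' w.Z) M.law :=
    hfi'.bdd_mul Obs.measurable_T.aestronglyMeasurable
      (Eventually.of_forall fun w => w.abs_T_le)
  have h1 := condExp_mul_of_stronglyMeasurable_right (μ := M.law) (m := sigmaZ r₁ r₂) hmZ hTf hTi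
  have h2 : ∫ w, w.T * f w.Z ∂M.law = ∫ w, ((Obs.T * fun w : Obs r₁ r₂ => f' w.Z : Obs r₁ r₂ → ℝ)) w ∂M.law := by
    refine integral_congr_ae ?_
    filter_upwards [hae] with w hw
    simp [hw]
  rw [h2, ← integral_condExp hle]
  refine integral_congr_ae ?_
  filter_upwards [h1, hae, hb.propensity] with w h1 h2 h3
  rw [h1, Pi.mul_apply, h3, h2]

lemma aestronglyMeasurable_comp_Z {f : ZVal r₁ r₂ → ℝ}
    (hf : AEStronglyMeasurable f (M.law.map Obs.Z)) :
    AEStronglyMeasurable (fun w => f w.Z) M.law :=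
  hf.comp_measurable Obs.measurable_Z

/-- Constants that bound the propensity score and its inverse. -/
lemma exists_pi_bounds (hp : M.Propensity) : ∃ c : ℝ, 0 < c ∧ c < 1 ∧
    ∀ γ ∈ M.Γ, ∀ x ∈ M.suppX, ∀ y : ℝ, c ≤ M.π (x, y) γ ∧ c ≤ 1 - M.π (x, y) γ ∧
      M.π (x, y) γ ≤ 1 := by
  obtain ⟨c, C, hc, hC, h⟩ := hp.bounds
  refine ⟨min (min c (1 - C)) (1 / 2), ?_, ?_, fun γ hγ x hx y => ?_⟩
  · exact lt_min (lt_min hc (by linarith)) (by norm_num)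
  · exact (min_le_right _ _).trans_lt (by norm_num)
  · have := h γ hγ x hx y
    have h1 : min (min c (1 - C)) (1 / 2) ≤ c := (min_le_left _ _).trans (min_le_left _ _)
    have h2 : min (min c (1 - C)) (1 / 2) ≤ 1 - C := (min_le_left _ _).trans (min_le_right _ _)
    exact ⟨by linarith [this.1], by linarith [this.2], by linarith [this.2]⟩

lemma exists_rho_bound (hp : M.Propensity) : ∃ C : ℝ, 0 < C ∧
    ∀ γ ∈ M.Γ, ∀ w : Obs r₁ r₂, w.X ∈ M.suppX → |M.rho γ w| ≤ C := by
  obtain ⟨c, hc, -, h⟩ := exists_pi_bounds hp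
  refine ⟨1 + c⁻¹, by positivity, fun γ hγ w hw => ?_⟩
  have h1 := (h γ hγ w.X hw w.Y).1
  have h2 : |w.T / M.π w.Z γ| ≤ c⁻¹ := by
    rw [abs_div, div_eq_mul_inv]
    have h3 : c ≤ |M.π w.Z γ| := h1.trans (le_abs_self _)
    calc |w.T| * |M.π w.Z γ|⁻¹ ≤ 1 * c⁻¹ := by
          gcongr; exact w.abs_T_le
      _ = c⁻¹ := one_mul _
  calc |M.rho γ w| ≤ |(1 : ℝ)| + |w.T / M.π w.Z γ| := abs_sub _ _
    _ ≤ 1 + c⁻¹ := by rw [abs_one]; linarith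

lemma ae_rho₀_bound (hi : M.Identification) (hp : M.Propensity) :
    ∃ C : ℝ, ∀ᵐ w ∂M.law, |M.rho M.γ₀ w| ≤ C := by
  obtain ⟨C, -, h⟩ := exists_rho_bound hp
  exact ⟨C, by filter_upwards [ae_X_mem_suppX] with w hw using h _ hi.γ₀_mem_Γ w hw⟩

section Gradient

lemma grad_eq_fderiv (j : Fin p) (z : ZVal r₁ r₂) :
    M.grad j z = fderiv ℝ (M.π z) M.γ₀ (EuclideanSpace.single j 1) := by
  have h := InnerProductSpace.toDual_symm_apply (𝕜 := ℝ) (x := EuclideanSpace.single j 1)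
    (y := fderiv ℝ (M.π z) M.γ₀)
  rw [grad, gradient, ← h, real_inner_comm, EuclideanSpace.inner_single_left]
  simp

lemma contDiffAt_pi (hp : M.Propensity) {z : ZVal r₁ r₂} (hz : z.1 ∈ M.suppX) {γ : Par p}
    (hγ : γ ∈ interior M.Γ) : ContDiffAt ℝ 2 (M.π z) γ :=
  (hp.contDiff z.1 hz z.2).contDiffAt (mem_interior_iff_mem_nhds.1 hγ)

lemma differentiableAt_pi (hp : M.Propensity) {z : ZVal r₁ r₂} (hz : z.1 ∈ M.suppX) {γ : Par p}
    (hγ : γ ∈ interior M.Γ) : DifferentiableAt ℝ (M.π z) γ :=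
  (contDiffAt_pi hp hz hγ).differentiableAt (by norm_num)

/-- Joint measurability of `π` is not assumed, but each partial derivative is an almost everywhere
limit of difference quotients, which are measurable in `z`. -/
lemma aestronglyMeasurable_grad (hb : M.Basic) (hi : M.Identification) (hp : M.Propensity)
    (j : Fin p) : AEStronglyMeasurable (M.grad j) (M.law.map Obs.Z) := by
  set e : Par p := EuclideanSpace.single j 1
  have hlim : Tendsto (fun n : ℕ => M.γ₀ + ((n : ℝ))⁻¹ • e) atTop (𝓝 M.γ₀) := by
    have h := (tendsto_inv_atTop_zero.comp (tendsto_natCast_atTop_atTop (R := ℝ))).smul_const e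
    simpa using h.const_add M.γ₀
  -- Measurability holds only for parameters in `Γ`, so the quotients start at the index after which
  -- the shifted parameter stays there.
  obtain ⟨n₀, hn₀⟩ := eventually_atTop.1 (hlim.eventually (mem_interior_iff_mem_nhds.1 hi.γ₀_mem))
  refine aestronglyMeasurable_of_tendsto_ae atTop
    (f := fun n z => ((n + n₀ : ℕ) : ℝ) • (M.π z (M.γ₀ + (((n + n₀ : ℕ) : ℝ))⁻¹ • e) - M.π z M.γ₀))
    (fun n => ?_) ?_
  · have h := (hb.measurable_pi _ (hn₀ _ (Nat.le_add_left n₀ n))).sub (measurable_pi₀ hb hi)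
    exact (h.const_mul _).aestronglyMeasurable
  · filter_upwards [ae_map_Z_fst_mem_suppX] with z hz
    rw [grad_eq_fderiv]
    refine (differentiableAt_pi hp hz hi.γ₀_mem).hasFDerivAt.lim e ?_
    have h : Tendsto (fun n : ℕ => ((n + n₀ : ℕ) : ℝ)) atTop atTop :=
      tendsto_natCast_atTop_atTop.comp (tendsto_add_atTop_nat n₀)
    exact tendsto_norm_atTop_atTop.comp h

lemma exists_grad_bound (hi : M.Identification) (hp : M.Propensity) : ∃ C : ℝ, 0 ≤ C ∧
    ∀ j, ∀ z : ZVal r₁ r₂, z.1 ∈ M.suppX → |M.grad j z| ≤ C := by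
  obtain ⟨C, h⟩ := hp.deriv_bounds
  refine ⟨|C|, abs_nonneg _, fun j z hz => ?_⟩
  have h1 := (h M.γ₀ hi.γ₀_mem z.1 hz z.2).1
  rw [grad_eq_fderiv]
  rw [norm_iteratedFDeriv_one] at h1
  have h2 := (fderiv ℝ (M.π z) M.γ₀).le_opNorm (EuclideanSpace.single j 1)
  rw [PiLp.norm_single, norm_one, mul_one] at h2
  exact (h2.trans h1).trans (le_abs_self _)

end Gradient

end Facts

end Model
end MNAR

namespace MNAR
namespace Model
variable {p r₁ r₂ : ℕ} {M : Model p r₁ r₂} [IsProbabilityMeasure M.law]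

/-! ### First-order expansion of the inverse propensity score. -/

section Taylor

lemma sum_grad_mul (z : ZVal r₁ r₂) (v : Par p) :
    ∑ j, M.grad j z * v j = fderiv ℝ (M.π z) M.γ₀ v := by
  have h := InnerProductSpace.toDual_symm_apply (𝕜 := ℝ) (x := v) (y := fderiv ℝ (M.π z) M.γ₀)
  rw [← h, PiLp.inner_apply]
  refine Finset.sum_congr rfl fun j _ => ?_
  simp [grad, gradient, mul_comm]

/-- A uniform first-order expansion of `1 - T / π` around `γ₀`. -/
lemma exists_taylor (hi : M.Identification) (hp : M.Propensity) : ∃ r : ℝ, 0 < r ∧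
    Metric.closedBall M.γ₀ r ⊆ M.Γ ∧ ∃ L : ℝ, 0 ≤ L ∧ ∀ w : Obs r₁ r₂, w.X ∈ M.suppX →
      ∀ s ≤ r, ∀ γ γ' : Par p, ‖γ - M.γ₀‖ ≤ s → ‖γ' - M.γ₀‖ ≤ s →
        |M.rho γ w - M.rho γ' w - ∑ j, M.slope j w * (γ j - γ' j)| ≤ L * s * ‖γ - γ'‖ := by
  obtain ⟨r, hr, hball⟩ := Metric.nhds_basis_closedBall.mem_iff.1
    (isOpen_interior.mem_nhds hi.γ₀_mem)
  obtain ⟨c, hc, hc1, hpi⟩ := exists_pi_bounds hp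
  obtain ⟨C₀, hC₀⟩ := hp.deriv_bounds
  set C := |C₀| with hC
  have hC0 : 0 ≤ C := abs_nonneg _
  -- The gradient of `1/π` is `-∇π/π²`. The first summand of the constant accounts for the change of
  -- `∇π`, the second for the change of `1/π²`.
  refine ⟨r, hr, hball.trans interior_subset, (c ^ 2)⁻¹ * C + (c ^ 4)⁻¹ * (2 * C) * C,
    by positivity, fun w hw s hs γ γ' hγ hγ' => ?_⟩
  have hs0 : 0 ≤ s := (norm_nonneg _).trans hγ
  set f : Par p → ℝ := M.π w.Z with hf
  have hconv : Convex ℝ (Metric.closedBall M.γ₀ s) := convex_closedBall _ _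
  have hint : ∀ x ∈ Metric.closedBall M.γ₀ s, x ∈ interior M.Γ := fun x hx =>
    hball (Metric.closedBall_subset_closedBall hs hx)
  have hw' : w.Z.1 ∈ M.suppX := hw
  have hlow : ∀ x ∈ Metric.closedBall M.γ₀ s, c ≤ f x := fun x hx =>
    (hpi x (interior_subset (hint x hx)) w.X hw w.Y).1
  have hup : ∀ x ∈ Metric.closedBall M.γ₀ s, f x ≤ 1 := fun x hx =>
    (hpi x (interior_subset (hint x hx)) w.X hw w.Y).2.2
  have hd : ∀ x ∈ Metric.closedBall M.γ₀ s, DifferentiableAt ℝ f x := fun x hx =>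
    differentiableAt_pi hp hw' (hint x hx)
  have hdb : ∀ x ∈ Metric.closedBall M.γ₀ s, ‖fderiv ℝ f x‖ ≤ C := fun x hx => by
    have h := (hC₀ x (hint x hx) w.X hw w.Y).1
    rw [norm_iteratedFDeriv_one] at h
    exact h.trans (le_abs_self _)
  have hdd : ∀ x ∈ Metric.closedBall M.γ₀ s, DifferentiableAt ℝ (fderiv ℝ f) x := fun x hx =>
    ((contDiffAt_pi hp hw' (hint x hx)).fderiv_right (m := 1) (by norm_num)).differentiableAt
      (by norm_num)
  have hddb : ∀ x ∈ Metric.closedBall M.γ₀ s, ‖fderiv ℝ (fderiv ℝ f) x‖ ≤ C := fun x hx => by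
    have h := (hC₀ x (hint x hx) w.X hw w.Y).2
    rw [← norm_iteratedFDeriv_one, norm_iteratedFDeriv_fderiv]
    exact h.trans (le_abs_self _)
  have h0 : M.γ₀ ∈ Metric.closedBall M.γ₀ s := Metric.mem_closedBall_self hs0
  have hπ0 := hlow _ h0
  have hf' : ∀ x ∈ Metric.closedBall M.γ₀ s, HasFDerivWithinAt (fun x => (f x)⁻¹)
      (-(f x ^ 2)⁻¹ • fderiv ℝ f x) (Metric.closedBall M.γ₀ s) x := fun x hx => by
    have hne : f x ≠ 0 := (hc.trans_le (hlow x hx)).ne'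
    exact ((hasDerivAt_inv hne).comp_hasFDerivAt x (hd x hx).hasFDerivAt).hasFDerivWithinAt
  have hbound : ∀ x ∈ Metric.closedBall M.γ₀ s,
      ‖-(f x ^ 2)⁻¹ • fderiv ℝ f x - -(f M.γ₀ ^ 2)⁻¹ • fderiv ℝ f M.γ₀‖
        ≤ ((c ^ 2)⁻¹ * C + (c ^ 4)⁻¹ * (2 * C) * C) * s := fun x hx => by
    have hxs : ‖x - M.γ₀‖ ≤ s := by simpa [dist_eq_norm] using hx
    have hD : ‖fderiv ℝ f x - fderiv ℝ f M.γ₀‖ ≤ C * s :=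
      (hconv.norm_image_sub_le_of_norm_fderiv_le hdd hddb h0 hx).trans (by gcongr)
    have hF : |f x - f M.γ₀| ≤ C * s :=
      (hconv.norm_image_sub_le_of_norm_fderiv_le hd hdb h0 hx).trans (by gcongr)
    have hx1 := hlow x hx
    have hfx : 0 < f x := hc.trans_le hx1
    have hf0 : 0 < f M.γ₀ := hc.trans_le hπ0
    have e : -(f x ^ 2)⁻¹ • fderiv ℝ f x - -(f M.γ₀ ^ 2)⁻¹ • fderiv ℝ f M.γ₀
        = -((f x ^ 2)⁻¹ • (fderiv ℝ f x - fderiv ℝ f M.γ₀))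
          - ((f x ^ 2)⁻¹ - (f M.γ₀ ^ 2)⁻¹) • fderiv ℝ f M.γ₀ := by
      simp only [neg_smul, smul_sub, sub_smul]; abel
    have e2 : |(f x ^ 2)⁻¹ - (f M.γ₀ ^ 2)⁻¹| ≤ (c ^ 4)⁻¹ * (2 * (C * s)) := by
      have : (f x ^ 2)⁻¹ - (f M.γ₀ ^ 2)⁻¹
          = (f x ^ 2 * f M.γ₀ ^ 2)⁻¹ * ((f x + f M.γ₀) * -(f x - f M.γ₀)) := by
        field_simp; ring
      rw [this, abs_mul, abs_mul, abs_neg, abs_of_pos (by positivity : 0 < f x + f M.γ₀),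
        abs_of_pos (by positivity : 0 < (f x ^ 2 * f M.γ₀ ^ 2)⁻¹)]
      gcongr
      · calc c ^ 4 = c ^ 2 * c ^ 2 := by ring
          _ ≤ _ := by gcongr
      · linarith [hup x hx, hup _ h0]
    rw [e]
    refine (norm_sub_le _ _).trans ?_
    rw [norm_neg, norm_smul, norm_smul, Real.norm_eq_abs, Real.norm_eq_abs,
      abs_of_pos (by positivity : 0 < (f x ^ 2)⁻¹)]
    have h1 : (f x ^ 2)⁻¹ * ‖fderiv ℝ f x - fderiv ℝ f M.γ₀‖ ≤ (c ^ 2)⁻¹ * (C * s) := by gcongr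
    have h2 : |(f x ^ 2)⁻¹ - (f M.γ₀ ^ 2)⁻¹| * ‖fderiv ℝ f M.γ₀‖
        ≤ (c ^ 4)⁻¹ * (2 * (C * s)) * C := by
      gcongr; exact hdb _ h0
    linarith
  have hγb : γ ∈ Metric.closedBall M.γ₀ s := by simpa [dist_eq_norm] using hγ
  have hγb' : γ' ∈ Metric.closedBall M.γ₀ s := by simpa [dist_eq_norm] using hγ'
  -- Mean value inequality for `1/π` minus its linearization at `γ₀`. Linearizing at `γ₀` instead of
  -- `γ'` makes the estimate a Lipschitz bound for one fixed remainder.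
  have key := hconv.norm_image_sub_le_of_norm_hasFDerivWithin_le' hf' hbound hγb' hγb
  have hsum : ∑ j, M.slope j w * (γ j - γ' j)
      = w.T * ((f M.γ₀ ^ 2)⁻¹ * fderiv ℝ f M.γ₀ (γ - γ')) := by
    rw [hf, ← sum_grad_mul, Finset.mul_sum, Finset.mul_sum]
    refine Finset.sum_congr rfl fun j _ => ?_
    simp [slope]; ring
  have e : M.rho γ w - M.rho γ' w - ∑ j, M.slope j w * (γ j - γ' j)
      = -(w.T * ((f γ)⁻¹ - (f γ')⁻¹ - (-(f M.γ₀ ^ 2)⁻¹ • fderiv ℝ f M.γ₀) (γ - γ'))) := by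
    rw [hsum]
    simp only [rho, hf, _root_.smul_apply, smul_eq_mul]
    ring
  rw [e, abs_neg, abs_mul]
  calc |w.T| * |(f γ)⁻¹ - (f γ')⁻¹ - (-(f M.γ₀ ^ 2)⁻¹ • fderiv ℝ f M.γ₀) (γ - γ')|
      ≤ 1 * |(f γ)⁻¹ - (f γ')⁻¹ - (-(f M.γ₀ ^ 2)⁻¹ • fderiv ℝ f M.γ₀) (γ - γ')| := by
        gcongr; exact w.abs_T_le
    _ ≤ _ := by rw [one_mul]; exact key

end Taylor

/-! ### Square integrability of the moments, the slopes and the functions `psi`. -/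

section Integrability

lemma memLp_phi (hb : M.Basic) (hB : M.Basis) {K : ℕ} (hK : p ≤ K) (a : Fin K ⊕ Unit) :
    MemLp (fun w => M.phi K a w.Z) 2 M.law := by
  rcases a with k | _
  · exact (hB.memLp K hK k).comp_of_map Obs.measurable_X.aemeasurable
  · exact hb.memLp_U

lemma measurable_phi (hb : M.Basic) (hB : M.Basis) {K : ℕ} (hK : p ≤ K) (a : Fin K ⊕ Unit) :
    Measurable (M.phi K a) := by
  rcases a with k | _
  · exact (hB.measurable K hK k).comp measurable_fst
  · exact hb.measurable_U

lemma memLp_rho_mul (hb : M.Basic) (hp : M.Propensity) {γ : Par p}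
    (hγ : γ ∈ M.Γ) {f : Obs r₁ r₂ → ℝ} (hf : MemLp f 2 M.law) :
    MemLp (fun w => M.rho γ w * f w) 2 M.law := by
  obtain ⟨C, -, hC⟩ := exists_rho_bound hp
  refine memLp_bdd_mul (C := C) (measurable_rho hb hγ).aestronglyMeasurable ?_ hf
  filter_upwards [ae_X_mem_suppX] with w hw using hC γ hγ w hw

lemma memLp_g (hb : M.Basic) (hB : M.Basis) (hp : M.Propensity) {K : ℕ}
    (hK : p ≤ K) {γ : Par p} (hγ : γ ∈ M.Γ) (θ : ℝ) (a : Fin K ⊕ Unit) :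
    MemLp (fun w => M.g K γ θ w a) 2 M.law := by
  simp only [g_eq]
  exact (memLp_rho_mul hb hp hγ (memLp_phi hb hB hK a)).add
    (((memLp_const θ).sub hb.memLp_U).const_mul _)

lemma aestronglyMeasurable_pi₀ (hb : M.Basic) (hi : M.Identification) :
    AEStronglyMeasurable (fun z => M.π z M.γ₀) (M.law.map Obs.Z) :=
  (measurable_pi₀ hb hi).aestronglyMeasurable

lemma aestronglyMeasurable_div {α : Type*} [MeasurableSpace α] {μ : Measure α} {f g : α → ℝ}
    (hf : AEStronglyMeasurable f μ) (hg : AEStronglyMeasurable g μ) :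
    AEStronglyMeasurable (fun x => f x / g x) μ :=
  (hf.aemeasurable.div hg.aemeasurable).aestronglyMeasurable

lemma exists_slope_bound (hi : M.Identification) (hp : M.Propensity) : ∃ C : ℝ, 0 ≤ C ∧
    ∀ᵐ w ∂M.law, ∀ j, |M.slope j w| ≤ C := by
  obtain ⟨c, hc, -, hpi⟩ := exists_pi_bounds hp
  obtain ⟨C, hC0, hC⟩ := exists_grad_bound hi hp
  refine ⟨C / c ^ 2, by positivity, ?_⟩
  filter_upwards [ae_X_mem_suppX] with w hw j
  have h1 : c ≤ M.π w.Z M.γ₀ := (hpi _ hi.γ₀_mem_Γ w.X hw w.Y).1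
  have h2 : 0 < M.π w.Z M.γ₀ := hc.trans_le h1
  rw [slope, abs_mul, abs_div, abs_of_pos (by positivity : 0 < M.π w.Z M.γ₀ ^ 2)]
  calc |w.T| * (|M.grad j w.Z| / M.π w.Z M.γ₀ ^ 2) ≤ 1 * (C / c ^ 2) := by
        gcongr
        · exact w.abs_T_le
        · exact hC j w.Z hw
    _ = _ := one_mul _

lemma aestronglyMeasurable_slope (hb : M.Basic) (hi : M.Identification) (hp : M.Propensity)
    (j : Fin p) : AEStronglyMeasurable (M.slope j) M.law :=
  Obs.measurable_T.aestronglyMeasurable.mul (aestronglyMeasurable_comp_Z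
    (aestronglyMeasurable_div (aestronglyMeasurable_grad hb hi hp j)
      ((aestronglyMeasurable_pi₀ hb hi).pow 2)))

lemma memLp_slope_mul (hb : M.Basic) (hi : M.Identification) (hp : M.Propensity) (j : Fin p)
    {f : Obs r₁ r₂ → ℝ} (hf : MemLp f 2 M.law) :
    MemLp (fun w => M.slope j w * f w) 2 M.law := by
  obtain ⟨C, -, hC⟩ := exists_slope_bound hi hp
  refine memLp_bdd_mul (C := C) (aestronglyMeasurable_slope hb hi hp j) ?_ hf
  filter_upwards [hC] with w hw using hw j

lemma memLp_psi (hb : M.Basic) (hi : M.Identification) (hp : M.Propensity) (j : Fin p ⊕ Unit) :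
    MemLp (M.psi j) 2 M.law := by
  rcases j with j | _
  · obtain ⟨c, hc, -, hpi⟩ := exists_pi_bounds hp
    obtain ⟨C, hC0, hC⟩ := exists_grad_bound hi hp
    refine memLp_rho_mul hb hp hi.γ₀_mem_Γ (f := fun w => M.grad j w.Z / (1 - M.π w.Z M.γ₀)) ?_
    refine MemLp.of_bound (aestronglyMeasurable_comp_Z
      (aestronglyMeasurable_div (aestronglyMeasurable_grad hb hi hp j)
        (aestronglyMeasurable_const.sub (aestronglyMeasurable_pi₀ hb hi)))) (C / c) ?_
    filter_upwards [ae_X_mem_suppX] with w hw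
    have h1 : c ≤ 1 - M.π w.Z M.γ₀ := (hpi _ hi.γ₀_mem_Γ w.X hw w.Y).2.1
    have h2 : 0 < 1 - M.π w.Z M.γ₀ := hc.trans_le h1
    rw [Real.norm_eq_abs, abs_div, abs_of_pos h2]
    gcongr
    exact hC j w.Z hw
  · exact ((memLp_const M.θ₀).sub hb.memLp_U).mul_const _

end Integrability

end Model
end MNAR

namespace MNAR
namespace Model
variable {p r₁ r₂ : ℕ} {M : Model p r₁ r₂} [IsProbabilityMeasure M.law]

/-! ### Expectations involving `1 - T/π`. -/

section Identities

lemma integrable_div_pi₀ (hb : M.Basic) (hi : M.Identification) (hp : M.Propensity)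
    {f : Obs r₁ r₂ → ℝ} (hf : Integrable f M.law) :
    Integrable (fun w => (M.π w.Z M.γ₀)⁻¹ * f w) M.law := by
  obtain ⟨c, hc, -, hpi⟩ := exists_pi_bounds hp
  refine integrable_bdd_mul (C := c⁻¹) ?_ ?_ hf
  · exact ((measurable_pi₀ hb hi).comp Obs.measurable_Z).inv.aestronglyMeasurable
  · filter_upwards [ae_X_mem_suppX] with w hw
    have h1 : c ≤ M.π w.Z M.γ₀ := (hpi _ hi.γ₀_mem_Γ w.X hw w.Y).1
    rw [abs_of_pos (inv_pos.2 (hc.trans_le h1))]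
    gcongr

lemma ae_pi₀_ne_zero (hi : M.Identification) (hp : M.Propensity) :
    ∀ᵐ w ∂M.law, M.π w.Z M.γ₀ ≠ 0 ∧ 1 - M.π w.Z M.γ₀ ≠ 0 := by
  obtain ⟨c, hc, -, hpi⟩ := exists_pi_bounds hp
  filter_upwards [ae_X_mem_suppX] with w hw
  have h := hpi _ hi.γ₀_mem_Γ w.X hw w.Y
  exact ⟨(hc.trans_le h.1).ne', (hc.trans_le h.2.1).ne'⟩

lemma integral_T_div_mul (hb : M.Basic) (hi : M.Identification) (hp : M.Propensity)
    {f : ZVal r₁ r₂ → ℝ} (hf : AEStronglyMeasurable f (M.law.map Obs.Z))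
    (hfi : Integrable (fun w => f w.Z) M.law) :
    ∫ w, w.T * ((M.π w.Z M.γ₀)⁻¹ * f w.Z) ∂M.law = ∫ w, f w.Z ∂M.law := by
  rw [integral_T_mul hb (f := fun z => (M.π z M.γ₀)⁻¹ * f z)
    ((measurable_pi₀ hb hi).inv.aestronglyMeasurable.mul hf) (integrable_div_pi₀ hb hi hp hfi)]
  refine integral_congr_ae ?_
  filter_upwards [ae_pi₀_ne_zero hi hp] with w hw
  have := hw.1
  field_simp

lemma integrable_T_mul {f : Obs r₁ r₂ → ℝ} (hf : Integrable f M.law) :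
    Integrable (fun w => w.T * f w) M.law :=
  integrable_bdd_mul Obs.measurable_T.aestronglyMeasurable
    (Eventually.of_forall fun w => w.abs_T_le) hf

lemma integral_rho_mul (hb : M.Basic) (hi : M.Identification) (hp : M.Propensity)
    {f : ZVal r₁ r₂ → ℝ} (hf : AEStronglyMeasurable f (M.law.map Obs.Z))
    (hfi : Integrable (fun w => f w.Z) M.law) :
    ∫ w, M.rho M.γ₀ w * f w.Z ∂M.law = 0 := by
  have e : ∀ w, M.rho M.γ₀ w * f w.Z = f w.Z - w.T * ((M.π w.Z M.γ₀)⁻¹ * f w.Z) := fun w => by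
    rw [rho]; ring
  simp_rw [e]
  rw [integral_sub hfi (integrable_T_mul (integrable_div_pi₀ hb hi hp hfi)),
    integral_T_div_mul hb hi hp hf hfi, sub_self]

lemma integrable_rho_mul (hb : M.Basic) (hi : M.Identification) (hp : M.Propensity)
    {f : Obs r₁ r₂ → ℝ} (hf : Integrable f M.law) :
    Integrable (fun w => M.rho M.γ₀ w * f w) M.law := by
  obtain ⟨C, hC⟩ := ae_rho₀_bound hi hp
  exact integrable_bdd_mul (measurable_rho hb hi.γ₀_mem_Γ).aestronglyMeasurable hC hf

/-- Given `Z`, the variable `1 - T/π` is centred with variance `1/π - 1`, because `T² = T`. -/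
lemma integral_rho_sq_mul (hb : M.Basic) (hi : M.Identification) (hp : M.Propensity)
    {f : ZVal r₁ r₂ → ℝ} (hf : AEStronglyMeasurable f (M.law.map Obs.Z))
    (hfi : Integrable (fun w => f w.Z) M.law) :
    ∫ w, M.rho M.γ₀ w * (M.rho M.γ₀ w * f w.Z) ∂M.law
      = ∫ w, ((M.π w.Z M.γ₀)⁻¹ - 1) * f w.Z ∂M.law := by
  have hm := (measurable_pi₀ hb hi).inv.aestronglyMeasurable (μ := M.law.map Obs.Z)
  have h1 := integrable_div_pi₀ hb hi hp hfi
  have h2 : Integrable (fun w => ((M.π w.Z M.γ₀)⁻¹ - 1) * f w.Z) M.law := by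
    simp only [sub_mul, one_mul]
    exact h1.sub hfi
  have e : ∀ w, M.rho M.γ₀ w * (M.rho M.γ₀ w * f w.Z) = M.rho M.γ₀ w * f w.Z
      + w.T * ((M.π w.Z M.γ₀)⁻¹ * (((M.π w.Z M.γ₀)⁻¹ - 1) * f w.Z)) := fun w => by
    have := w.T_mul_self
    rw [rho]; linear_combination (M.π w.Z M.γ₀)⁻¹ * (M.π w.Z M.γ₀)⁻¹ * f w.Z * this
  simp_rw [e]
  rw [integral_add (integrable_rho_mul hb hi hp hfi)
      (integrable_T_mul (integrable_div_pi₀ hb hi hp h2)), integral_rho_mul hb hi hp hf hfi,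
    integral_T_div_mul hb hi hp (f := fun z => ((M.π z M.γ₀)⁻¹ - 1) * f z)
      ((hm.sub aestronglyMeasurable_const).mul hf) h2, zero_add]

lemma integrable_phi (hb : M.Basic) (hB : M.Basis) {K : ℕ} (hK : p ≤ K) (a : Fin K ⊕ Unit) :
    Integrable (fun w => M.phi K a w.Z) M.law := (memLp_phi hb hB hK a).integrable one_le_two

lemma integral_theta_sub_U (hb : M.Basic) : ∫ w, (M.θ₀ - M.U w.Z) ∂M.law = 0 := by
  rw [integral_sub (integrable_const _) (hb.memLp_U.integrable one_le_two), ← hb.theta_eq]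
  simp

lemma integral_g (hb : M.Basic) (hi : M.Identification) (hB : M.Basis) (hp : M.Propensity) {K : ℕ}
    (hK : p ≤ K) (a : Fin K ⊕ Unit) : ∫ w, M.g K M.γ₀ M.θ₀ w a ∂M.law = 0 := by
  have hU : Integrable (fun w : Obs r₁ r₂ => lastInd a * (M.θ₀ - M.U w.Z)) M.law :=
    ((integrable_const _).sub (hb.memLp_U.integrable one_le_two)).const_mul _
  simp_rw [g_eq]
  rw [integral_add (integrable_rho_mul hb hi hp (integrable_phi hb hB hK a)) hU,
    integral_rho_mul hb hi hp (measurable_phi hb hB hK a).aestronglyMeasurable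
      (integrable_phi hb hB hK a), integral_const_mul, integral_theta_sub_U hb]
  simp

lemma B_inl (hK : ℕ) (a : Fin hK ⊕ Unit) (j : Fin p) :
    M.B hK a (Sum.inl j) = ∫ w, M.phi hK a w.Z * M.score M.γ₀ j w ∂M.law := by
  rcases a with k | _ <;> rfl

lemma B_inr (K : ℕ) (a : Fin K ⊕ Unit) (j : Unit) : M.B K a (Sum.inr j) = lastInd a := by
  rcases a with k | _
  · rfl
  · simp [B, lastInd]

/-- The slope is `T ∇π/π²`, and averaging `T` given `Z` cancels one factor `π`. So `B` is the
expected derivative of the moments in `γ`. -/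
lemma integral_slope_mul_phi (hb : M.Basic) (hi : M.Identification) (hB : M.Basis)
    (hp : M.Propensity) {K : ℕ} (hK : p ≤ K) (a : Fin K ⊕ Unit) (j : Fin p) :
    ∫ w, M.slope j w * M.phi K a w.Z ∂M.law = M.B K a (Sum.inl j) := by
  obtain ⟨C, hC0, hC⟩ := exists_grad_bound hi hp
  have hgi : Integrable (fun w => M.grad j w.Z * M.phi K a w.Z) M.law := by
    refine integrable_bdd_mul (C := C)
      (aestronglyMeasurable_comp_Z (aestronglyMeasurable_grad hb hi hp j)) ?_
      (integrable_phi hb hB hK a)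
    filter_upwards [ae_X_mem_suppX] with w hw using hC j w.Z hw
  have hgm : AEStronglyMeasurable (fun z => M.grad j z * M.phi K a z) (M.law.map Obs.Z) :=
    (aestronglyMeasurable_grad hb hi hp j).mul (measurable_phi hb hB hK a).aestronglyMeasurable
  have h := integral_T_div_mul hb hi hp
    (f := fun z => (M.π z M.γ₀)⁻¹ * (M.grad j z * M.phi K a z))
    ((measurable_pi₀ hb hi).inv.aestronglyMeasurable.mul hgm) (integrable_div_pi₀ hb hi hp hgi)
  rw [B_inl]
  convert h using 3 with w w
  · rw [slope]; ring
  · rw [score_eq]; ring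

/-- The denominators in `psi` are chosen for this identity: `1 - π` cancels against the conditional
variance `(1 - π)/π` of `rho`, and `Var U` against the second moment of `θ₀ - U`. All cross terms
are `rho` times a function of `Z` and integrate to zero. The functions `psi` do not depend on `K`,
so one finite family in `L²` encodes every `B`. -/
lemma integral_psi_mul_g (hb : M.Basic) (hi : M.Identification) (hB : M.Basis)
    (hp : M.Propensity) {K : ℕ} (hK : p ≤ K) (a : Fin K ⊕ Unit) (j : Fin p ⊕ Unit) :
    ∫ w, M.psi j w * M.g K M.γ₀ M.θ₀ w a ∂M.law = M.B K a j := by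
  have hUm : AEStronglyMeasurable (fun z => M.θ₀ - M.U z) (M.law.map Obs.Z) :=
    (measurable_const.sub hb.measurable_U).aestronglyMeasurable
  have hU : MemLp (fun w : Obs r₁ r₂ => M.θ₀ - M.U w.Z) 2 M.law :=
    (memLp_const M.θ₀).sub hb.memLp_U
  rcases j with j | _
  · obtain ⟨c, hc, -, hpi⟩ := exists_pi_bounds hp
    obtain ⟨C, hC0, hC⟩ := exists_grad_bound hi hp
    set q : ZVal r₁ r₂ → ℝ := fun z => M.grad j z / (1 - M.π z M.γ₀) with hq
    have hqm : AEStronglyMeasurable q (M.law.map Obs.Z) :=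
      aestronglyMeasurable_div (aestronglyMeasurable_grad hb hi hp j)
        (aestronglyMeasurable_const.sub (aestronglyMeasurable_pi₀ hb hi))
    have hqb : ∀ᵐ w ∂M.law, |q w.Z| ≤ C / c := by
      filter_upwards [ae_X_mem_suppX] with w hw
      have h1 : c ≤ 1 - M.π w.Z M.γ₀ := (hpi _ hi.γ₀_mem_Γ w.X hw w.Y).2.1
      have h2 : 0 < 1 - M.π w.Z M.γ₀ := hc.trans_le h1
      rw [hq, abs_div, abs_of_pos h2]
      gcongr
      exact hC j w.Z hw
    have hqp : Integrable (fun w => q w.Z * M.phi K a w.Z) M.law :=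
      integrable_bdd_mul (aestronglyMeasurable_comp_Z hqm) hqb (integrable_phi hb hB hK a)
    have hqpm : AEStronglyMeasurable (fun z => q z * M.phi K a z) (M.law.map Obs.Z) :=
      hqm.mul (measurable_phi hb hB hK a).aestronglyMeasurable
    have hqU : Integrable (fun w => q w.Z * (M.θ₀ - M.U w.Z)) M.law :=
      integrable_bdd_mul (aestronglyMeasurable_comp_Z hqm) hqb (hU.integrable one_le_two)
    have e : ∀ w, M.psi (Sum.inl j) w * M.g K M.γ₀ M.θ₀ w a
        = M.rho M.γ₀ w * (M.rho M.γ₀ w * (q w.Z * M.phi K a w.Z))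
          + lastInd a * (M.rho M.γ₀ w * (q w.Z * (M.θ₀ - M.U w.Z))) := fun w => by
      rw [g_eq]; simp only [psi, Sum.elim_inl, hq]; ring
    simp_rw [e]
    rw [integral_add (integrable_rho_mul hb hi hp (integrable_rho_mul hb hi hp hqp))
      ((integrable_rho_mul hb hi hp hqU).const_mul _), integral_const_mul,
      integral_rho_mul hb hi hp (f := fun z => q z * (M.θ₀ - M.U z)) (hqm.mul hUm) hqU, mul_zero,
      add_zero, integral_rho_sq_mul hb hi hp (f := fun z => q z * M.phi K a z) hqpm hqp, B_inl]
    refine integral_congr_ae ?_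
    filter_upwards [ae_pi₀_ne_zero hi hp] with w hw
    obtain ⟨h1, h2⟩ := hw
    rw [score_eq, hq]
    field_simp
  · have hUphi : Integrable (fun w => (M.θ₀ - M.U w.Z) * M.phi K a w.Z) M.law :=
      hU.integrable_mul (memLp_phi hb hB hK a)
    have hUphim : AEStronglyMeasurable (fun z => (M.θ₀ - M.U z) * M.phi K a z)
        (M.law.map Obs.Z) := hUm.mul (measurable_phi hb hB hK a).aestronglyMeasurable
    set V := Var[fun w : Obs r₁ r₂ => M.U w.Z; M.law] with hV
    have hVar : ∫ w, (M.θ₀ - M.U w.Z) ^ 2 ∂M.law = V := by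
      rw [hV, variance_eq_integral hb.memLp_U.aemeasurable, ← hb.theta_eq]
      refine integral_congr_ae (Eventually.of_forall fun w => ?_)
      simp only; ring
    have e : ∀ w, M.psi (Sum.inr ()) w * M.g K M.γ₀ M.θ₀ w a
        = V⁻¹ * (M.rho M.γ₀ w * ((M.θ₀ - M.U w.Z) * M.phi K a w.Z))
          + lastInd a * V⁻¹ * (M.θ₀ - M.U w.Z) ^ 2 := fun w => by
      rw [g_eq]; simp only [psi, Sum.elim_inr]; ring
    simp_rw [e]
    rw [integral_add ((integrable_rho_mul hb hi hp hUphi).const_mul _)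
      (hU.integrable_sq.const_mul _), integral_const_mul, integral_const_mul,
      integral_rho_mul hb hi hp (f := fun z => (M.θ₀ - M.U z) * M.phi K a z) hUphim hUphi, hVar,
      B_inr, mul_assoc, inv_mul_cancel₀ hb.var_U_pos.ne']
    simp

end Identities

/-! ### Uniform coercivity of the weighting matrices. -/

section Quadratic

lemma memLp_sum_mul {α ι : Type*} [MeasurableSpace α] {μ : Measure α} [Fintype ι]
    {f : ι → α → ℝ} (hf : ∀ i, MemLp (f i) 2 μ) (v : ι → ℝ) :
    MemLp (fun x => ∑ i, v i * f i x) 2 μ :=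
  memLp_finsetSum _ fun i _ => (hf i).const_mul _

lemma integral_sum_mul_sum {α ι κ : Type*} [MeasurableSpace α] {μ : Measure α} [Fintype ι]
    [Fintype κ] {f : ι → α → ℝ} (hf : ∀ i, MemLp (f i) 2 μ) {g : κ → α → ℝ}
    (hg : ∀ i, MemLp (g i) 2 μ) (v : ι → ℝ) (c : κ → ℝ) :
    ∫ x, (∑ i, v i * f i x) * (∑ j, c j * g j x) ∂μ
      = dotProduct v ((Matrix.of fun i j => ∫ x, f i x * g j x ∂μ).mulVec c) := by
  have h : ∀ i j, Integrable (fun x => v i * c j * (f i x * g j x)) μ := fun i j =>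
    ((hf i).integrable_mul (hg j)).const_mul _
  have e : ∀ x, (∑ i, v i * f i x) * (∑ j, c j * g j x)
      = ∑ i, ∑ j, v i * c j * (f i x * g j x) := fun x => by
    rw [Finset.sum_mul_sum]
    exact Finset.sum_congr rfl fun i _ => Finset.sum_congr rfl fun j _ => by ring
  simp_rw [e]
  rw [integral_finsetSum _ fun i _ => integrable_finsetSum _ fun j _ => h i j]
  simp only [dotProduct, Matrix.mulVec, Matrix.of_apply]
  refine Finset.sum_congr rfl fun i _ => ?_
  rw [integral_finsetSum _ fun j _ => h i j, Finset.mul_sum]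
  refine Finset.sum_congr rfl fun j _ => ?_
  rw [integral_const_mul]; ring

lemma gram_isHermitian (K : ℕ) : (M.gram K).IsHermitian := by
  ext k l
  simp only [gram, Matrix.conjTranspose_apply, Matrix.of_apply, star_trivial]
  exact integral_congr_ae (Eventually.of_forall fun w => mul_comm _ _)

/-- The second moments of linear combinations of the basis functions are uniformly comparable to
the squared norms of their coefficients. -/
lemma exists_gram_bounds (hB : M.Basis) : ∃ a A : ℝ, 0 < a ∧ 0 < A ∧ ∀ K, p ≤ K →
    ∀ v : Fin K → ℝ, a * ∑ k, v k ^ 2 ≤ ∫ w, (∑ k, v k * M.u K k w.X) ^ 2 ∂M.law ∧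
      ∫ w, (∑ k, v k * M.u K k w.X) ^ 2 ∂M.law ≤ A * ∑ k, v k ^ 2 := by
  obtain ⟨a, A, ha, h⟩ := hB.eigen
  refine ⟨a, |A| + 1, ha, by positivity, fun K hK v => ?_⟩
  have hu : ∀ k, MemLp (fun w : Obs r₁ r₂ => M.u K k w.X) 2 M.law := fun k =>
    (hB.memLp K hK k).comp_of_map Obs.measurable_X.aemeasurable
  have e : ∫ w, (∑ k, v k * M.u K k w.X) ^ 2 ∂M.law = dotProduct v ((M.gram K).mulVec v) := by
    simp_rw [pow_two]
    exact integral_sum_mul_sum hu hu v v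
  have hsa : IsSelfAdjoint (M.gram K) := gram_isHermitian K
  -- The eigenvalue bounds become inequalities in the Loewner order, and from there between
  -- quadratic forms.
  have h1 : algebraMap ℝ _ a ≤ M.gram K :=
    (algebraMap_le_iff_le_spectrum (ha := hsa)).2 fun x hx => (h K hK x hx).1
  have h2 : M.gram K ≤ algebraMap ℝ _ A :=
    (le_algebraMap_iff_spectrum_le (ha := hsa)).2 fun x hx => (h K hK x hx).2
  have h1' := (Matrix.le_iff.1 h1).dotProduct_mulVec_nonneg v
  have h2' := (Matrix.le_iff.1 h2).dotProduct_mulVec_nonneg v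
  have e2 : ∀ c : ℝ, dotProduct v ((algebraMap ℝ (Matrix (Fin K) (Fin K) ℝ) c).mulVec v)
      = c * ∑ k, v k ^ 2 := fun c => by
    rw [Algebra.algebraMap_eq_smul_one, Matrix.smul_mulVec, Matrix.one_mulVec, dotProduct_smul,
      smul_eq_mul]
    simp [dotProduct, pow_two]
  simp only [star_trivial, Matrix.sub_mulVec, dotProduct_sub, e2, ← e] at h1' h2'
  have h3 : 0 ≤ ∑ k, v k ^ 2 := Finset.sum_nonneg fun _ _ => sq_nonneg _
  refine ⟨by linarith, ?_⟩
  nlinarith [le_abs_self A]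

lemma D_quad (hb : M.Basic) (hi : M.Identification) (hB : M.Basis) (hp : M.Propensity) {K : ℕ}
    (hK : p ≤ K) (v c : Fin K ⊕ Unit → ℝ) :
    dotProduct v ((M.D K).mulVec c) = ∫ w, (∑ a, v a * M.g K M.γ₀ M.θ₀ w a)
      * (∑ a, c a * M.g K M.γ₀ M.θ₀ w a) ∂M.law :=
  (integral_sum_mul_sum (fun a => memLp_g hb hB hp hK hi.γ₀_mem_Γ _ a)
    (fun a => memLp_g hb hB hp hK hi.γ₀_mem_Γ _ a) v c).symm

/-- The variance splits into the part conditional on `Z` and the variance of the conditional mean,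
the latter coming only from `θ₀ - U`. The mixed term vanishes because `rho` is centred given `Z`. -/
lemma D_quad_eq (hb : M.Basic) (hi : M.Identification) (hB : M.Basis) (hp : M.Propensity) {K : ℕ}
    (hK : p ≤ K) (v : Fin K ⊕ Unit → ℝ) :
    dotProduct v ((M.D K).mulVec v)
      = ∫ w, ((M.π w.Z M.γ₀)⁻¹ - 1) * (∑ a, v a * M.phi K a w.Z) ^ 2 ∂M.law
        + v (Sum.inr ()) ^ 2 * Var[fun w : Obs r₁ r₂ => M.U w.Z; M.law] := by
  rw [D_quad hb hi hB hp hK]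
  set s : ZVal r₁ r₂ → ℝ := fun z => ∑ a, v a * M.phi K a z with hs
  have hsL : MemLp (fun w : Obs r₁ r₂ => s w.Z) 2 M.law :=
    memLp_sum_mul (fun a => memLp_phi hb hB hK a) v
  have hsm : Measurable s :=
    Finset.measurable_sum _ fun a _ => (measurable_phi hb hB hK a).const_mul _
  have hU : MemLp (fun w : Obs r₁ r₂ => M.θ₀ - M.U w.Z) 2 M.law :=
    (memLp_const M.θ₀).sub hb.memLp_U
  have hUm : Measurable fun z : ZVal r₁ r₂ => M.θ₀ - M.U z :=
    measurable_const.sub hb.measurable_U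
  set d := v (Sum.inr ()) with hd
  have e0 : ∀ w, ∑ a, v a * M.g K M.γ₀ M.θ₀ w a
      = M.rho M.γ₀ w * s w.Z + d * (M.θ₀ - M.U w.Z) := fun w => by
    simp only [g_eq, mul_add, Finset.sum_add_distrib, hs, Finset.mul_sum]
    congr 1
    · exact Finset.sum_congr rfl fun a _ => by ring
    · simp [lastInd, hd]
  have e : ∀ w, (∑ a, v a * M.g K M.γ₀ M.θ₀ w a) * (∑ a, v a * M.g K M.γ₀ M.θ₀ w a)
      = M.rho M.γ₀ w * (M.rho M.γ₀ w * s w.Z ^ 2)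
        + (2 * d * (M.rho M.γ₀ w * ((M.θ₀ - M.U w.Z) * s w.Z))
        + d ^ 2 * (M.θ₀ - M.U w.Z) ^ 2) := fun w => by
    rw [e0]; ring
  have hVar : ∫ w, (M.θ₀ - M.U w.Z) ^ 2 ∂M.law
      = Var[fun w : Obs r₁ r₂ => M.U w.Z; M.law] := by
    rw [variance_eq_integral hb.memLp_U.aemeasurable, ← hb.theta_eq]
    refine integral_congr_ae (Eventually.of_forall fun w => ?_)
    simp only; ring
  have hUs : Integrable (fun w : Obs r₁ r₂ => (M.θ₀ - M.U w.Z) * s w.Z) M.law :=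
    hU.integrable_mul hsL
  have i1 : Integrable (fun w => 2 * d * (M.rho M.γ₀ w * ((M.θ₀ - M.U w.Z) * s w.Z))) M.law :=
    (integrable_rho_mul hb hi hp hUs).const_mul _
  have i2 : Integrable (fun w : Obs r₁ r₂ => d ^ 2 * (M.θ₀ - M.U w.Z) ^ 2) M.law :=
    hU.integrable_sq.const_mul _
  have i12 : Integrable (fun w => 2 * d * (M.rho M.γ₀ w * ((M.θ₀ - M.U w.Z) * s w.Z))
      + d ^ 2 * (M.θ₀ - M.U w.Z) ^ 2) M.law := i1.add i2
  simp_rw [e]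
  rw [integral_add (integrable_rho_mul hb hi hp (integrable_rho_mul hb hi hp hsL.integrable_sq))
      i12, integral_add i1 i2,
    integral_const_mul, integral_const_mul, hVar,
    integral_rho_mul hb hi hp (f := fun z => (M.θ₀ - M.U z) * s z)
      (hUm.mul hsm).aestronglyMeasurable hUs,
    integral_rho_sq_mul hb hi hp (f := fun z => s z ^ 2) (hsm.pow_const 2).aestronglyMeasurable
      hsL.integrable_sq]
  ring

/-- The matrices `D` are uniformly coercive. -/
lemma exists_D_coercive (hb : M.Basic) (hi : M.Identification) (hB : M.Basis)
    (hp : M.Propensity) : ∃ c : ℝ, 0 < c ∧ ∀ K, p ≤ K → ∀ v : Fin K ⊕ Unit → ℝ,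
      c * ∑ a, v a ^ 2 ≤ dotProduct v ((M.D K).mulVec v) := by
  obtain ⟨κ, hκ, hκ1, hpi⟩ := exists_pi_bounds hp
  obtain ⟨a, A, ha, hA, hgram⟩ := exists_gram_bounds hB
  set V := Var[fun w : Obs r₁ r₂ => M.U w.Z; M.law] with hV
  have hVpos : 0 < V := hb.var_U_pos
  set m := ∫ w, M.U w.Z ^ 2 ∂M.law with hm
  have hm0 : 0 ≤ m := integral_nonneg fun w => sq_nonneg _
  -- `U` may lie in the span of the basis, so the first term of `D_quad_eq` alone need not control
  -- `v`. Only a fraction `t ≤ 1` of it is spent on the basis coefficients, with `t` so small that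
  -- the loss `t κ m d²` caused by `U` costs at most half of `V d²`.
  set t := V / (2 * (κ * m + V)) with ht
  have hden : 0 < κ * m + V := by positivity
  have htpos : 0 < t := by positivity
  have ht1 : t ≤ 1 := by
    rw [ht, div_le_one (by positivity)]; nlinarith [mul_nonneg hκ.le hm0]
  have htm : t * κ * m ≤ V / 2 := by
    rw [ht, div_mul_eq_mul_div, div_mul_eq_mul_div, div_le_iff₀ (by positivity)]
    nlinarith [mul_nonneg hκ.le hm0]
  refine ⟨min (t * κ * a / 2) (V / 2), lt_min (by positivity) (by positivity), fun K hK v => ?_⟩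
  rw [D_quad_eq hb hi hB hp hK]
  set s : ZVal r₁ r₂ → ℝ := fun z => ∑ a, v a * M.phi K a z with hs
  set d := v (Sum.inr ()) with hd
  have hsL : MemLp (fun w : Obs r₁ r₂ => s w.Z) 2 M.law :=
    memLp_sum_mul (fun a => memLp_phi hb hB hK a) v
  have h1 : κ * ∫ w, s w.Z ^ 2 ∂M.law
      ≤ ∫ w, ((M.π w.Z M.γ₀)⁻¹ - 1) * s w.Z ^ 2 ∂M.law := by
    rw [← integral_const_mul]
    refine integral_mono_ae (hsL.integrable_sq.const_mul _) ?_ ?_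
    · have := (integrable_div_pi₀ hb hi hp hsL.integrable_sq).sub hsL.integrable_sq
      simp only [sub_mul, one_mul]
      exact this
    · filter_upwards [ae_X_mem_suppX] with w hw
      obtain ⟨g1, g2, g3⟩ := hpi _ hi.γ₀_mem_Γ w.X hw w.Y
      change κ ≤ M.π w.Z M.γ₀ at g1
      change κ ≤ 1 - M.π w.Z M.γ₀ at g2
      change M.π w.Z M.γ₀ ≤ 1 at g3
      have g4 : 0 < M.π w.Z M.γ₀ := hκ.trans_le g1
      have g5 : 1 + κ ≤ (M.π w.Z M.γ₀)⁻¹ := by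
        rw [le_inv_comm₀ (by positivity) g4, inv_eq_one_div, le_div_iff₀ (by positivity)]
        nlinarith
      exact mul_le_mul_of_nonneg_right (by linarith) (sq_nonneg _)
  have h2 : a * ∑ k, v (Sum.inl k) ^ 2 ≤ 2 * ∫ w, s w.Z ^ 2 ∂M.law + 2 * d ^ 2 * m := by
    refine (hgram K hK fun k => v (Sum.inl k)).1.trans ?_
    rw [hm, ← integral_const_mul, ← integral_const_mul,
      ← integral_add (hsL.integrable_sq.const_mul _) (hb.memLp_U.integrable_sq.const_mul _)]
    refine integral_mono (memLp_sum_mul (fun k => memLp_phi hb hB hK (Sum.inl k))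
      (fun k => v (Sum.inl k))).integrable_sq
      ((hsL.integrable_sq.const_mul _).add (hb.memLp_U.integrable_sq.const_mul _)) fun w => ?_
    have e : ∑ k, v (Sum.inl k) * M.u K k w.X = s w.Z - d * M.U w.Z := by
      simp [hs, phi, hd, Obs.X, Obs.Z]
    simp only [e]
    nlinarith [sq_nonneg (s w.Z + d * M.U w.Z)]
  have h3 : ∑ a, v a ^ 2 = ∑ k, v (Sum.inl k) ^ 2 + d ^ 2 := by simp [hd]
  have hI : 0 ≤ ∫ w, s w.Z ^ 2 ∂M.law := integral_nonneg fun w => sq_nonneg _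
  have hS : 0 ≤ ∑ k, v (Sum.inl k) ^ 2 := Finset.sum_nonneg fun _ _ => sq_nonneg _
  have h4 : t * κ * a / 2 * ∑ k, v (Sum.inl k) ^ 2
      ≤ κ * (∫ w, s w.Z ^ 2 ∂M.law) + V / 2 * d ^ 2 := by
    have g1 : t * κ * a / 2 * ∑ k, v (Sum.inl k) ^ 2
        ≤ t * κ / 2 * (2 * (∫ w, s w.Z ^ 2 ∂M.law) + 2 * d ^ 2 * m) := by
      calc _ = t * κ / 2 * (a * ∑ k, v (Sum.inl k) ^ 2) := by ring
        _ ≤ _ := by gcongr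
    have g2 : t * (κ * ∫ w, s w.Z ^ 2 ∂M.law) ≤ 1 * (κ * ∫ w, s w.Z ^ 2 ∂M.law) := by gcongr
    have g3 : t * κ * m * d ^ 2 ≤ V / 2 * d ^ 2 := by gcongr
    linarith
  rw [h3, mul_add]
  have h5 : min (t * κ * a / 2) (V / 2) * ∑ k, v (Sum.inl k) ^ 2
      ≤ t * κ * a / 2 * ∑ k, v (Sum.inl k) ^ 2 := by gcongr; exact min_le_left _ _
  have h6 : min (t * κ * a / 2) (V / 2) * d ^ 2 ≤ V / 2 * d ^ 2 := by
    gcongr; exact min_le_right _ _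
  linarith

end Quadratic

end Model
end MNAR

namespace MNAR

/-! ### The moment conditions as geometry in `L²`. -/

section ToL2
variable {α : Type*} [MeasurableSpace α]

open Classical in
/-- The class in `L²` of a square integrable function (zero for other functions). -/
noncomputable def toL2 (μ : Measure α) (f : α → ℝ) : Lp ℝ 2 μ :=
  if h : MemLp f 2 μ then h.toLp f else 0

variable {μ : Measure α} {f g : α → ℝ}

lemma coeFn_toL2 (hf : MemLp f 2 μ) : toL2 μ f =ᵐ[μ] f := by
  rw [toL2, dif_pos hf]; exact hf.coeFn_toLp

lemma inner_toL2 (hf : MemLp f 2 μ) (hg : MemLp g 2 μ) :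
    inner ℝ (toL2 μ f) (toL2 μ g) = ∫ x, f x * g x ∂μ := by
  rw [L2.inner_def]
  refine integral_congr_ae ?_
  filter_upwards [coeFn_toL2 hf, coeFn_toL2 hg] with x h1 h2
  rw [h1, h2, real_inner_eq_re_inner]; simp [mul_comm]

lemma norm_sq_eq_integral (h : Lp ℝ 2 μ) : ‖h‖ ^ 2 = ∫ x, h x ^ 2 ∂μ := by
  rw [← real_inner_self_eq_norm_sq, L2.inner_def]
  refine integral_congr_ae (Eventually.of_forall fun x => ?_)
  simp [pow_two]

lemma coeFn_sum_smul_toL2 {ι : Type*} [Fintype ι] {f : ι → α → ℝ} (hf : ∀ i, MemLp (f i) 2 μ)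
    (v : ι → ℝ) : (∑ i, v i • toL2 μ (f i) : Lp ℝ 2 μ) =ᵐ[μ] fun x => ∑ i, v i * f i x := by
  have h : ∀ i, (v i • toL2 μ (f i) : Lp ℝ 2 μ) =ᵐ[μ] fun x => v i * f i x := fun i => by
    filter_upwards [Lp.coeFn_smul (v i) (toL2 μ (f i)), coeFn_toL2 (hf i)] with x h1 h2
    rw [h1, Pi.smul_apply, h2, smul_eq_mul]
  have h' : ∀ᵐ x ∂μ, ∀ i, (v i • toL2 μ (f i) : Lp ℝ 2 μ) x = v i * f i x :=
    ae_all_iff.2 h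
  filter_upwards [Lp.coeFn_finsetSum Finset.univ fun i => v i • toL2 μ (f i), h'] with x h1 h2
  rw [h1, Finset.sum_apply]; exact Finset.sum_congr rfl fun i _ => h2 i

end ToL2

namespace Model
variable {p r₁ r₂ : ℕ} (M : Model p r₁ r₂)

/-- The regularity conditions on the model that the asymptotic analysis uses. -/
structure Regular [IsProbabilityMeasure M.law] : Prop where
  basic : M.Basic
  ident : M.Identification
  basis : M.Basis
  prop : M.Propensity

/-- The moment functions at the true parameter, as elements of `L²`. -/
noncomputable def momentL2 (K : ℕ) (a : Fin K ⊕ Unit) : Lp ℝ 2 M.law :=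
  toL2 M.law fun w => M.g K M.γ₀ M.θ₀ w a

/-- The span of the moment functions at the true parameter. -/
noncomputable def momentSpan (K : ℕ) : Submodule ℝ (Lp ℝ 2 M.law) :=
  Submodule.span ℝ (Set.range (M.momentL2 K))

instance (K : ℕ) : FiniteDimensional ℝ (M.momentSpan K) :=
  FiniteDimensional.span_of_finite ℝ (Set.finite_range _)

/-- The isometric embedding of `ℝ^{K+1}` with the inner product of `D⁻¹` into `L²`. -/
noncomputable def embed (K : ℕ) : (Fin K ⊕ Unit → ℝ) →ₗ[ℝ] Lp ℝ 2 M.law where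
  toFun v := ∑ a, ((M.D K)⁻¹.mulVec v) a • M.momentL2 K a
  map_add' v w := by simp [Matrix.mulVec_add, add_smul, Finset.sum_add_distrib]
  map_smul' c v := by simp [Matrix.mulVec_smul, mul_smul, Finset.smul_sum]

/-- A linear parametrization of the span of the functions `psi`. -/
noncomputable def psiL2 : FullPar p →ₗ[ℝ] Lp ℝ 2 M.law where
  toFun d := ∑ j, d j • toL2 M.law (M.psi j)
  map_add' v w := by simp [add_smul, Finset.sum_add_distrib]
  map_smul' c v := by simp [mul_smul, Finset.smul_sum]

lemma psiL2_apply (d : FullPar p) : M.psiL2 d = ∑ j, d j • toL2 M.law (M.psi j) := rfl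

lemma psiL2_single (j : Fin p ⊕ Unit) :
    M.psiL2 (EuclideanSpace.single j 1) = toL2 M.law (M.psi j) := by
  rw [psiL2_apply, Finset.sum_eq_single j]
  · simp
  · intro b _ hb; simp [hb]
  · simp

/-- The vector `D⁻¹ B e_j` of coefficients of the projection of `psi j`. -/
noncomputable def coef (K : ℕ) (j : Fin p ⊕ Unit) : Fin K ⊕ Unit → ℝ :=
  (M.D K)⁻¹.mulVec fun a => M.B K a j

/-- The derivative of the embedded moment vector with respect to the parameter. -/
noncomputable def deriv (K : ℕ) (d : FullPar p) : Lp ℝ 2 M.law :=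
  (M.momentSpan K).starProjection (M.psiL2 d)

section
variable {M} [IsProbabilityMeasure M.law]

lemma D_isHermitian (K : ℕ) : (M.D K).IsHermitian := by
  ext k l
  simp only [D, Matrix.conjTranspose_apply, Matrix.of_apply, star_trivial]
  exact integral_congr_ae (Eventually.of_forall fun w => mul_comm _ _)

lemma isUnit_det_D (h : M.Regular) {K : ℕ} (hK : p ≤ K) : IsUnit (M.D K).det := by
  obtain ⟨c, hc, hD⟩ := exists_D_coercive h.basic h.ident h.basis h.prop
  have hpd : (M.D K).PosDef := by
    refine Matrix.PosDef.of_dotProduct_mulVec_pos (D_isHermitian K) fun v hv => ?_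
    have h1 : 0 < ∑ a, v a ^ 2 := by
      obtain ⟨a, ha⟩ := Function.ne_iff.1 hv
      exact Finset.sum_pos' (fun _ _ => sq_nonneg _) ⟨a, Finset.mem_univ _, by
        have : v a ≠ 0 := ha
        positivity⟩
    rw [star_trivial]
    exact (by positivity : 0 < c * ∑ a, v a ^ 2).trans_le (hD K hK v)
  exact (Matrix.isUnit_iff_isUnit_det _).1 hpd.isUnit

lemma D_mulVec_inv (h : M.Regular) {K : ℕ} (hK : p ≤ K) (v : Fin K ⊕ Unit → ℝ) :
    (M.D K).mulVec ((M.D K)⁻¹.mulVec v) = v := by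
  rw [Matrix.mulVec_mulVec, Matrix.mul_nonsing_inv _ (isUnit_det_D h hK), Matrix.one_mulVec]

lemma D_inv_symm (K : ℕ) (v w : Fin K ⊕ Unit → ℝ) :
    dotProduct ((M.D K)⁻¹.mulVec v) w = dotProduct v ((M.D K)⁻¹.mulVec w) := by
  have hs : ((M.D K)⁻¹).transpose = (M.D K)⁻¹ := by
    have := (D_isHermitian (M := M) K).inv
    rwa [Matrix.IsHermitian, Matrix.conjTranspose_eq_transpose_of_trivial] at this
  rw [Matrix.dotProduct_mulVec, ← Matrix.mulVec_transpose, hs]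

lemma memLp_moment (h : M.Regular) {K : ℕ} (hK : p ≤ K) (a : Fin K ⊕ Unit) :
    MemLp (fun w => M.g K M.γ₀ M.θ₀ w a) 2 M.law :=
  memLp_g h.basic h.basis h.prop hK h.ident.γ₀_mem_Γ _ a

lemma inner_momentL2 (h : M.Regular) {K : ℕ} (hK : p ≤ K) (a b : Fin K ⊕ Unit) :
    inner ℝ (M.momentL2 K a) (M.momentL2 K b) = M.D K a b :=
  inner_toL2 (memLp_moment h hK a) (memLp_moment h hK b)

/-- The Gram matrix of the moments is `D`, and `D D⁻¹ v = v`. Thus `embed v` is the element of the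
span whose inner products with the moments are the entries of `v`. -/
lemma inner_momentL2_embed (h : M.Regular) {K : ℕ} (hK : p ≤ K) (a : Fin K ⊕ Unit)
    (v : Fin K ⊕ Unit → ℝ) : inner ℝ (M.momentL2 K a) (M.embed K v) = v a := by
  have e : inner ℝ (M.momentL2 K a) (M.embed K v)
      = (M.D K).mulVec ((M.D K)⁻¹.mulVec v) a := by
    simp only [embed, LinearMap.coe_mk, AddHom.coe_mk, inner_sum, real_inner_smul_right,
      inner_momentL2 h hK]
    simp only [Matrix.mulVec, dotProduct]
    exact Finset.sum_congr rfl fun b _ => mul_comm _ _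
  rw [e, D_mulVec_inv h hK]

lemma inner_embed (h : M.Regular) {K : ℕ} (hK : p ≤ K) (v w : Fin K ⊕ Unit → ℝ) :
    inner ℝ (M.embed K v) (M.embed K w) = dotProduct v ((M.D K)⁻¹.mulVec w) := by
  rw [← D_inv_symm]
  have e : M.embed K v = ∑ a, ((M.D K)⁻¹.mulVec v) a • M.momentL2 K a := rfl
  rw [e, sum_inner]
  simp only [real_inner_smul_left, inner_momentL2_embed h hK, dotProduct]

lemma embed_mem (K : ℕ) (v : Fin K ⊕ Unit → ℝ) : M.embed K v ∈ M.momentSpan K := by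
  change ∑ a, ((M.D K)⁻¹.mulVec v) a • M.momentL2 K a ∈ M.momentSpan K
  exact Submodule.sum_mem _ fun a _ => Submodule.smul_mem _ _ (Submodule.subset_span (Set.mem_range_self a))

/-- With `x = D⁻¹v` one has `‖embed v‖² = x · v = x · Dx`. Coercivity of `D` bounds `|x|²` by this
number, and Cauchy–Schwarz for `x · v` then bounds it by `|v|²`. -/
lemma exists_embed_bound (h : M.Regular) : ∃ C : ℝ, 0 < C ∧ ∀ K, p ≤ K →
    ∀ v : Fin K ⊕ Unit → ℝ, ‖M.embed K v‖ ^ 2 ≤ C * ∑ a, v a ^ 2 ∧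
      ∑ a, ((M.D K)⁻¹.mulVec v) a ^ 2 ≤ C * ‖M.embed K v‖ ^ 2 := by
  obtain ⟨c, hc, hD⟩ := exists_D_coercive h.basic h.ident h.basis h.prop
  refine ⟨c⁻¹, inv_pos.2 hc, fun K hK v => ?_⟩
  set x := (M.D K)⁻¹.mulVec v with hx
  have h1 : ‖M.embed K v‖ ^ 2 = dotProduct x v := by
    rw [← real_inner_self_eq_norm_sq, inner_embed h hK, ← D_inv_symm]
  have h2 := hD K hK x
  rw [hx, D_mulVec_inv h hK, ← hx, ← h1] at h2
  have h3 : dotProduct x v ^ 2 ≤ (∑ a, x a ^ 2) * ∑ a, v a ^ 2 :=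
    Finset.sum_mul_sq_le_sq_mul_sq _ _ _
  rw [← h1] at h3
  have hx0 : 0 ≤ ∑ a, x a ^ 2 := Finset.sum_nonneg fun _ _ => sq_nonneg _
  have hv0 : 0 ≤ ∑ a, v a ^ 2 := Finset.sum_nonneg fun _ _ => sq_nonneg _
  have h4 : ∑ a, x a ^ 2 ≤ c⁻¹ * ‖M.embed K v‖ ^ 2 := by
    rw [inv_mul_eq_div, le_div_iff₀ hc]; linarith
  refine ⟨?_, h4⟩
  set n := ‖M.embed K v‖ ^ 2 with hn
  have hn0 : 0 ≤ n := by positivity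
  rcases hn0.eq_or_lt with h0 | h0
  · rw [← h0]; positivity
  · have : n * n ≤ n * (c⁻¹ * ∑ a, v a ^ 2) := by
      calc n * n = n ^ 2 := by ring
        _ ≤ (∑ a, x a ^ 2) * ∑ a, v a ^ 2 := h3
        _ ≤ (c⁻¹ * n) * ∑ a, v a ^ 2 := by gcongr
        _ = _ := by ring
    exact le_of_mul_le_mul_left this h0

/-- Both sides lie in the span and have the same inner products with the moments, by
`inner_momentL2_embed` and `integral_psi_mul_g`. -/
lemma embed_B_eq (h : M.Regular) {K : ℕ} (hK : p ≤ K) (j : Fin p ⊕ Unit) :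
    M.embed K (fun a => M.B K a j) = (M.momentSpan K).starProjection (toL2 M.law (M.psi j)) := by
  refine (Submodule.eq_starProjection_of_mem_of_inner_eq_zero (embed_mem K _) fun w hw => ?_).symm
  induction hw using Submodule.span_induction with
  | mem x hx =>
    obtain ⟨a, rfl⟩ := hx
    rw [inner_sub_left, real_inner_comm, real_inner_comm (M.momentL2 K a) (M.embed K _),
      inner_momentL2_embed h hK, real_inner_comm, momentL2,
      inner_toL2 (memLp_psi h.basic h.ident h.prop j) (memLp_moment h hK a),
      integral_psi_mul_g h.basic h.ident h.basis h.prop hK, sub_self]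
  | zero => simp
  | add x y _ _ hx hy => rw [inner_add_right, hx, hy, add_zero]
  | smul c x _ hx => rw [inner_smul_right, hx, mul_zero]

lemma deriv_eq (h : M.Regular) {K : ℕ} (hK : p ≤ K) (d : FullPar p) :
    M.deriv K d = M.embed K (fun a => ∑ j, M.B K a j * d j) := by
  have e : (fun a => ∑ j, M.B K a j * d j) = ∑ j, d j • fun a => M.B K a j := by
    ext a; simp [mul_comm]
  rw [deriv, psiL2_apply, e]
  simp only [map_sum, map_smul, embed_B_eq h hK]

lemma deriv_single (h : M.Regular) {K : ℕ} (hK : p ≤ K) (j : Fin p ⊕ Unit) :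
    M.deriv K (EuclideanSpace.single j 1) = M.embed K (fun a => M.B K a j) := by
  rw [deriv, psiL2_single, embed_B_eq h hK]

lemma deriv_sub (K : ℕ) (d e : FullPar p) : M.deriv K (d - e) = M.deriv K d - M.deriv K e := by
  simp [deriv]

lemma deriv_eq_sum (h : M.Regular) {K : ℕ} (hK : p ≤ K) (d : FullPar p) :
    M.deriv K d = ∑ j, d j • M.embed K (fun a => M.B K a j) := by
  rw [deriv, psiL2_apply]
  simp only [map_sum, map_smul, embed_B_eq h hK]

lemma inner_embed_B_embed (h : M.Regular) {K : ℕ} (hK : p ≤ K) (j : Fin p ⊕ Unit)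
    (v : Fin K ⊕ Unit → ℝ) :
    inner ℝ (M.embed K fun a => M.B K a j) (M.embed K v) = dotProduct (M.coef K j) v := by
  rw [inner_embed h hK, coef, D_inv_symm]

lemma info_apply (h : M.Regular) {K : ℕ} (hK : p ≤ K) (i j : Fin p ⊕ Unit) :
    M.info K i j = inner ℝ (M.embed K fun a => M.B K a i) (M.embed K fun a => M.B K a j) := by
  rw [inner_embed h hK, info, Matrix.mul_assoc]
  simp only [Matrix.mul_apply, Matrix.transpose_apply, dotProduct, Matrix.mulVec]

lemma exists_psi_bound : ∃ C : ℝ, 0 < C ∧ ∀ d : FullPar p, ‖M.psiL2 d‖ ≤ C * ‖d‖ := by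
  refine ⟨∑ j, ‖toL2 M.law (M.psi j)‖ + 1, ?_, fun d => ?_⟩
  · have : 0 ≤ ∑ j, ‖toL2 M.law (M.psi j)‖ := Finset.sum_nonneg fun _ _ => norm_nonneg _
    linarith
  · rw [psiL2_apply]
    calc ‖∑ j, d j • toL2 M.law (M.psi j)‖ ≤ ∑ j, ‖d j • toL2 M.law (M.psi j)‖ :=
          norm_sum_le _ _
      _ ≤ ∑ j, ‖toL2 M.law (M.psi j)‖ * ‖d‖ := by
          refine Finset.sum_le_sum fun j _ => ?_
          rw [norm_smul, mul_comm]
          gcongr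
          exact PiLp.norm_apply_le d j
      _ = (∑ j, ‖toL2 M.law (M.psi j)‖) * ‖d‖ := by rw [Finset.sum_mul]
      _ ≤ _ := by gcongr; linarith

lemma norm_deriv_le (K : ℕ) (d : FullPar p) : ‖M.deriv K d‖ ≤ ‖M.psiL2 d‖ :=
  (M.momentSpan K).norm_starProjection_apply_le _

/-- The embedded column of `B` is a projection of a fixed function, so its norm is bounded in `K`,
and `exists_embed_bound` transfers this to `D⁻¹B e_j`. This boundedness is what removes the factor
`√K` along the range of the derivative. -/
lemma exists_coef_bound (h : M.Regular) : ∃ C : ℝ, 0 < C ∧ ∀ K, p ≤ K → ∀ j,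
    ∑ a, M.coef K j a ^ 2 ≤ C := by
  obtain ⟨C, hC, hCe⟩ := exists_embed_bound h
  refine ⟨C * (∑ j, ‖toL2 M.law (M.psi j)‖ ^ 2) + 1, by positivity, fun K hK j => ?_⟩
  have h1 := (hCe K hK fun a => M.B K a j).2
  rw [embed_B_eq h hK] at h1
  have h2 := (M.momentSpan K).norm_starProjection_apply_le (toL2 M.law (M.psi j))
  have h3 : ‖toL2 M.law (M.psi j)‖ ^ 2 ≤ ∑ j, ‖toL2 M.law (M.psi j)‖ ^ 2 :=
    Finset.single_le_sum (f := fun j => ‖toL2 M.law (M.psi j)‖ ^ 2) (fun _ _ => by positivity)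
      (Finset.mem_univ j)
  calc _ ≤ C * ‖(M.momentSpan K).starProjection (toL2 M.law (M.psi j))‖ ^ 2 := h1
    _ ≤ C * ∑ j, ‖toL2 M.law (M.psi j)‖ ^ 2 := by
        gcongr
        refine le_trans ?_ h3
        gcongr
    _ ≤ _ := by linarith

/-- `rho` at `γ₀` is bounded, so multiplying by it turns a mean-square approximation of `u_{K₀ k}`
by later basis functions into one of the moment by later moments. -/
lemma tendsto_proj_moment (h : M.Regular) {K₀ : ℕ} (hK₀ : p ≤ K₀) (a : Fin K₀ ⊕ Unit) :
    Tendsto (fun l => (M.momentSpan l).starProjection (M.momentL2 K₀ a)) atTop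
      (𝓝 (M.momentL2 K₀ a)) := by
  rcases a with k | _
  · obtain ⟨C, hC⟩ := ae_rho₀_bound h.ident h.prop
    have hu : MemLp (M.u K₀ k) 2 M.lawX := h.basis.memLp K₀ hK₀ k
    rw [Metric.tendsto_nhds]
    intro ε hε
    have hδ : 0 < ε ^ 2 / (4 * (C ^ 2 + 1)) := by positivity
    filter_upwards [h.basis.span (M.u K₀ k) hu _ hδ, eventually_ge_atTop p] with l ⟨c, hc⟩ hl
    set t : Lp ℝ 2 M.law := ∑ m, c m • M.momentL2 l (Sum.inl m) with ht
    have htm : t ∈ M.momentSpan l :=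
      Submodule.sum_mem _ fun m _ => Submodule.smul_mem _ _ (Submodule.subset_span (Set.mem_range_self _))
    set q : Cov r₁ r₂ → ℝ := fun x => M.u K₀ k x - ∑ m, c m * M.u l m x with hq
    have hqL : MemLp q 2 M.lawX :=
      hu.sub (memLp_sum_mul (fun m => h.basis.memLp l hl m) c)
    have hqL' : MemLp (fun w : Obs r₁ r₂ => q w.X) 2 M.law :=
      hqL.comp_of_map Obs.measurable_X.aemeasurable
    have hst : ‖M.momentL2 K₀ (Sum.inl k) - t‖ ^ 2 ≤ C ^ 2 * ∫ x, q x ^ 2 ∂M.lawX := by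
      rw [norm_sq_eq_integral, lawX, integral_map (f := fun x => q x ^ 2)
        Obs.measurable_X.aemeasurable (hqL.aestronglyMeasurable.pow 2), ← integral_const_mul]
      refine integral_mono_ae ?_ (hqL'.integrable_sq.const_mul _) ?_
      · exact (Lp.memLp _).integrable_sq
      · filter_upwards [Lp.coeFn_sub (M.momentL2 K₀ (Sum.inl k)) t,
          coeFn_toL2 (memLp_moment h hK₀ (Sum.inl k)),
          coeFn_sum_smul_toL2 (fun m => memLp_moment h hl (Sum.inl m)) c, hC] with w h1 h2 h3 h4
        have h5 : (M.momentL2 K₀ (Sum.inl k) - t : Lp ℝ 2 M.law) w = M.rho M.γ₀ w * q w.X := by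
          rw [h1, Pi.sub_apply]
          have h2' : M.momentL2 K₀ (Sum.inl k) w = M.g K₀ M.γ₀ M.θ₀ w (Sum.inl k) := h2
          have h3' : t w = ∑ m, c m * M.g l M.γ₀ M.θ₀ w (Sum.inl m) := h3
          rw [h2', h3']
          simp only [g, Sum.elim_inl, hq, mul_sub, Finset.mul_sum]
          congr 1
          exact Finset.sum_congr rfl fun m _ => by ring
        rw [h5, mul_pow]
        exact mul_le_mul_of_nonneg_right (sq_le_sq.2 (h4.trans (le_abs_self C))) (sq_nonneg _)
    have hst' : ‖M.momentL2 K₀ (Sum.inl k) - t‖ < ε / 2 := by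
      refine lt_of_pow_lt_pow_left₀ 2 (by positivity) (hst.trans_lt ?_)
      have h6 : ∫ x, q x ^ 2 ∂M.lawX < ε ^ 2 / (4 * (C ^ 2 + 1)) := hc
      rw [lt_div_iff₀ (by positivity)] at h6
      have h7 : 0 ≤ ∫ x, q x ^ 2 ∂M.lawX := integral_nonneg fun _ => sq_nonneg _
      have h8 : 0 < ε ^ 2 := by positivity
      rcases h7.eq_or_lt with h9 | h9
      · rw [← h9]; nlinarith
      · nlinarith
    have hPt : (M.momentSpan l).starProjection t = t :=
      Submodule.starProjection_eq_self_iff.2 htm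
    rw [dist_eq_norm]
    have e : (M.momentSpan l).starProjection (M.momentL2 K₀ (Sum.inl k)) - M.momentL2 K₀ (Sum.inl k)
        = (M.momentSpan l).starProjection (M.momentL2 K₀ (Sum.inl k) - t)
          - (M.momentL2 K₀ (Sum.inl k) - t) := by
      rw [map_sub, hPt]; abel
    rw [e]
    have h9 := (M.momentSpan l).norm_starProjection_apply_le (M.momentL2 K₀ (Sum.inl k) - t)
    linarith [norm_sub_le ((M.momentSpan l).starProjection (M.momentL2 K₀ (Sum.inl k) - t))
      (M.momentL2 K₀ (Sum.inl k) - t)]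
  · refine tendsto_const_nhds.congr fun l => ?_
    -- The moment for `θ` is the same function for every `K`, so it belongs to every span.
    have e : M.momentL2 K₀ (Sum.inr ()) = M.momentL2 l (Sum.inr ()) := rfl
    have hm : M.momentL2 l (Sum.inr ()) ∈ M.momentSpan l :=
      Submodule.subset_span (Set.mem_range_self _)
    rw [e, Submodule.starProjection_eq_self_iff.2 hm]

lemma exists_limit_projection (h : M.Regular) : ∃ Q : Lp ℝ 2 M.law →L[ℝ] Lp ℝ 2 M.law,
    (∀ v, Tendsto (fun k => (M.momentSpan k).starProjection v) atTop (𝓝 (Q v))) ∧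
      ∀ k, p ≤ k → ∀ v, ‖(M.momentSpan k).starProjection v‖ ≤ ‖Q v‖ := by
  refine tendsto_starProjection M.momentSpan p fun k hk s hs => ?_
  induction hs using Submodule.span_induction with
  | mem x hx =>
    obtain ⟨a, rfl⟩ := hx
    exact tendsto_proj_moment h hk a
  | zero => simp
  | add x y _ _ hx hy => simpa only [map_add] using hx.add hy
  | smul c x _ hx => simpa only [map_smul] using hx.const_smul c

/-- The derivatives are uniformly nonsingular. -/
lemma exists_deriv_lower (h : M.Regular) (hV : ∀ᶠ K in atTop, IsUnit (M.info K).det)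
    {Q : Lp ℝ 2 M.law →L[ℝ] Lp ℝ 2 M.law}
    (hQ : ∀ v, Tendsto (fun k => (M.momentSpan k).starProjection v) atTop (𝓝 (Q v)))
    (hQ' : ∀ k, p ≤ k → ∀ v, ‖(M.momentSpan k).starProjection v‖ ≤ ‖Q v‖) :
    ∃ c : ℝ, 0 < c ∧ (∀ d : FullPar p, c * ‖d‖ ≤ ‖Q (M.psiL2 d)‖) ∧
      ∀ᶠ K in atTop, ∀ d : FullPar p, c * ‖d‖ ≤ ‖M.deriv K d‖ := by
  -- One nonsingular index suffices: if `Q` kills a combination of the `psi`, the dominated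
  -- projection at `K` kills it too, and then `info K` annihilates its coefficients.
  obtain ⟨K, hK, hdet⟩ := ((eventually_ge_atTop p).and hV).exists
  set F : FullPar p →ₗ[ℝ] Lp ℝ 2 M.law := Q.toLinearMap ∘ₗ M.psiL2 with hF
  have hker : LinearMap.ker F = ⊥ := by
    rw [LinearMap.ker_eq_bot']
    intro d hd
    have h1 : M.deriv K d = 0 := by
      have h2 := hQ' K hK (M.psiL2 d)
      have h3 : Q (M.psiL2 d) = 0 := hd
      rw [h3, norm_zero] at h2
      exact norm_le_zero_iff.1 h2
    have h4 : (M.info K).mulVec (fun j => d j) = 0 := by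
      ext i
      have h5 : inner ℝ (M.embed K fun a => M.B K a i) (M.deriv K d) = 0 := by
        rw [h1, inner_zero_right]
      rw [deriv_eq_sum h hK, inner_sum] at h5
      simp only [Matrix.mulVec, dotProduct, info_apply h hK, Pi.zero_apply]
      rw [← h5]
      exact Finset.sum_congr rfl fun j _ => by rw [real_inner_smul_right, mul_comm]
    have h5 : (fun j => d j) = 0 := by
      have := congrArg ((M.info K)⁻¹.mulVec) h4
      rwa [Matrix.mulVec_mulVec, Matrix.nonsing_inv_mul _ hdet, Matrix.one_mulVec,
        Matrix.mulVec_zero] at this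
    ext j
    exact congrFun h5 j
  obtain ⟨κ, hκ, hanti⟩ := F.exists_antilipschitzWith hker
  have hκ' : (0 : ℝ) < κ := by exact_mod_cast hκ
  have hlow : ∀ d : FullPar p, (κ : ℝ)⁻¹ * ‖d‖ ≤ ‖Q (M.psiL2 d)‖ := fun d => by
    have := hanti.le_mul_dist d 0
    rw [map_zero, dist_zero_right, dist_zero_right] at this
    rw [inv_mul_le_iff₀ hκ']; exact this
  refine ⟨(κ : ℝ)⁻¹ / 2, by positivity, fun d => ?_, ?_⟩
  · refine le_trans ?_ (hlow d)
    have : 0 < (κ : ℝ)⁻¹ := by positivity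
    gcongr; linarith
  -- Only finitely many `psi` occur, so strong convergence is uniform over their unit combinations;
  -- the discrepancy may use up half of the lower bound.
  · have hsum : Tendsto (fun k => ∑ j, ‖(M.momentSpan k).starProjection (toL2 M.law (M.psi j))
        - Q (toL2 M.law (M.psi j))‖) atTop (𝓝 0) := by
      have : Tendsto (fun k => ∑ j, ‖(M.momentSpan k).starProjection (toL2 M.law (M.psi j))
          - Q (toL2 M.law (M.psi j))‖) atTop (𝓝 (∑ _j : Fin p ⊕ Unit, (0 : ℝ))) :=
        tendsto_finsetSum _ fun j _ => tendsto_iff_norm_sub_tendsto_zero.1 (hQ _)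
      simpa using this
    filter_upwards [hsum.eventually_le_const (show (0 : ℝ) < (κ : ℝ)⁻¹ / 2 by positivity)]
      with k hk d
    have h1 : ‖M.deriv k d - Q (M.psiL2 d)‖ ≤ (κ : ℝ)⁻¹ / 2 * ‖d‖ := by
      have e : M.deriv k d - Q (M.psiL2 d) = ∑ j, d j •
          ((M.momentSpan k).starProjection (toL2 M.law (M.psi j)) - Q (toL2 M.law (M.psi j))) := by
        rw [deriv, psiL2_apply]
        simp only [map_sum, map_smul, smul_sub, Finset.sum_sub_distrib]
      rw [e]
      refine (norm_sum_le _ _).trans ?_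
      refine le_trans (Finset.sum_le_sum (g := fun j => ‖(M.momentSpan k).starProjection
        (toL2 M.law (M.psi j)) - Q (toL2 M.law (M.psi j))‖ * ‖d‖) fun j _ => ?_) ?_
      · rw [norm_smul, mul_comm]
        gcongr
        exact PiLp.norm_apply_le d j
      · rw [← Finset.sum_mul]
        gcongr
    have h2 := hlow d
    have h3 := norm_sub_norm_le (Q (M.psiL2 d)) (M.deriv k d)
    rw [norm_sub_rev] at h3
    linarith

end
end Model
end MNAR

namespace MNAR

/-! ### Deterministic comparison of perturbed least squares minimizers. -/

section Deterministic

variable {ℋ F : Type*} [NormedAddCommGroup ℋ] [InnerProductSpace ℝ ℋ] [NormedAddCommGroup F]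

/-- A crude rate for a point that does not increase the norm of a perturbed linear map. -/
lemma norm_le_of_norm_add_le {d : F} {b x R : ℋ} {c C ρ : ℝ} (hc : 0 < c) (hC : 0 ≤ C)
    (hlow : c * ‖d‖ ≤ ‖b‖) (hup : ‖b‖ ≤ C * ‖d‖) (hmin : ‖x + b + R‖ ≤ ‖x‖)
    (hR : |inner ℝ b R| ≤ ρ * ‖d‖ ^ 2) (hρ : ρ ≤ c ^ 2 / 2) :
    c ^ 2 * ‖d‖ ≤ 4 * C * ‖x‖ := by
  rcases (norm_nonneg d).eq_or_lt with h0 | h0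
  · rw [← h0, mul_zero]; positivity
  · have e : ‖b‖ ^ 2 = inner ℝ b (x + b + R) - inner ℝ b x - inner ℝ b R := by
      rw [inner_add_right, inner_add_right, real_inner_self_eq_norm_sq]; ring
    -- Testing with `b` is the point: the full vector is controlled by minimality, and `R` enters
    -- only through its component along `b`.
    have h1 : inner ℝ b (x + b + R) ≤ C * ‖d‖ * ‖x‖ :=
      (real_inner_le_norm _ _).trans (by gcongr)
    have h2 : -inner ℝ b x ≤ C * ‖d‖ * ‖x‖ :=
      (neg_le_abs _).trans ((abs_real_inner_le_norm _ _).trans (by gcongr))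
    have h3 : -inner ℝ b R ≤ ρ * ‖d‖ ^ 2 := (neg_le_abs _).trans hR
    have h4 : (c * ‖d‖) ^ 2 ≤ ‖b‖ ^ 2 := by gcongr
    have h5 : ρ * ‖d‖ ^ 2 ≤ c ^ 2 / 2 * ‖d‖ ^ 2 := by gcongr
    have h6 : ‖d‖ * (c ^ 2 * ‖d‖) ≤ ‖d‖ * (4 * C * ‖x‖) := by nlinarith
    exact le_of_mul_le_mul_left h6 h0

/-- Comparison of a minimizer of a perturbed least squares problem with the minimizer of the
unperturbed problem. -/
lemma norm_sub_le_of_norm_add_le {δ : ℝ} {b e R Δ : ℋ} {c C ρ : ℝ} (hc : 0 < c)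
    (hC : 0 ≤ C) (hρ0 : 0 ≤ ρ) (hδ : 0 ≤ δ) (hlow : c * δ ≤ ‖b‖) (hup : ‖b‖ ≤ C * δ) (horth : inner ℝ b e = 0)
    (hmin : ‖e + R + (b + Δ)‖ ≤ ‖e + R‖) (hΔ : ‖Δ‖ ≤ ρ * δ) (hρ : ρ ≤ c / 2) :
    c ^ 2 * δ ≤ 8 * (C * ‖R‖ + ρ * ‖e‖ + ρ * ‖R‖) := by
  rcases hδ.eq_or_lt with h0 | h0
  · rw [← h0, mul_zero]; positivity
  · have h1 : ‖e + R + (b + Δ)‖ ^ 2 ≤ ‖e + R‖ ^ 2 := by gcongr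
    rw [norm_add_sq_real] at h1
    -- In the expanded square the leading cross term `⟨b, e⟩` vanishes by the normal equations. What
    -- is left is first order in `δ` with small coefficients, against `‖b + Δ‖² ≥ (c δ/2)²`.
    have h2 : inner ℝ (e + R) (b + Δ) = inner ℝ b R + inner ℝ (e + R) Δ := by
      rw [inner_add_right, inner_add_left, real_inner_comm, horth, real_inner_comm b R]; ring
    have h3 : -inner ℝ b R ≤ C * δ * ‖R‖ :=
      (neg_le_abs _).trans ((abs_real_inner_le_norm _ _).trans (by gcongr))
    have h4 : -inner ℝ (e + R) Δ ≤ (‖e‖ + ‖R‖) * (ρ * δ) :=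
      (neg_le_abs _).trans ((abs_real_inner_le_norm _ _).trans
        (mul_le_mul (norm_add_le _ _) hΔ (norm_nonneg _) (by positivity)))
    have h5 : c / 2 * δ ≤ ‖b + Δ‖ := by
      have h6 := norm_sub_le (b + Δ) Δ
      rw [add_sub_cancel_right] at h6
      have : ρ * δ ≤ c / 2 * δ := by gcongr
      linarith
    have h6 : (c / 2 * δ) ^ 2 ≤ ‖b + Δ‖ ^ 2 := by gcongr
    have h7 : δ * (c ^ 2 * δ) ≤ δ * (8 * (C * ‖R‖ + ρ * ‖e‖ + ρ * ‖R‖)) := by nlinarith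
    exact le_of_mul_le_mul_left h7 h0

/-- The distance between a minimizer of `‖x + β d + R d‖` and the minimizer of `‖x + β d‖`. -/
lemma norm_sub_linear_minimizer_le {c C s k τ r : ℝ} (hc : 0 < c) (hC : 1 ≤ C) (hs : 0 ≤ s)
    (hk : 1 ≤ k) {β R : F → ℋ} {x : ℋ} {d e : F} (hβ : ∀ d d', β (d - d') = β d - β d')
    (hlow : ∀ d, c * ‖d‖ ≤ ‖β d‖) (hup : ∀ d, ‖β d‖ ≤ C * ‖d‖) (hx : ‖x‖ ≤ C * s)
    (he : ‖e‖ ≤ C * s) (horth : ∀ d, inner ℝ (β d) (x + β e) = 0) (hR0 : R 0 = 0)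
    (hRlip : ∀ σ ≤ r, ∀ d d', ‖d‖ ≤ σ → ‖d'‖ ≤ σ → ‖R d - R d'‖ ≤ C * (s + σ * k) * ‖d - d'‖)
    (hRin : |inner ℝ (β d) (R d)| ≤ C * (s + τ) * ‖d‖ ^ 2) (hτ : C * (s + τ) ≤ c ^ 2 / 2)
    (hr : (4 * C ^ 2 / c ^ 2 + C) * s ≤ r)
    (hρ : C * (s + (4 * C ^ 2 / c ^ 2 + C) * s * k) ≤ c / 2)
    (hρ1 : C * (s + (4 * C ^ 2 / c ^ 2 + C) * s * k) ≤ 1)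
    (hmin₀ : ‖x + β d + R d‖ ≤ ‖x‖) (hmin₁ : ‖x + β d + R d‖ ≤ ‖x + β e + R e‖) :
    ‖d - e‖ ≤ 32 * C ^ 2 / c ^ 2 * (C * (1 + (4 * C ^ 2 / c ^ 2 + C))) * (k * s ^ 2) := by
  have hC0 : 0 ≤ C := by linarith
  set q := 4 * C ^ 2 / c ^ 2 with hq
  have hq0 : 0 ≤ q := by positivity
  set σ := (q + C) * s with hσ
  set ρ := C * (s + σ * k) with hρ'
  have hσ0 : 0 ≤ σ := by positivity
  have hρ0 : 0 ≤ ρ := by positivity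
  -- Comparison with the true parameter gives the crude rate. It places `d` and `e` in the ball of
  -- radius `σ`, where `R` is Lipschitz with the small constant `ρ`.
  have hd : ‖d‖ ≤ q * s := by
    have h1 := norm_le_of_norm_add_le hc hC0 (hlow d) (hup d) hmin₀ hRin hτ
    have h2 : c ^ 2 * ‖d‖ ≤ 4 * C * (C * s) := h1.trans (by gcongr)
    rw [hq, div_mul_eq_mul_div, le_div_iff₀ (by positivity)]
    linarith
  have hdσ : ‖d‖ ≤ σ := hd.trans (by rw [hσ]; nlinarith [mul_nonneg hC0 hs])
  have heσ : ‖e‖ ≤ σ := he.trans (by rw [hσ]; nlinarith [mul_nonneg hq0 hs])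
  have hΔ : ‖R d - R e‖ ≤ ρ * ‖d - e‖ := hRlip σ hr d e hdσ heσ
  have hRe : ‖R e‖ ≤ ρ * (C * s) := by
    have h := hRlip σ hr e 0 heσ (by rw [norm_zero]; exact hσ0)
    rw [hR0, sub_zero, sub_zero] at h
    exact h.trans (by gcongr)
  have hres : ‖x + β e‖ ≤ 2 * C ^ 2 * s := by
    have h1 : ‖β e‖ ≤ C * (C * s) := (hup e).trans (by gcongr)
    have h2 : C * s ≤ C * (C * s) := by nlinarith [mul_nonneg hC0 hs]
    calc ‖x + β e‖ ≤ ‖x‖ + ‖β e‖ := norm_add_le _ _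
      _ ≤ 2 * C ^ 2 * s := by nlinarith
  -- Now `d` is compared with the linear minimizer `e`, whose residual `x + β e` is orthogonal to
  -- the range of `β`.
  have hmin : ‖x + β e + R e + (β (d - e) + (R d - R e))‖ ≤ ‖x + β e + R e‖ := by
    have : x + β e + R e + (β (d - e) + (R d - R e)) = x + β d + R d := by
      rw [hβ]; abel
    rw [this]; exact hmin₁
  have key := norm_sub_le_of_norm_add_le hc hC0 hρ0 (norm_nonneg _) (hlow (d - e)) (hup (d - e))
    (horth (d - e)) hmin hΔ hρ
  have h1 : C * ‖R e‖ + ρ * ‖x + β e‖ + ρ * ‖R e‖ ≤ ρ * (4 * C ^ 2 * s) := by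
    have g1 : C * ‖R e‖ ≤ ρ * (C ^ 2 * s) := by
      calc C * ‖R e‖ ≤ C * (ρ * (C * s)) := by gcongr
        _ = _ := by ring
    have g2 : ρ * ‖x + β e‖ ≤ ρ * (2 * C ^ 2 * s) := by gcongr
    have g3 : ρ * ‖R e‖ ≤ ρ * (C ^ 2 * s) := by
      gcongr
      calc ‖R e‖ ≤ ρ * (C * s) := hRe
        _ ≤ 1 * (C * s) := by gcongr
        _ ≤ C ^ 2 * s := by nlinarith [mul_nonneg hC0 hs]
    linarith
  have h2 : ρ * s ≤ C * (1 + (q + C)) * (k * s ^ 2) := by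
    have : s ≤ s * k := by nlinarith
    calc ρ * s = C * (s + (q + C) * s * k) * s := rfl
      _ ≤ C * (s * k + (q + C) * s * k) * s := by gcongr
      _ = _ := by ring
  have h3 : c ^ 2 * ‖d - e‖ ≤ 32 * C ^ 2 * (C * (1 + (q + C)) * (k * s ^ 2)) := by
    calc c ^ 2 * ‖d - e‖ ≤ 8 * (ρ * (4 * C ^ 2 * s)) := key.trans (by gcongr)
      _ = 32 * C ^ 2 * (ρ * s) := by ring
      _ ≤ _ := by gcongr
  rw [mul_assoc, div_mul_eq_mul_div, le_div_iff₀ (by positivity)]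
  linarith

end Deterministic
end MNAR

/-! ### Stochastic bounds for the empirical moments and their derivatives. -/

namespace MNAR
namespace Model
variable {p r₁ r₂ : ℕ} (M : Model p r₁ r₂)

/-- The deviation of the empirical derivative of the moments from its expectation. -/
noncomputable def slopeDev (K N : ℕ) (w : ℕ → Obs r₁ r₂) (j : Fin p) (a : Fin K ⊕ Unit) : ℝ :=
  emean (fun x => M.slope j x * M.phi K a x.Z) N w - M.B K a (Sum.inl j)

/-- The empirical moments at the true parameter. -/
noncomputable def moment₀ (K N : ℕ) (w : ℕ → Obs r₁ r₂) (a : Fin K ⊕ Unit) : ℝ :=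
  emean (fun x => M.g K M.γ₀ M.θ₀ x a) N w

/-- The sum of the normalized random quantities that control the estimator. -/
noncomputable def noise (K N : ℕ) (w : ℕ → Obs r₁ r₂) : ℝ :=
  N / (K + 1) * ∑ a, M.moment₀ K N w a ^ 2
  + N / (K + 1) * ∑ j, ∑ a, M.slopeDev K N w j a ^ 2
  + ((K : ℝ) + 1)⁻¹ * ∑ a, emean (fun x => M.phi K a x.Z ^ 2) N w
  + N * ∑ j, ∑ l, (∑ a, M.coef K l a * M.slopeDev K N w j a) ^ 2
  + ∑ l, emean (fun x => (∑ a, M.coef K l a * M.phi K a x.Z) ^ 2) N w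
  + N * ∑ l, (∑ a, M.coef K l a * M.moment₀ K N w a) ^ 2

section
variable {M}

lemma le_of_sum_six_le {a b c d e f A : ℝ} (ha : 0 ≤ a) (hb : 0 ≤ b) (hc : 0 ≤ c) (hd : 0 ≤ d)
    (he : 0 ≤ e) (hf : 0 ≤ f) (h : a + b + c + d + e + f ≤ A) :
    a ≤ A ∧ b ≤ A ∧ c ≤ A ∧ d ≤ A ∧ e ≤ A ∧ f ≤ A := by
  refine ⟨?_, ?_, ?_, ?_, ?_, ?_⟩ <;> linarith

lemma integral_sum_six {α : Type*} [MeasurableSpace α] {μ : Measure α} {a b c d e f : α → ℝ}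
    (ha : Integrable a μ) (hb : Integrable b μ) (hc : Integrable c μ) (hd : Integrable d μ)
    (he : Integrable e μ) (hf : Integrable f μ) :
    Integrable (fun x => a x + b x + c x + d x + e x + f x) μ ∧
      ∫ x, (a x + b x + c x + d x + e x + f x) ∂μ
        = ∫ x, a x ∂μ + ∫ x, b x ∂μ + ∫ x, c x ∂μ + ∫ x, d x ∂μ + ∫ x, e x ∂μ + ∫ x, f x ∂μ := by
  have i2 : Integrable (fun x => a x + b x) μ := ha.add hb
  have i3 : Integrable (fun x => a x + b x + c x) μ := i2.add hc
  have i4 : Integrable (fun x => a x + b x + c x + d x) μ := i3.add hd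
  have i5 : Integrable (fun x => a x + b x + c x + d x + e x) μ := i4.add he
  exact ⟨i5.add hf, by rw [integral_add i5 hf, integral_add i4 he, integral_add i3 hd,
    integral_add i2 hc, integral_add ha hb]⟩

lemma le_sum_of_nonneg {ι : Type*} [Fintype ι] {f : ι → ℝ} (hf : ∀ i, 0 ≤ f i) (i : ι) :
    f i ≤ ∑ i, f i :=
  Finset.single_le_sum (fun i _ => hf i) (Finset.mem_univ i)

lemma nested_sum_bounds {ι κ : Type*} [Fintype ι] [Fintype κ] {q m n x1 x3 A : ℝ} {x2 : ι → ℝ}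
    {x4 : ι → κ → ℝ} {x5 x6 : κ → ℝ} (hq : 0 ≤ q) (hm : 0 ≤ m) (hn : 0 ≤ n) (h1 : 0 ≤ x1)
    (h2 : ∀ j, 0 ≤ x2 j) (h3 : 0 ≤ x3) (h4 : ∀ j l, 0 ≤ x4 j l) (h5 : ∀ l, 0 ≤ x5 l)
    (h6 : ∀ l, 0 ≤ x6 l)
    (h : q * x1 + q * ∑ j, x2 j + m * x3 + n * ∑ j, ∑ l, x4 j l + ∑ l, x5 l + n * ∑ l, x6 l ≤ A) :
    q * x1 ≤ A ∧ (∀ j, q * x2 j ≤ A) ∧ m * x3 ≤ A ∧ (∀ j l, n * x4 j l ≤ A) ∧ (∀ l, x5 l ≤ A) ∧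
      ∀ l, n * x6 l ≤ A := by
  have h4' : ∀ j, 0 ≤ ∑ l, x4 j l := fun j => Finset.sum_nonneg fun l _ => h4 j l
  obtain ⟨b1, b2, b3, b4, b5, b6⟩ := le_of_sum_six_le (mul_nonneg hq h1)
    (mul_nonneg hq (Finset.sum_nonneg fun j _ => h2 j)) (mul_nonneg hm h3)
    (mul_nonneg hn (Finset.sum_nonneg fun j _ => h4' j)) (Finset.sum_nonneg fun l _ => h5 l)
    (mul_nonneg hn (Finset.sum_nonneg fun l _ => h6 l)) h
  refine ⟨b1, fun j => (mul_le_mul_of_nonneg_left (le_sum_of_nonneg h2 j) hq).trans b2, b3,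
    fun j l => (mul_le_mul_of_nonneg_left ?_ hn).trans b4, fun l => (le_sum_of_nonneg h5 l).trans b5,
    fun l => (mul_le_mul_of_nonneg_left (le_sum_of_nonneg h6 l) hn).trans b6⟩
  exact (le_sum_of_nonneg (h4 j) l).trans (le_sum_of_nonneg h4' j)

lemma noise_bounds {K N : ℕ} {w : ℕ → Obs r₁ r₂} {A : ℝ} (h : M.noise K N w ≤ A) :
    N / (K + 1) * ∑ a, M.moment₀ K N w a ^ 2 ≤ A ∧
    (∀ j, N / (K + 1) * ∑ a, M.slopeDev K N w j a ^ 2 ≤ A) ∧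
    ((K : ℝ) + 1)⁻¹ * ∑ a, emean (fun x => M.phi K a x.Z ^ 2) N w ≤ A ∧
    (∀ j l, N * (∑ a, M.coef K l a * M.slopeDev K N w j a) ^ 2 ≤ A) ∧
    (∀ l, emean (fun x => (∑ a, M.coef K l a * M.phi K a x.Z) ^ 2) N w ≤ A) ∧
    (∀ l, N * (∑ a, M.coef K l a * M.moment₀ K N w a) ^ 2 ≤ A) := by
  rw [noise] at h
  have n1 : 0 ≤ ∑ a, M.moment₀ K N w a ^ 2 := Finset.sum_nonneg fun _ _ => sq_nonneg _
  have n2 : ∀ j, 0 ≤ ∑ a, M.slopeDev K N w j a ^ 2 := fun j =>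
    Finset.sum_nonneg fun _ _ => sq_nonneg _
  have n3 : 0 ≤ ∑ a, emean (fun x : Obs r₁ r₂ => M.phi K a x.Z ^ 2) N w :=
    Finset.sum_nonneg fun _ _ => emean_nonneg (fun _ => sq_nonneg _) _ _
  have n4' : ∀ j l, 0 ≤ (∑ a, M.coef K l a * M.slopeDev K N w j a) ^ 2 := fun j l => sq_nonneg _
  have n5 : ∀ l, 0 ≤ emean (fun x : Obs r₁ r₂ => (∑ a, M.coef K l a * M.phi K a x.Z) ^ 2) N w :=
    fun l => emean_nonneg (fun _ => sq_nonneg _) _ _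
  have n6 : ∀ l, 0 ≤ (∑ a, M.coef K l a * M.moment₀ K N w a) ^ 2 := fun l => sq_nonneg _
  exact nested_sum_bounds (by positivity) (by positivity) (by positivity) n1 n2 n3 n4' n5 n6 h

variable [IsProbabilityMeasure M.law]

/-- The upper Gram bound controls the basis part and the second moment of `U` the last coordinate.
Unit vectors give the trace bound, which is where powers of `K + 1` originate. -/
lemma exists_phi_bounds (h : M.Regular) : ∃ C : ℝ, 0 < C ∧ ∀ K, p ≤ K →
    (∀ v : Fin K ⊕ Unit → ℝ, ∫ x, (∑ a, v a * M.phi K a x.Z) ^ 2 ∂M.law ≤ C * ∑ a, v a ^ 2) ∧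
    ∑ a, ∫ x, M.phi K a x.Z ^ 2 ∂M.law ≤ C * (K + 1) := by
  obtain ⟨a, A, ha, hA, hgram⟩ := exists_gram_bounds h.basis
  set m := ∫ w, M.U w.Z ^ 2 ∂M.law with hm
  have hm0 : 0 ≤ m := integral_nonneg fun w => sq_nonneg _
  have hmain : ∀ K, p ≤ K → ∀ v : Fin K ⊕ Unit → ℝ,
      ∫ x, (∑ a, v a * M.phi K a x.Z) ^ 2 ∂M.law ≤ (2 * A + 2 * m) * ∑ a, v a ^ 2 := by
    intro K hK v
    have hL : MemLp (fun x : Obs r₁ r₂ => ∑ k, v (Sum.inl k) * M.u K k x.X) 2 M.law :=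
      memLp_sum_mul (fun k => memLp_phi h.basic h.basis hK (Sum.inl k))
        (fun k => v (Sum.inl k))
    have h1 : ∫ x, (∑ a, v a * M.phi K a x.Z) ^ 2 ∂M.law
        ≤ 2 * ∫ x, (∑ k, v (Sum.inl k) * M.u K k x.X) ^ 2 ∂M.law + 2 * v (Sum.inr ()) ^ 2 * m := by
      rw [hm, ← integral_const_mul, ← integral_const_mul,
        ← integral_add (hL.integrable_sq.const_mul _)
          (h.basic.memLp_U.integrable_sq.const_mul _)]
      refine integral_mono
        (memLp_sum_mul (fun a => memLp_phi h.basic h.basis hK a) v).integrable_sq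
        ((hL.integrable_sq.const_mul _).add (h.basic.memLp_U.integrable_sq.const_mul _))
        fun x => ?_
      have e : ∑ a, v a * M.phi K a x.Z
          = ∑ k, v (Sum.inl k) * M.u K k x.X + v (Sum.inr ()) * M.U x.Z := by
        simp [phi, Obs.X, Obs.Z]
      simp only [e]
      nlinarith [sq_nonneg (∑ k, v (Sum.inl k) * M.u K k x.X - v (Sum.inr ()) * M.U x.Z)]
    have h2 := (hgram K hK fun k => v (Sum.inl k)).2
    have h3 : ∑ a, v a ^ 2 = ∑ k, v (Sum.inl k) ^ 2 + v (Sum.inr ()) ^ 2 := by simp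
    have h4 : 0 ≤ ∑ k, v (Sum.inl k) ^ 2 := Finset.sum_nonneg fun _ _ => sq_nonneg _
    rw [h3]
    nlinarith [sq_nonneg (v (Sum.inr ())), mul_nonneg hm0 h4,
      mul_nonneg hA.le (sq_nonneg (v (Sum.inr ())))]
  refine ⟨2 * A + 2 * m, by positivity, fun K hK => ⟨hmain K hK, ?_⟩⟩
  have h1 : ∀ a : Fin K ⊕ Unit, ∫ x, M.phi K a x.Z ^ 2 ∂M.law ≤ 2 * A + 2 * m := fun a => by
    have := hmain K hK (Pi.single a 1)
    simpa [Pi.single_apply] using this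
  calc ∑ a, ∫ x, M.phi K a x.Z ^ 2 ∂M.law ≤ ∑ _a : Fin K ⊕ Unit, (2 * A + 2 * m) :=
        Finset.sum_le_sum fun a _ => h1 a
    _ = (2 * A + 2 * m) * (K + 1) := by simp; ring

lemma integral_bdd_mul_sq_le {α : Type*} [MeasurableSpace α] {μ : Measure α} {b f : α → ℝ} {C : ℝ}
    (hb : AEStronglyMeasurable b μ) (hC : ∀ᵐ x ∂μ, |b x| ≤ C) (hf : MemLp f 2 μ) :
    ∫ x, (b x * f x) ^ 2 ∂μ ≤ C ^ 2 * ∫ x, f x ^ 2 ∂μ := by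
  rw [← integral_const_mul]
  refine integral_mono_ae (memLp_bdd_mul hb hC hf).integrable_sq (hf.integrable_sq.const_mul _) ?_
  filter_upwards [hC] with x hx
  rw [mul_pow]
  exact mul_le_mul_of_nonneg_right (sq_le_sq.2 (hx.trans (le_abs_self C))) (sq_nonneg _)

/-- A combination of the coordinatewise deviations is the deviation of a single function, so its
variance can be bounded without summing over `K + 1` coordinates. -/
lemma sum_mul_slopeDev (h : M.Regular) {K : ℕ} (hK : p ≤ K) (N : ℕ) (w : ℕ → Obs r₁ r₂)
    (j : Fin p) (v : Fin K ⊕ Unit → ℝ) :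
    ∑ a, v a * M.slopeDev K N w j a
      = emean (fun x => M.slope j x * ∑ a, v a * M.phi K a x.Z) N w
        - ∫ x, M.slope j x * ∑ a, v a * M.phi K a x.Z ∂M.law := by
  have e : (fun x : Obs r₁ r₂ => M.slope j x * ∑ a, v a * M.phi K a x.Z)
      = fun x => ∑ a, v a * (M.slope j x * M.phi K a x.Z) := by
    ext x; rw [Finset.mul_sum]; exact Finset.sum_congr rfl fun a _ => by ring
  rw [e, emean_sum, integral_finsetSum _ fun a _ => ((memLp_slope_mul h.basic h.ident h.prop j
    (memLp_phi h.basic h.basis hK a)).integrable one_le_two).const_mul _,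
    ← Finset.sum_sub_distrib]
  refine Finset.sum_congr rfl fun a _ => ?_
  rw [emean_const_mul, integral_const_mul,
    integral_slope_mul_phi h.basic h.ident h.basis h.prop hK, slopeDev]
  ring

lemma sum_mul_moment₀ {K : ℕ} (N : ℕ) (w : ℕ → Obs r₁ r₂) (v : Fin K ⊕ Unit → ℝ) :
    ∑ a, v a * M.moment₀ K N w a
      = emean (fun x => ∑ a, v a * M.g K M.γ₀ M.θ₀ x a) N w := by
  rw [emean_sum]
  exact Finset.sum_congr rfl fun a _ => by rw [emean_const_mul]; rfl

variable {Ω : Type*} [MeasurableSpace Ω] {P : Measure Ω} [IsProbabilityMeasure P]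
  {W : ℕ → Ω → Obs r₁ r₂}

/-- The normalized noise has bounded expectation. -/
lemma exists_integral_noise_le (h : M.Regular) (hlaw : ∀ i, HasLaw (W i) M.law P)
    (hindep : iIndepFun W P) : ∃ C : ℝ, 0 < C ∧ ∀ K, p ≤ K → ∀ N : ℕ, N ≠ 0 →
      Integrable (fun ω => M.noise K N fun i => W i ω) P ∧
      ∫ ω, M.noise K N (fun i => W i ω) ∂P ≤ C := by
  obtain ⟨Cφ, hCφ, hφ⟩ := exists_phi_bounds h
  obtain ⟨Cρ, hCρ⟩ := ae_rho₀_bound h.ident h.prop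
  obtain ⟨Cs, hCs0, hCs⟩ := exists_slope_bound h.ident h.prop
  obtain ⟨Cc, hCc, hcoef⟩ := exists_coef_bound h
  obtain ⟨Cψ, hCψ, hψ⟩ := exists_psi_bound (M := M)
  set v := ∫ w, (M.θ₀ - M.U w.Z) ^ 2 ∂M.law with hv
  have hv0 : 0 ≤ v := integral_nonneg fun _ => sq_nonneg _
  have hU : MemLp (fun w : Obs r₁ r₂ => M.θ₀ - M.U w.Z) 2 M.law :=
    (memLp_const M.θ₀).sub h.basic.memLp_U
  refine ⟨(2 * Cρ ^ 2 * Cφ + 2 * v) + p * (Cs ^ 2 * Cφ) + Cφ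
    + p * ((p + 1) * (Cs ^ 2 * (Cφ * Cc))) + (p + 1) * (Cφ * Cc) + (p + 1) * Cψ ^ 2,
    by positivity, fun K hK N hN => ?_⟩
  have hN' : (N : ℝ) ≠ 0 := by exact_mod_cast hN
  have hN0 : (0 : ℝ) < N := by exact_mod_cast Nat.pos_of_ne_zero hN
  have hK0 : (0 : ℝ) < (K : ℝ) + 1 := by positivity
  obtain ⟨hφ1, hφ2⟩ := hφ K hK
  have hphi := fun a => memLp_phi h.basic h.basis hK a
  have hf : ∀ l, MemLp (fun x : Obs r₁ r₂ => ∑ a, M.coef K l a * M.phi K a x.Z) 2 M.law :=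
    fun l => memLp_sum_mul hphi _
  have hfI : ∀ l, ∫ x, (∑ a, M.coef K l a * M.phi K a x.Z) ^ 2 ∂M.law ≤ Cφ * Cc := fun l =>
    (hφ1 _).trans (by gcongr; exact hcoef K hK l)
  have hsl : ∀ (j : Fin p) {f : Obs r₁ r₂ → ℝ}, MemLp f 2 M.law →
      ∫ x, (M.slope j x * f x) ^ 2 ∂M.law ≤ Cs ^ 2 * ∫ x, f x ^ 2 ∂M.law := fun j f hf =>
    integral_bdd_mul_sq_le (aestronglyMeasurable_slope h.basic h.ident h.prop j)
      (by filter_upwards [hCs] with x hx using hx j) hf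
  have hmemdev : ∀ j a, MemLp (fun ω => M.slopeDev K N (fun i => W i ω) j a) 2 P := fun j a =>
    (memLp_emean hlaw (memLp_slope_mul h.basic h.ident h.prop j (hphi a)) N).sub (memLp_const _)
  have hmemmom : ∀ a, MemLp (fun ω => M.moment₀ K N (fun i => W i ω) a) 2 P := fun a =>
    memLp_emean hlaw (memLp_moment h hK a) N
  -- integrability of the six terms
  have i1 : Integrable (fun ω => (N : ℝ) / (K + 1) * ∑ a, M.moment₀ K N (fun i => W i ω) a ^ 2) P :=
    (integrable_finsetSum _ fun a _ => (hmemmom a).integrable_sq).const_mul _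
  have i2 : Integrable (fun ω => (N : ℝ) / (K + 1)
      * ∑ j, ∑ a, M.slopeDev K N (fun i => W i ω) j a ^ 2) P :=
    (integrable_finsetSum _ fun j _ => integrable_finsetSum _ fun a _ =>
      (hmemdev j a).integrable_sq).const_mul _
  have i3 : Integrable (fun ω => ((K : ℝ) + 1)⁻¹
      * ∑ a, emean (fun x => M.phi K a x.Z ^ 2) N (fun i => W i ω)) P :=
    (integrable_finsetSum _ fun a _ => integrable_emean hlaw (hphi a).integrable_sq N).const_mul _
  have i4' : ∀ j l, Integrable (fun ω =>
      (∑ a, M.coef K l a * M.slopeDev K N (fun i => W i ω) j a) ^ 2) P := fun j l =>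
    (memLp_sum_mul (fun a => hmemdev j a) _).integrable_sq
  have i4 : Integrable (fun ω => (N : ℝ)
      * ∑ j, ∑ l, (∑ a, M.coef K l a * M.slopeDev K N (fun i => W i ω) j a) ^ 2) P :=
    (integrable_finsetSum _ fun j _ => integrable_finsetSum _ fun l _ => i4' j l).const_mul _
  have i5' : ∀ l, Integrable (fun ω =>
      emean (fun x => (∑ a, M.coef K l a * M.phi K a x.Z) ^ 2) N (fun i => W i ω)) P := fun l =>
    integrable_emean hlaw (hf l).integrable_sq N
  have i5 : Integrable (fun ω =>
      ∑ l, emean (fun x => (∑ a, M.coef K l a * M.phi K a x.Z) ^ 2) N (fun i => W i ω)) P :=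
    integrable_finsetSum _ fun l _ => i5' l
  have i6' : ∀ l, Integrable (fun ω =>
      (∑ a, M.coef K l a * M.moment₀ K N (fun i => W i ω) a) ^ 2) P := fun l =>
    (memLp_sum_mul hmemmom _).integrable_sq
  have i6 : Integrable (fun ω => (N : ℝ)
      * ∑ l, (∑ a, M.coef K l a * M.moment₀ K N (fun i => W i ω) a) ^ 2) P :=
    (integrable_finsetSum _ fun l _ => i6' l).const_mul _
  -- bounds for the six expectations
  have b1 : ∫ ω, (N : ℝ) / (K + 1) * ∑ a, M.moment₀ K N (fun i => W i ω) a ^ 2 ∂P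
      ≤ 2 * Cρ ^ 2 * Cφ + 2 * v := by
    rw [integral_const_mul, integral_finsetSum _ fun a _ => (hmemmom a).integrable_sq]
    have g1 : ∀ a, ∫ ω, M.moment₀ K N (fun i => W i ω) a ^ 2 ∂P
        ≤ (2 * Cρ ^ 2 * (∫ x, M.phi K a x.Z ^ 2 ∂M.law) + 2 * lastInd a * v) / N := fun a => by
      have := integral_emean_sub_sq_le hlaw hindep (memLp_moment h hK a) hN
      rw [integral_g h.basic h.ident h.basis h.prop hK] at this
      simp only [sub_zero] at this
      refine this.trans ?_
      gcongr
      have g2 := integral_bdd_mul_sq_le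
        (measurable_rho h.basic h.ident.γ₀_mem_Γ).aestronglyMeasurable hCρ (hphi a)
      have hr := memLp_rho_mul h.basic h.prop h.ident.γ₀_mem_Γ (hphi a)
      calc ∫ x, M.g K M.γ₀ M.θ₀ x a ^ 2 ∂M.law
          ≤ ∫ x, (2 * (M.rho M.γ₀ x * M.phi K a x.Z) ^ 2
            + 2 * (lastInd a * (M.θ₀ - M.U x.Z) ^ 2)) ∂M.law := by
            refine integral_mono (memLp_moment h hK a).integrable_sq
              ((hr.integrable_sq.const_mul _).add
                ((hU.integrable_sq.const_mul _).const_mul _)) fun x => ?_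
            have hl : (lastInd a : ℝ) ^ 2 = lastInd a := by
              rcases a with a | a <;> simp [lastInd]
            simp only [g_eq]
            have e : lastInd a * (M.θ₀ - M.U x.Z) ^ 2
                = (lastInd a * (M.θ₀ - M.U x.Z)) ^ 2 := by rw [mul_pow, hl]
            rw [e]
            nlinarith [sq_nonneg (M.rho M.γ₀ x * M.phi K a x.Z
              - lastInd a * (M.θ₀ - M.U x.Z))]
        _ = 2 * (∫ x, (M.rho M.γ₀ x * M.phi K a x.Z) ^ 2 ∂M.law)
            + 2 * ∫ x, lastInd a * (M.θ₀ - M.U x.Z) ^ 2 ∂M.law := by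
            rw [integral_add (hr.integrable_sq.const_mul _)
              ((hU.integrable_sq.const_mul _).const_mul _), integral_const_mul,
              integral_const_mul]
        _ ≤ _ := by rw [integral_const_mul (lastInd a : ℝ)]; linarith
    calc (N : ℝ) / (K + 1) * ∑ a, ∫ ω, M.moment₀ K N (fun i => W i ω) a ^ 2 ∂P
        ≤ (N : ℝ) / (K + 1) * ∑ a, (2 * Cρ ^ 2 * (∫ x, M.phi K a x.Z ^ 2 ∂M.law)
          + 2 * lastInd a * v) / N := by
          gcongr with a; exact g1 a
      _ = (2 * Cρ ^ 2 * (∑ a, ∫ x, M.phi K a x.Z ^ 2 ∂M.law) + 2 * v) / (K + 1) := by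
          rw [← Finset.sum_div, Finset.sum_add_distrib, ← Finset.mul_sum, ← Finset.sum_mul,
            ← Finset.mul_sum]
          have : ∑ a : Fin K ⊕ Unit, (lastInd a : ℝ) = 1 := by simp [lastInd]
          rw [this]; field_simp
      _ ≤ (2 * Cρ ^ 2 * (Cφ * (K + 1)) + 2 * v * (K + 1)) / (K + 1) := by
          refine div_le_div_of_nonneg_right ?_ hK0.le
          have g3 : 0 ≤ v * K := by positivity
          have g4 : 2 * Cρ ^ 2 * (∑ a, ∫ x, M.phi K a x.Z ^ 2 ∂M.law)
            ≤ 2 * Cρ ^ 2 * (Cφ * (K + 1)) := by gcongr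
          linarith
      _ = _ := by field_simp
  have b2' : ∀ j a, ∫ ω, M.slopeDev K N (fun i => W i ω) j a ^ 2 ∂P
      ≤ Cs ^ 2 * (∫ x, M.phi K a x.Z ^ 2 ∂M.law) / N := fun j a => by
    have := integral_emean_sub_sq_le hlaw hindep
      (memLp_slope_mul h.basic h.ident h.prop j (hphi a)) hN
    rw [integral_slope_mul_phi h.basic h.ident h.basis h.prop hK] at this
    refine this.trans ?_
    gcongr
    exact hsl j (hphi a)
  have b2 : ∫ ω, (N : ℝ) / (K + 1) * ∑ j, ∑ a, M.slopeDev K N (fun i => W i ω) j a ^ 2 ∂P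
      ≤ p * (Cs ^ 2 * Cφ) := by
    rw [integral_const_mul, integral_finsetSum _ fun j _ => integrable_finsetSum _ fun a _ =>
      (hmemdev j a).integrable_sq]
    have g1 : ∀ j, ∫ ω, ∑ a, M.slopeDev K N (fun i => W i ω) j a ^ 2 ∂P
        ≤ Cs ^ 2 * (Cφ * (K + 1)) / N := fun j => by
      rw [integral_finsetSum _ fun a _ => (hmemdev j a).integrable_sq]
      refine (Finset.sum_le_sum fun a _ => b2' j a).trans ?_
      rw [← Finset.sum_div, ← Finset.mul_sum]
      gcongr
    calc (N : ℝ) / (K + 1) * ∑ j, ∫ ω, ∑ a, M.slopeDev K N (fun i => W i ω) j a ^ 2 ∂P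
        ≤ (N : ℝ) / (K + 1) * ∑ _j : Fin p, Cs ^ 2 * (Cφ * (K + 1)) / N := by
          gcongr with j; exact g1 j
      _ = _ := by simp; field_simp
  have b3 : ∫ ω, ((K : ℝ) + 1)⁻¹
      * ∑ a, emean (fun x => M.phi K a x.Z ^ 2) N (fun i => W i ω) ∂P ≤ Cφ := by
    rw [integral_const_mul, integral_finsetSum _ fun a _ =>
      integrable_emean hlaw (hphi a).integrable_sq N]
    simp only [fun a => integral_emean hlaw (hphi a).integrable_sq hN]
    rw [inv_mul_le_iff₀ hK0, mul_comm]
    exact hφ2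
  have b4 : ∫ ω, (N : ℝ)
      * ∑ j, ∑ l, (∑ a, M.coef K l a * M.slopeDev K N (fun i => W i ω) j a) ^ 2 ∂P
      ≤ p * ((p + 1) * (Cs ^ 2 * (Cφ * Cc))) := by
    rw [integral_const_mul, integral_finsetSum _ fun j _ => integrable_finsetSum _ fun l _ => i4' j l]
    have g1 : ∀ j, ∫ ω, ∑ l, (∑ a, M.coef K l a * M.slopeDev K N (fun i => W i ω) j a) ^ 2 ∂P
        ≤ (p + 1) * (Cs ^ 2 * (Cφ * Cc) / N) := fun j => by
      rw [integral_finsetSum _ fun l _ => i4' j l]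
      -- The bounded coefficient vectors give functions with second moments bounded in `K`; the
      -- order here is `1/N` and not `K/N`.
      have g2 : ∀ l, ∫ ω, (∑ a, M.coef K l a * M.slopeDev K N (fun i => W i ω) j a) ^ 2 ∂P
          ≤ Cs ^ 2 * (Cφ * Cc) / N := fun l => by
        simp only [sum_mul_slopeDev h hK]
        refine (integral_emean_sub_sq_le hlaw hindep
          (memLp_slope_mul h.basic h.ident h.prop j (hf l)) hN).trans ?_
        gcongr
        refine (hsl j (hf l)).trans ?_
        gcongr
        exact hfI l
      refine (Finset.sum_le_sum fun l _ => g2 l).trans (le_of_eq ?_)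
      simp
    calc (N : ℝ) * ∑ j, ∫ ω, ∑ l,
          (∑ a, M.coef K l a * M.slopeDev K N (fun i => W i ω) j a) ^ 2 ∂P
        ≤ (N : ℝ) * ∑ _j : Fin p, (p + 1) * (Cs ^ 2 * (Cφ * Cc) / N) := by
          gcongr with j; exact g1 j
      _ = _ := by simp; field_simp
  have b5 : ∫ ω, ∑ l, emean (fun x => (∑ a, M.coef K l a * M.phi K a x.Z) ^ 2) N
      (fun i => W i ω) ∂P ≤ (p + 1) * (Cφ * Cc) := by
    rw [integral_finsetSum _ fun l _ => i5' l]
    simp only [fun l => integral_emean hlaw (hf l).integrable_sq hN]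
    refine (Finset.sum_le_sum fun l _ => hfI l).trans (le_of_eq ?_)
    simp
  have b6 : ∫ ω, (N : ℝ) * ∑ l, (∑ a, M.coef K l a * M.moment₀ K N (fun i => W i ω) a) ^ 2 ∂P
      ≤ (p + 1) * Cψ ^ 2 := by
    rw [integral_const_mul, integral_finsetSum _ fun l _ => i6' l]
    have g1 : ∀ l, ∫ ω, (∑ a, M.coef K l a * M.moment₀ K N (fun i => W i ω) a) ^ 2 ∂P
        ≤ Cψ ^ 2 / N := fun l => by
      simp only [sum_mul_moment₀]
      have hg := memLp_sum_mul (fun a => memLp_moment h hK a) (M.coef K l)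
      have hmean : ∫ x, ∑ a, M.coef K l a * M.g K M.γ₀ M.θ₀ x a ∂M.law = 0 := by
        rw [integral_finsetSum _ fun a _ =>
          ((memLp_moment h hK a).integrable one_le_two).const_mul _]
        simp [integral_const_mul, integral_g h.basic h.ident h.basis h.prop hK]
      have := integral_emean_sub_sq_le hlaw hindep hg hN
      rw [hmean] at this
      simp only [sub_zero] at this
      refine this.trans ?_
      gcongr
      -- The second moment is the quadratic form of `D` at `D⁻¹B e_l`, that is, the squared norm of
      -- the projection of `psi l`, which is at most that of `psi l`.
      have e : ∫ x, (∑ a, M.coef K l a * M.g K M.γ₀ M.θ₀ x a) ^ 2 ∂M.law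
          = ‖M.deriv K (EuclideanSpace.single l 1)‖ ^ 2 := by
        rw [deriv_single h hK, ← real_inner_self_eq_norm_sq, inner_embed_B_embed h hK]
        simp only [pow_two]
        rw [← D_quad h.basic h.ident h.basis h.prop hK]
        congr 1
        rw [coef, D_mulVec_inv h hK]
      rw [e]
      have g3 := (norm_deriv_le K (EuclideanSpace.single l 1)).trans
        (hψ (EuclideanSpace.single l 1))
      rw [PiLp.norm_single, norm_one, mul_one] at g3
      gcongr
    calc (N : ℝ) * ∑ l, ∫ ω, (∑ a, M.coef K l a * M.moment₀ K N (fun i => W i ω) a) ^ 2 ∂P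
        ≤ (N : ℝ) * ∑ _l : Fin p ⊕ Unit, Cψ ^ 2 / N := by
          gcongr with l; exact g1 l
      _ = _ := by simp; field_simp
  obtain ⟨hint, heq⟩ := integral_sum_six i1 i2 i3 i4 i5 i6
  refine ⟨hint, ?_⟩
  change ∫ ω, (_ + _ + _ + _ + _ + _) ∂P ≤ _
  rw [heq]
  exact add_le_add (add_le_add (add_le_add (add_le_add (add_le_add b1 b2) b3) b4) b5) b6

end
end Model
end MNAR

/-! ### Expansion of the embedded empirical moments around the truth. -/

namespace MNAR
namespace Model
variable {p r₁ r₂ : ℕ} (M : Model p r₁ r₂)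

/-- The empirical moments at `(γ, θ)`. -/
noncomputable def moment (K N : ℕ) (w : ℕ → Obs r₁ r₂) (γ : Par p) (θ : ℝ) (a : Fin K ⊕ Unit) : ℝ :=
  emean (fun x => M.g K γ θ x a) N w

/-- The coordinates that belong to the propensity parameter. -/
noncomputable def parPart (d : FullPar p) : Par p := WithLp.toLp 2 fun j => d (Sum.inl j)

/-- The difference between a parameter `(γ, θ)` and the true one. -/
noncomputable def diff (γ : Par p) (θ : ℝ) : FullPar p :=
  WithLp.toLp 2 (Sum.elim (fun j => γ j - M.γ₀ j) fun _ => θ - M.θ₀)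

/-- The nonlinear remainder of `rho` in its expansion between `γ'` and `γ`. -/
noncomputable def rhoRem (γ γ' : Par p) (x : Obs r₁ r₂) : ℝ :=
  M.rho γ x - M.rho γ' x - ∑ j, M.slope j x * (γ j - γ' j)

/-- The remainder of the empirical moments in their expansion between `γ'` and `γ`. -/
noncomputable def remVec (K N : ℕ) (w : ℕ → Obs r₁ r₂) (γ γ' : Par p) (a : Fin K ⊕ Unit) : ℝ :=
  ∑ j, (γ j - γ' j) * M.slopeDev K N w j a
    + emean (fun x => M.rhoRem γ γ' x * M.phi K a x.Z) N w

section
variable {M}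

lemma norm_parPart_le (d : FullPar p) : ‖parPart d‖ ≤ ‖d‖ := by
  rw [EuclideanSpace.norm_eq, EuclideanSpace.norm_eq]
  refine Real.sqrt_le_sqrt ?_
  rw [Fintype.sum_sum_type]
  exact le_add_of_nonneg_right (Finset.sum_nonneg fun _ _ => sq_nonneg _)

lemma parPart_diff (γ : Par p) (θ : ℝ) : parPart (M.diff γ θ) = γ - M.γ₀ := by
  ext j; simp [parPart, diff]

lemma remVec_eq {K N : ℕ} (w : ℕ → Obs r₁ r₂) (γ γ' : Par p) (a : Fin K ⊕ Unit) :
    M.remVec K N w γ γ' a = emean (fun x => (M.rho γ x - M.rho γ' x) * M.phi K a x.Z) N w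
      - ∑ j, M.B K a (Sum.inl j) * (γ j - γ' j) := by
  have e : (fun x : Obs r₁ r₂ => (M.rho γ x - M.rho γ' x) * M.phi K a x.Z)
      = fun x => M.rhoRem γ γ' x * M.phi K a x.Z
        + ∑ j, (γ j - γ' j) * (M.slope j x * M.phi K a x.Z) := by
    ext x
    have : ∑ j, (γ j - γ' j) * (M.slope j x * M.phi K a x.Z)
        = (∑ j, M.slope j x * (γ j - γ' j)) * M.phi K a x.Z := by
      rw [Finset.sum_mul]; exact Finset.sum_congr rfl fun j _ => by ring
    rw [this, rhoRem]; ring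
  have e2 : ∑ j, M.B K a (Sum.inl j) * (γ j - γ' j) = ∑ j, (γ j - γ' j) * M.B K a (Sum.inl j) :=
    Finset.sum_congr rfl fun j _ => mul_comm _ _
  rw [e, emean_add, emean_sum, remVec, e2]
  have e3 : ∑ j, (γ j - γ' j) * M.slopeDev K N w j a
      = ∑ j, emean (fun x => (γ j - γ' j) * (M.slope j x * M.phi K a x.Z)) N w
        - ∑ j, (γ j - γ' j) * M.B K a (Sum.inl j) := by
    rw [← Finset.sum_sub_distrib]
    exact Finset.sum_congr rfl fun j _ => by rw [emean_const_mul, slopeDev]; ring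
  rw [e3]; ring

/-- The subtracted linear part always uses the derivative at `γ₀`, so remainders are additive along
chains of parameters. A bound for the remainder between two points is thus a Lipschitz bound. -/
lemma remVec_sub {K N : ℕ} (w : ℕ → Obs r₁ r₂) (γ γ' : Par p) (a : Fin K ⊕ Unit) :
    M.remVec K N w γ M.γ₀ a - M.remVec K N w γ' M.γ₀ a = M.remVec K N w γ γ' a := by
  simp only [remVec_eq]
  have e : (fun x : Obs r₁ r₂ => (M.rho γ x - M.rho γ' x) * M.phi K a x.Z)
      = fun x => (M.rho γ x - M.rho M.γ₀ x) * M.phi K a x.Z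
        - (M.rho γ' x - M.rho M.γ₀ x) * M.phi K a x.Z := by
    ext x; ring
  rw [e, emean_sub]
  have : ∑ j, M.B K a (Sum.inl j) * (γ j - γ' j)
      = ∑ j, M.B K a (Sum.inl j) * (γ j - M.γ₀ j) - ∑ j, M.B K a (Sum.inl j) * (γ' j - M.γ₀ j) := by
    rw [← Finset.sum_sub_distrib]; exact Finset.sum_congr rfl fun j _ => by ring
  rw [this]; ring

lemma G_eq (K N : ℕ) (w : ℕ → Obs r₁ r₂) (γ : Par p) (θ : ℝ) :
    M.G K N w γ θ = (N : ℝ) • M.moment K N w γ θ := by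
  ext a
  rcases Nat.eq_zero_or_pos N with rfl | hN
  · simp [G]
  · have : (N : ℝ) ≠ 0 := by positivity
    simp [G, moment, emean, this]

variable [IsProbabilityMeasure M.law]

lemma criterion_eq (h : M.Regular) {K : ℕ} (hK : p ≤ K) (N : ℕ) (w : ℕ → Obs r₁ r₂) (γ : Par p)
    (θ : ℝ) : M.criterion K N w γ θ = (N * ‖M.embed K (M.moment K N w γ θ)‖) ^ 2 := by
  rw [criterion, ← inner_embed h hK, real_inner_self_eq_norm_sq, G_eq, map_smul, norm_smul]
  simp

lemma IsBestGMM.norm_embed_le (h : M.Regular) {K N : ℕ} (hK : p ≤ K) (hN : N ≠ 0)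
    {w : ℕ → Obs r₁ r₂} {γ γ' : Par p} {θ θ' : ℝ} (hmin : M.IsBestGMM K N w γ θ) (hγ' : γ' ∈ M.Γ)
    (hθ' : θ' ∈ M.Θ) :
    ‖M.embed K (M.moment K N w γ θ)‖ ≤ ‖M.embed K (M.moment K N w γ' θ')‖ := by
  have h1 := hmin.2.2 γ' hγ' θ' hθ'
  rw [criterion_eq h hK, criterion_eq h hK] at h1
  have hN' : (0 : ℝ) < N := by positivity
  exact le_of_mul_le_mul_left ((sq_le_sq₀ (by positivity) (by positivity)).1 h1) hN'

/-- The expansion is exact. The `θ` direction contributes only to the linear term, so the remainder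
depends on `γ` alone. -/
lemma embed_moment (h : M.Regular) {K N : ℕ} (hK : p ≤ K) (hN : N ≠ 0) (w : ℕ → Obs r₁ r₂)
    (γ : Par p) (θ : ℝ) :
    M.embed K (M.moment K N w γ θ) = M.embed K (M.moment₀ K N w) + M.deriv K (M.diff γ θ)
      + M.embed K (M.remVec K N w γ M.γ₀) := by
  rw [deriv_eq h hK, ← map_add, ← map_add]
  congr 1
  ext a
  have e : (fun x : Obs r₁ r₂ => M.g K γ θ x a)
      = fun x => M.g K M.γ₀ M.θ₀ x a + (M.rho γ x - M.rho M.γ₀ x) * M.phi K a x.Z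
        + lastInd a * (θ - M.θ₀) := by
    ext x; simp only [g_eq]; ring
  have hB : ∑ j, M.B K a j * M.diff γ θ j
      = ∑ j, M.B K a (Sum.inl j) * (γ j - M.γ₀ j) + lastInd a * (θ - M.θ₀) := by
    rw [Fintype.sum_sum_type]
    simp [diff, B_inr]
  rw [moment, e, emean_add, emean_add, emean_const _ hN]
  simp only [Pi.add_apply, hB, remVec_eq, moment₀]
  ring

/-- The remainder is small, uniformly near the true parameter. -/
lemma norm_embed_remVec_le {K N : ℕ} {w : ℕ → Obs r₁ r₂} {A Ce L σ : ℝ} (hCe : 0 ≤ Ce) (hA : 0 ≤ A)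
    (hσ : 0 ≤ σ)
    (hL : 0 ≤ L) (hN : N ≠ 0) (he : ∀ v : Fin K ⊕ Unit → ℝ, ‖M.embed K v‖ ^ 2 ≤ Ce * ∑ a, v a ^ 2)
    (hnoise : M.noise K N w ≤ A) {γ γ' : Par p}
    (hrem : ∀ i, |M.rhoRem γ γ' (w i)| ≤ L * σ * ‖γ - γ'‖) :
    ‖M.embed K (M.remVec K N w γ γ')‖
      ≤ √(Ce * A) * (p + L) * (√((K + 1) / N) + σ * √(K + 1)) * ‖γ - γ'‖ := by
  obtain ⟨-, b2, b3, -, -, -⟩ := noise_bounds hnoise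
  have hN' : (0 : ℝ) < N := by positivity
  have hK' : (0 : ℝ) < (K : ℝ) + 1 := by positivity
  have e1 : M.embed K (M.remVec K N w γ γ')
      = ∑ j, (γ j - γ' j) • M.embed K (M.slopeDev K N w j)
        + M.embed K (fun a => emean (fun x => M.rhoRem γ γ' x * M.phi K a x.Z) N w) := by
    simp only [← map_smul, ← map_sum]
    rw [← map_add]
    congr 1
    ext a
    simp [remVec]
  have h1 : ∀ j, ‖M.embed K (M.slopeDev K N w j)‖ ≤ √(Ce * A) * √((K + 1) / N) := fun j => by
    rw [← Real.sqrt_mul (by positivity)]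
    refine Real.le_sqrt_of_sq_le ((he _).trans ?_)
    have h2 := b2 j
    rw [div_mul_eq_mul_div, div_le_iff₀ hK'] at h2
    rw [mul_assoc]
    refine mul_le_mul_of_nonneg_left ?_ hCe
    rw [mul_div_assoc', le_div_iff₀ hN']
    linarith
  -- The Taylor remainder is bounded pointwise and `phi` only in empirical mean square. Summing over
  -- all coordinates costs the factor `√(K + 1)`.
  have h3 : ‖M.embed K (fun a => emean (fun x => M.rhoRem γ γ' x * M.phi K a x.Z) N w)‖
      ≤ √(Ce * A) * √(K + 1) * (L * σ * ‖γ - γ'‖) := by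
    set q := L * σ * ‖γ - γ'‖ with hq
    have hq0 : 0 ≤ q := by positivity
    rw [← Real.sqrt_mul (by positivity), ← Real.sqrt_sq hq0, ← Real.sqrt_mul (by positivity)]
    refine Real.le_sqrt_of_sq_le ((he _).trans ?_)
    have h4 : ∀ a : Fin K ⊕ Unit, emean (fun x => M.rhoRem γ γ' x * M.phi K a x.Z) N w ^ 2
        ≤ q ^ 2 * emean (fun x => M.phi K a x.Z ^ 2) N w := fun a => by
      rw [← emean_const_mul]
      refine (sq_emean_le _ _ _).trans (emean_mono fun i => ?_)
      rw [mul_pow]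
      refine mul_le_mul_of_nonneg_right ?_ (sq_nonneg _)
      exact sq_le_sq.2 ((hrem i).trans (le_abs_self _))
    have h5 : ∑ a : Fin K ⊕ Unit, emean (fun x => M.phi K a x.Z ^ 2) N w ≤ (K + 1) * A := by
      rwa [inv_mul_le_iff₀ hK'] at b3
    calc Ce * ∑ a : Fin K ⊕ Unit, emean (fun x => M.rhoRem γ γ' x * M.phi K a x.Z) N w ^ 2
        ≤ Ce * ∑ a : Fin K ⊕ Unit, q ^ 2 * emean (fun x => M.phi K a x.Z ^ 2) N w := by
          gcongr with a; exact h4 a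
      _ ≤ Ce * (q ^ 2 * ((K + 1) * A)) := by rw [← Finset.mul_sum]; gcongr
      _ = _ := by ring
  have h6 : ‖∑ j, (γ j - γ' j) • M.embed K (M.slopeDev K N w j)‖
      ≤ p * (‖γ - γ'‖ * (√(Ce * A) * √((K + 1) / N))) := by
    refine (norm_sum_le _ _).trans ((Finset.sum_le_sum fun j _ => ?_).trans_eq
      (by rw [Finset.sum_const, Finset.card_univ, Fintype.card_fin, nsmul_eq_mul]))
    rw [norm_smul]
    exact mul_le_mul (PiLp.norm_apply_le (γ - γ') j) (h1 j) (norm_nonneg _) (norm_nonneg _)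
  rw [e1]
  refine (norm_add_le _ _).trans ((add_le_add h6 h3).trans ?_)
  have z1 : 0 ≤ L * (‖γ - γ'‖ * (√(Ce * A) * √((K + 1) / N))) := by positivity
  have z2 : 0 ≤ p * (√(Ce * A) * √(K + 1) * (σ * ‖γ - γ'‖)) := by positivity
  linarith

/-- The component of the remainder along the range of the derivative is even smaller. -/
lemma abs_inner_deriv_remVec_le (h : M.Regular) {K N : ℕ} (hK : p ≤ K) {w : ℕ → Obs r₁ r₂}
    {A L τ : ℝ} (hA : 0 ≤ A) (hL : 0 ≤ L) (hN : N ≠ 0) (hτ : 0 ≤ τ)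
    (hnoise : M.noise K N w ≤ A) {γ : Par p} (d : FullPar p) (hd : ‖γ - M.γ₀‖ ≤ ‖d‖)
    (hrem : ∀ i, |M.rhoRem γ M.γ₀ (w i)| ≤ L * τ * ‖γ - M.γ₀‖) :
    |inner ℝ (M.deriv K d) (M.embed K (M.remVec K N w γ M.γ₀))|
      ≤ √A * (p + 1) * (p + L) * (√((K + 1) / N) + τ) * ‖d‖ ^ 2 := by
  obtain ⟨-, -, -, b4, b5, -⟩ := noise_bounds hnoise
  have hN' : (0 : ℝ) < N := by positivity
  have hK' : (0 : ℝ) < (K : ℝ) + 1 := by positivity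
  rw [deriv_eq_sum h hK, sum_inner]
  simp only [real_inner_smul_left, inner_embed_B_embed h hK]
  set s := √(((K : ℝ) + 1) / N) with hs
  have hs0 : 0 ≤ s := Real.sqrt_nonneg _
  -- The noise bound gives even `√(A/N)`; it is weakened to `√A * s` to match the other terms.
  have h1 : ∀ j l, |∑ a, M.coef K l a * M.slopeDev K N w j a| ≤ √A * s := fun j l => by
    rw [hs, ← Real.sqrt_mul hA]
    refine Real.abs_le_sqrt ?_
    rw [mul_div_assoc', le_div_iff₀ hN', mul_comm]
    refine (b4 j l).trans ?_
    have : 0 ≤ A * K := by positivity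
    linarith
  have h2 : ∀ l, |emean (fun x => M.rhoRem γ M.γ₀ x * ∑ a, M.coef K l a * M.phi K a x.Z) N w|
      ≤ √A * (L * τ * ‖d‖) := fun l => by
    have hq0 : 0 ≤ L * τ * ‖d‖ := by positivity
    rw [← Real.sqrt_sq hq0, ← Real.sqrt_mul hA]
    refine Real.abs_le_sqrt ?_
    rw [mul_comm]
    refine (sq_emean_le _ _ _).trans (le_trans ?_ (mul_le_mul_of_nonneg_left (b5 l) (sq_nonneg _)))
    rw [← emean_const_mul]
    refine emean_mono fun i => ?_
    rw [mul_pow]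
    refine mul_le_mul_of_nonneg_right ?_ (sq_nonneg _)
    refine sq_le_sq.2 (le_trans ?_ (le_abs_self _))
    exact (hrem i).trans (by gcongr)
  have h3 : ∀ l, |dotProduct (M.coef K l) (M.remVec K N w γ M.γ₀)|
      ≤ √A * (p + L) * (s + τ) * ‖d‖ := fun l => by
    have e : dotProduct (M.coef K l) (M.remVec K N w γ M.γ₀)
        = ∑ j, (γ j - M.γ₀ j) * (∑ a, M.coef K l a * M.slopeDev K N w j a)
          + emean (fun x => M.rhoRem γ M.γ₀ x * ∑ a, M.coef K l a * M.phi K a x.Z) N w := by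
      have e1 : (fun x : Obs r₁ r₂ => M.rhoRem γ M.γ₀ x * ∑ a, M.coef K l a * M.phi K a x.Z)
          = fun x => ∑ a, M.coef K l a * (M.rhoRem γ M.γ₀ x * M.phi K a x.Z) := by
        ext x; rw [Finset.mul_sum]; exact Finset.sum_congr rfl fun a _ => by ring
      rw [e1, emean_sum]
      simp only [emean_const_mul, dotProduct, remVec, mul_add, Finset.sum_add_distrib,
        Finset.mul_sum]
      rw [Finset.sum_comm]
      congr 1
      exact Finset.sum_congr rfl fun j _ => Finset.sum_congr rfl fun a _ => by ring
    have h4 : |∑ j, (γ j - M.γ₀ j) * (∑ a, M.coef K l a * M.slopeDev K N w j a)|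
        ≤ p * (‖d‖ * (√A * s)) := by
      refine (Finset.abs_sum_le_sum_abs _ _).trans ((Finset.sum_le_sum fun j _ => ?_).trans_eq
        (by rw [Finset.sum_const, Finset.card_univ, Fintype.card_fin, nsmul_eq_mul]))
      rw [abs_mul]
      exact mul_le_mul ((PiLp.norm_apply_le (γ - M.γ₀) j).trans hd) (h1 j l) (abs_nonneg _)
        (norm_nonneg _)
    rw [e]
    refine (abs_add_le _ _).trans ((add_le_add h4 (h2 l)).trans ?_)
    have z1 : 0 ≤ L * (‖d‖ * (√A * s)) := by positivity
    have z2 : 0 ≤ p * (√A * (τ * ‖d‖)) := by positivity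
    linarith
  refine (Finset.abs_sum_le_sum_abs _ _).trans ?_
  calc ∑ l, |d l * dotProduct (M.coef K l) (M.remVec K N w γ M.γ₀)|
      ≤ ∑ _l : Fin p ⊕ Unit, ‖d‖ * (√A * (p + L) * (s + τ) * ‖d‖) := by
        refine Finset.sum_le_sum fun l _ => ?_
        rw [abs_mul]
        exact mul_le_mul (PiLp.norm_apply_le d l) (h3 l) (abs_nonneg _) (norm_nonneg _)
    _ = _ := by simp; ring

end

/-! ### The linear approximation of the estimator and its error. -/

/-- The linear approximation of the estimator. -/
noncomputable def linEst (K N : ℕ) (w : ℕ → Obs r₁ r₂) : FullPar p :=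
  WithLp.toLp 2 (-(M.V K).mulVec fun l => dotProduct (M.coef K l) (M.moment₀ K N w))

section
variable {M} [IsProbabilityMeasure M.law]

/-- These are the normal equations: multiplying `linEst` by the information matrix cancels `V` and
leaves minus the inner products of the moments with the columns of the derivative. -/
lemma inner_deriv_linEst (h : M.Regular) {K : ℕ} (hK : p ≤ K) (hV : IsUnit (M.info K).det) (N : ℕ)
    (w : ℕ → Obs r₁ r₂) (d : FullPar p) :
    inner ℝ (M.deriv K d) (M.embed K (M.moment₀ K N w) + M.deriv K (M.linEst K N w)) = 0 := by
  have h1 : (M.info K).mulVec (M.linEst K N w)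
      = -fun l => dotProduct (M.coef K l) (M.moment₀ K N w) := by
    simp only [linEst]
    rw [Matrix.mulVec_neg, V, Matrix.mulVec_mulVec, Matrix.mul_nonsing_inv _ hV, Matrix.one_mulVec]
  rw [deriv_eq_sum h hK d, sum_inner]
  refine Finset.sum_eq_zero fun l _ => ?_
  rw [real_inner_smul_left, inner_add_right, inner_embed_B_embed h hK, deriv_eq_sum h hK, inner_sum]
  have h2 : ∑ j, inner ℝ (M.embed K fun a => M.B K a l)
      (M.linEst K N w j • M.embed K fun a => M.B K a j)
      = (M.info K).mulVec (M.linEst K N w) l := by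
    simp only [Matrix.mulVec, dotProduct, info_apply h hK, real_inner_smul_right]
    exact Finset.sum_congr rfl fun j _ => mul_comm _ _
  rw [h2, h1]
  simp

/-- Test the normal equations with `linEst` itself. The squared norm of its derivative equals a
combination of the `p + 1` projected empirical moments, each of which is small by the noise bound.
-/
lemma norm_linEst_le (h : M.Regular) {K N : ℕ} (hK : p ≤ K) (hN : N ≠ 0)
    (hV : IsUnit (M.info K).det) {w : ℕ → Obs r₁ r₂} {A c : ℝ} (hA : 0 ≤ A) (hc : 0 < c)
    (hlow : ∀ d, c * ‖d‖ ≤ ‖M.deriv K d‖) (hnoise : M.noise K N w ≤ A) :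
    ‖M.linEst K N w‖ ≤ (p + 1) * √A / c ^ 2 * √((K + 1) / N) := by
  obtain ⟨-, -, -, -, -, b6⟩ := noise_bounds hnoise
  have hN' : (0 : ℝ) < N := by positivity
  set e := M.linEst K N w with he
  set s := √(((K : ℝ) + 1) / N) with hs
  have h1 : ∀ l, |dotProduct (M.coef K l) (M.moment₀ K N w)| ≤ √A * s := fun l => by
    rw [hs, ← Real.sqrt_mul hA]
    refine Real.abs_le_sqrt ?_
    rw [mul_div_assoc', le_div_iff₀ hN', mul_comm]
    refine (b6 l).trans ?_
    have : 0 ≤ A * K := by positivity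
    linarith
  have h2 := inner_deriv_linEst h hK hV N w e
  rw [inner_add_right, ← he, real_inner_self_eq_norm_sq, deriv_eq_sum h hK e, sum_inner,
    ← deriv_eq_sum h hK e] at h2
  simp only [real_inner_smul_left, inner_embed_B_embed h hK] at h2
  have h3 : -∑ l, e l * dotProduct (M.coef K l) (M.moment₀ K N w) ≤ (p + 1) * (‖e‖ * (√A * s)) := by
    refine (neg_le_abs _).trans ((Finset.abs_sum_le_sum_abs _ _).trans
      ((Finset.sum_le_sum fun l _ => ?_).trans_eq
        (b := ∑ _l : Fin p ⊕ Unit, ‖e‖ * (√A * s)) (by simp)))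
    rw [abs_mul]
    exact mul_le_mul (PiLp.norm_apply_le e l) (h1 l) (abs_nonneg _) (norm_nonneg _)
  have h4 : (c * ‖e‖) ^ 2 ≤ ‖M.deriv K e‖ ^ 2 := by gcongr; exact hlow e
  rw [div_mul_eq_mul_div, le_div_iff₀ (by positivity)]
  rcases (norm_nonneg e).eq_or_lt with h0 | h0
  · rw [← h0, zero_mul]; positivity
  · have h5 : ‖e‖ * (‖e‖ * c ^ 2) ≤ ‖e‖ * ((p + 1) * √A * s) := by nlinarith
    exact le_of_mul_le_mul_left h5 h0

lemma diff_parPart (d : FullPar p) : M.diff (M.γ₀ + parPart d) (M.θ₀ + d (Sum.inr ())) = d := by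
  ext j
  rcases j with j | _ <;> simp [diff, parPart]

/-- Verifies the hypotheses of `norm_sub_linear_minimizer_le` for `β = deriv K` on the event that
the noise is bounded. Here `s` is the size of the embedded moments, `k` the price of the dimension,
`q s` the radius of the crude localization, and `τ` the radius supplied by consistency. -/
lemma norm_diff_sub_linEst_le (h : M.Regular) {K N : ℕ} (hK : p ≤ K) (hN : N ≠ 0)
    (hVK : IsUnit (M.info K).det) {w : ℕ → Obs r₁ r₂} {A C c Ce Cψ L τ r r' s k q : ℝ} (hA : 0 ≤ A)
    (hc : 0 < c) (hCe : 0 < Ce) (hL : 0 ≤ L) (hτ0 : 0 ≤ τ) (hτr : τ ≤ r)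
    (hlow : ∀ d, c * ‖d‖ ≤ ‖M.deriv K d‖)
    (hembed : ∀ v : Fin K ⊕ Unit → ℝ, ‖M.embed K v‖ ^ 2 ≤ Ce * ∑ a, v a ^ 2)
    (hψ : ∀ d : FullPar p, ‖M.psiL2 d‖ ≤ Cψ * ‖d‖)
    (hball : Metric.closedBall M.γ₀ r ⊆ M.Γ) (hball' : Metric.closedBall M.θ₀ r' ⊆ M.Θ)
    (htaylor : ∀ i, ∀ s ≤ r, ∀ γ γ' : Par p, ‖γ - M.γ₀‖ ≤ s → ‖γ' - M.γ₀‖ ≤ s →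
      |M.rhoRem γ γ' (w i)| ≤ L * s * ‖γ - γ'‖)
    (hC1 : 1 ≤ C) (hC2 : Cψ ≤ C) (hC3 : √(Ce * A) ≤ C) (hC4 : √(Ce * A) * (p + L) ≤ C)
    (hC5 : √A * (p + 1) * (p + L) ≤ C) (hC6 : (p + 1) * √A / c ^ 2 ≤ C)
    (hs : s = √(((K : ℝ) + 1) / N)) (hk : k = √((K : ℝ) + 1)) (hq : q = 4 * C ^ 2 / c ^ 2 + C)
    (hCs : C * (s + τ) ≤ c ^ 2 / 2) (hqr : q * s ≤ r) (hqr' : q * s ≤ r')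
    (hρ : C * (s + q * s * k) ≤ c / 2) (hρ1 : C * (s + q * s * k) ≤ 1)
    (hnoise : M.noise K N w ≤ A) {γ : Par p} {θ : ℝ} (hmin : M.IsBestGMM K N w γ θ)
    (hγ : ‖γ - M.γ₀‖ ≤ τ) :
    ‖M.diff γ θ - M.linEst K N w‖ ≤ 32 * C ^ 2 / c ^ 2 * (C * (1 + q)) * (k * s ^ 2) := by
  have hN' : (0 : ℝ) < N := by positivity
  have hK' : (1 : ℝ) ≤ (K : ℝ) + 1 := by
    have : (0 : ℝ) ≤ K := by positivity
    linarith
  have hC0 : 0 ≤ C := zero_le_one.trans hC1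
  have hs0 : 0 ≤ s := hs ▸ Real.sqrt_nonneg _
  have hk1 : 1 ≤ k := hk ▸ Real.one_le_sqrt.2 hK'
  have hxs : ‖M.embed K (M.moment₀ K N w)‖ ≤ C * s := by
    have h1 : ‖M.embed K (M.moment₀ K N w)‖ ≤ √(Ce * A) * s := by
      rw [hs, ← Real.sqrt_mul (by positivity)]
      refine Real.le_sqrt_of_sq_le ((hembed _).trans ?_)
      have h2 := (noise_bounds hnoise).1
      rw [div_mul_eq_mul_div, div_le_iff₀ (by linarith)] at h2
      rw [mul_assoc]
      refine mul_le_mul_of_nonneg_left ?_ hCe.le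
      rw [mul_div_assoc', le_div_iff₀ hN']
      linarith
    exact h1.trans (mul_le_mul_of_nonneg_right hC3 hs0)
  have hes : ‖M.linEst K N w‖ ≤ C * s := by
    refine (norm_linEst_le h hK hN hVK hA hc hlow hnoise).trans ?_
    rw [← hs]
    exact mul_le_mul_of_nonneg_right hC6 hs0
  have hq1 : C * s ≤ q * s := by
    refine mul_le_mul_of_nonneg_right ?_ hs0
    rw [hq]
    exact le_add_of_nonneg_left (by positivity)
  have hmem : ∀ d : FullPar p, ‖d‖ ≤ r → M.γ₀ + parPart d ∈ M.Γ := fun d hd => hball (by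
    rw [Metric.mem_closedBall, dist_eq_norm, add_sub_cancel_left]
    exact (norm_parPart_le d).trans hd)
  have hRlip : ∀ σ ≤ r, ∀ d d' : FullPar p, ‖d‖ ≤ σ → ‖d'‖ ≤ σ →
      ‖M.embed K (M.remVec K N w (M.γ₀ + parPart d) M.γ₀)
        - M.embed K (M.remVec K N w (M.γ₀ + parPart d') M.γ₀)‖
        ≤ C * (s + σ * k) * ‖d - d'‖ := by
    intro σ hσ d d' hd hd'
    have hσ0 : 0 ≤ σ := (norm_nonneg _).trans hd
    have e1 : M.remVec K N w (M.γ₀ + parPart d) M.γ₀ - M.remVec K N w (M.γ₀ + parPart d') M.γ₀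
        = M.remVec K N w (M.γ₀ + parPart d) (M.γ₀ + parPart d') := by
      ext a
      exact remVec_sub w _ _ a
    have e2 : M.γ₀ + parPart d - (M.γ₀ + parPart d') = parPart (d - d') := by
      ext j; simp [parPart]
    have h1 := norm_embed_remVec_le (M := M) (γ := M.γ₀ + parPart d) (γ' := M.γ₀ + parPart d')
      hCe.le hA hσ0 hL hN hembed hnoise fun i => htaylor i σ hσ _ _
        (by rw [add_sub_cancel_left]; exact (norm_parPart_le d).trans hd)
        (by rw [add_sub_cancel_left]; exact (norm_parPart_le d').trans hd')
    rw [← map_sub, e1]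
    refine h1.trans ?_
    rw [e2, ← hs, ← hk]
    have hsk : 0 ≤ s + σ * k := by positivity
    exact mul_le_mul (mul_le_mul_of_nonneg_right hC4 hsk) (norm_parPart_le _) (norm_nonneg _)
      (by positivity)
  have hdiff : M.γ₀ + parPart (M.diff γ θ) = γ := by rw [parPart_diff]; abel
  have hγd : ‖γ - M.γ₀‖ ≤ ‖M.diff γ θ‖ := by
    rw [← parPart_diff (M := M) γ θ]; exact norm_parPart_le _
  have hRin : |inner ℝ (M.deriv K (M.diff γ θ))
      (M.embed K (M.remVec K N w (M.γ₀ + parPart (M.diff γ θ)) M.γ₀))|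
      ≤ C * (s + τ) * ‖M.diff γ θ‖ ^ 2 := by
    rw [hdiff]
    refine (abs_inner_deriv_remVec_le h hK hA hL hN hτ0 hnoise _ hγd fun i =>
      htaylor i τ hτr _ _ hγ (by simpa using hτ0)).trans ?_
    rw [← hs]
    exact mul_le_mul_of_nonneg_right (mul_le_mul_of_nonneg_right hC5 (by positivity)) (sq_nonneg _)
  have hval : M.embed K (M.moment₀ K N w) + M.deriv K (M.diff γ θ)
      + M.embed K (M.remVec K N w (M.γ₀ + parPart (M.diff γ θ)) M.γ₀)
      = M.embed K (M.moment K N w γ θ) := by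
    rw [hdiff, embed_moment h hK hN]
  have hR0 : M.embed K (M.remVec K N w (M.γ₀ + parPart (0 : FullPar p)) M.γ₀) = 0 := by
    have e1 : M.γ₀ + parPart (0 : FullPar p) = M.γ₀ := by ext j; simp [parPart]
    have e2 : M.remVec K N w M.γ₀ M.γ₀ = 0 := by
      ext a
      have e3 := remVec_sub (M := M) (K := K) (N := N) w M.γ₀ M.γ₀ a
      rw [sub_self] at e3
      exact e3.symm
    rw [e1, e2, map_zero]
  have hmin₁ : ‖M.embed K (M.moment K N w γ θ)‖
      ≤ ‖M.embed K (M.moment₀ K N w) + M.deriv K (M.linEst K N w)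
        + M.embed K (M.remVec K N w (M.γ₀ + parPart (M.linEst K N w)) M.γ₀)‖ := by
    have h1 := embed_moment h hK hN w (M.γ₀ + parPart (M.linEst K N w))
      (M.θ₀ + M.linEst K N w (Sum.inr ()))
    rw [diff_parPart] at h1
    rw [← h1]
    -- The linear approximation is an admissible competitor: it lies in the balls around the true
    -- values that are contained in `Γ` and `Θ`.
    refine hmin.norm_embed_le h hK hN (hmem _ (hes.trans (hq1.trans hqr))) (hball' ?_)
    rw [Metric.mem_closedBall, dist_eq_norm, add_sub_cancel_left]
    exact (PiLp.norm_apply_le _ _).trans (hes.trans (hq1.trans hqr'))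
  have hmin₀ : ‖M.embed K (M.moment K N w γ θ)‖ ≤ ‖M.embed K (M.moment₀ K N w)‖ :=
    hmin.norm_embed_le h hK hN h.ident.γ₀_mem_Γ (interior_subset h.ident.θ₀_mem)
  rw [← hval] at hmin₀ hmin₁
  have hup : ∀ d : FullPar p, ‖M.deriv K d‖ ≤ C * ‖d‖ := fun d =>
    ((norm_deriv_le K d).trans (hψ d)).trans (mul_le_mul_of_nonneg_right hC2 (norm_nonneg _))
  subst hq
  exact norm_sub_linear_minimizer_le (β := M.deriv K)
    (R := fun d => M.embed K (M.remVec K N w (M.γ₀ + parPart d) M.γ₀)) hc hC1 hs0 hk1 (deriv_sub K)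
    hlow hup hxs hes (inner_deriv_linEst h hK hVK N w) hR0 hRlip hRin hCs hqr hρ hρ1 hmin₀ hmin₁

/-- On the event that the noise is bounded, a minimizer of the criterion that is close to the true
value is close to its linear approximation. -/
theorem exists_rate (h : M.Regular) (hV : ∀ᶠ K in atTop, IsUnit (M.info K).det) {A : ℝ}
    (hA : 0 ≤ A) : ∃ τ : ℝ, 0 < τ ∧ ∃ ε : ℝ, 0 < ε ∧ ∃ C : ℝ, ∀ᶠ K : ℕ in atTop, ∀ N : ℕ, N ≠ 0 →
      √(((K : ℝ) + 1) ^ 3 / N) ≤ ε → ∀ w : ℕ → Obs r₁ r₂, (∀ i, (w i).X ∈ M.suppX) →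
        M.noise K N w ≤ A → ∀ γ θ, M.IsBestGMM K N w γ θ → ‖γ - M.γ₀‖ ≤ τ →
          √N * ‖M.diff γ θ - M.linEst K N w‖ ≤ C * √(((K : ℝ) + 1) ^ 3 / N) := by
  obtain ⟨Q, hQ, hQ'⟩ := exists_limit_projection h
  obtain ⟨c, hc, -, hlow⟩ := exists_deriv_lower h hV hQ hQ'
  obtain ⟨Ce, hCe, hembed⟩ := exists_embed_bound h
  obtain ⟨Cψ, hCψ, hψ⟩ := exists_psi_bound (M := M)
  obtain ⟨r, hr, hball, L, hL, htaylor⟩ := exists_taylor h.ident h.prop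
  obtain ⟨r', hr', hball'⟩ := Metric.nhds_basis_closedBall.mem_iff.1
    (mem_interior_iff_mem_nhds.1 h.ident.θ₀_mem)
  obtain ⟨C, hC1, hC2, hC3, hC4, hC5, hC6⟩ : ∃ C : ℝ, 1 ≤ C ∧ Cψ ≤ C ∧ √(Ce * A) ≤ C ∧
      √(Ce * A) * (p + L) ≤ C ∧ √A * (p + 1) * (p + L) ≤ C ∧ (p + 1) * √A / c ^ 2 ≤ C := by
    have z1 : 0 ≤ √(Ce * A) := Real.sqrt_nonneg _
    have z2 : 0 ≤ √(Ce * A) * (p + L) := by positivity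
    have z3 : 0 ≤ √A * (p + 1) * (p + L) := by positivity
    have z4 : 0 ≤ (p + 1) * √A / c ^ 2 := by positivity
    refine ⟨1 + Cψ + √(Ce * A) + √(Ce * A) * (p + L) + √A * (p + 1) * (p + L)
      + (p + 1) * √A / c ^ 2, ?_, ?_, ?_, ?_, ?_, ?_⟩ <;> linarith
  have hC0 : 0 < C := by linarith
  obtain ⟨q, hq⟩ : ∃ q, q = 4 * C ^ 2 / c ^ 2 + C := ⟨_, rfl⟩
  have hq0 : 0 < q := by rw [hq]; positivity
  have hm : 0 < min (c / 2) 1 := lt_min (by positivity) one_pos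
  -- The two occurrences of `c²/(4C)` give `C(s + τ) ≤ c²/2`. The quotients `r/q` and `r'/q` keep
  -- the localization radius `q s` inside the parameter sets, and the last entry makes the Lipschitz
  -- constant of the remainder small.
  refine ⟨min r (c ^ 2 / (4 * C)), lt_min hr (by positivity),
    min (min (c ^ 2 / (4 * C)) (min (r / q) (r' / q))) (min (c / 2) 1 / (C * (1 + q))),
    lt_min (lt_min (by positivity) (lt_min (by positivity) (by positivity))) (by positivity),
    32 * C ^ 2 / c ^ 2 * (C * (1 + q)), ?_⟩
  filter_upwards [hV, hlow, eventually_ge_atTop p] with K hVK hlowK hK N hN hKN w hw hnoise γ θ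
    hmin hγ
  have hN' : (0 : ℝ) < N := by positivity
  have hK' : (1 : ℝ) ≤ (K : ℝ) + 1 := by
    have : (0 : ℝ) ≤ K := by positivity
    linarith
  obtain ⟨s, hs⟩ : ∃ s, s = √(((K : ℝ) + 1) / N) := ⟨_, rfl⟩
  obtain ⟨k, hk⟩ : ∃ k, k = √((K : ℝ) + 1) := ⟨_, rfl⟩
  have hs0 : 0 ≤ s := hs ▸ Real.sqrt_nonneg _
  have hk1 : 1 ≤ k := hk ▸ Real.one_le_sqrt.2 hK'
  -- This is where `K³/N` appears: the error bound `k s²` times `√N` equals `s k²`, since `√N s =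
  -- k`.
  have hts : √(((K : ℝ) + 1) ^ 3 / N) = s * k ^ 2 := by
    rw [hk, Real.sq_sqrt (by linarith), hs,
      show ((K : ℝ) + 1) ^ 3 / N = ((K : ℝ) + 1) / N * ((K : ℝ) + 1) ^ 2 by ring,
      Real.sqrt_mul (by positivity), Real.sqrt_sq (by linarith)]
  rw [hts] at hKN ⊢
  have hskt : s * k ≤ s * k ^ 2 := mul_le_mul_of_nonneg_left (by nlinarith) hs0
  have hst : s ≤ s * k ^ 2 := le_trans (le_mul_of_one_le_right hs0 hk1) hskt
  have hNs : √N * s = k := by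
    rw [hs, hk, ← Real.sqrt_mul hN'.le, mul_div_cancel₀ _ hN'.ne']
  rw [le_min_iff, le_min_iff, le_min_iff] at hKN
  obtain ⟨⟨hε1, hε2, hε3⟩, hε4⟩ := hKN
  have hρ : C * (s + q * s * k) ≤ min (c / 2) 1 := by
    rw [le_div_iff₀ (by positivity)] at hε4
    refine le_trans ?_ hε4
    calc C * (s + q * s * k) = C * (s + q * (s * k)) := by ring
      _ ≤ C * (s * k ^ 2 + q * (s * k ^ 2)) :=
        mul_le_mul_of_nonneg_left (add_le_add hst (mul_le_mul_of_nonneg_left hskt hq0.le)) hC0.le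
      _ = _ := by ring
  have hCs : C * (s + min r (c ^ 2 / (4 * C))) ≤ c ^ 2 / 2 := by
    calc C * (s + min r (c ^ 2 / (4 * C))) ≤ C * (c ^ 2 / (4 * C) + c ^ 2 / (4 * C)) :=
          mul_le_mul_of_nonneg_left (add_le_add (hst.trans hε1) (min_le_right _ _)) hC0.le
      _ = _ := by field_simp; ring
  have key := norm_diff_sub_linEst_le h hK hN hVK (q := q) hA hc hCe hL
    (lt_min hr (by positivity)).le (min_le_left _ _) hlowK (fun v => (hembed K hK v).1) hψ hball
    hball' (fun i => htaylor (w i) (hw i)) hC1 hC2 hC3 hC4 hC5 hC6 hs hk hq hCs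
    (by rw [mul_comm, ← le_div_iff₀ hq0]; exact hst.trans hε2)
    (by rw [mul_comm, ← le_div_iff₀ hq0]; exact hst.trans hε3)
    (hρ.trans (min_le_left _ _)) (hρ.trans (min_le_right _ _)) hnoise hmin hγ
  calc √N * ‖M.diff γ θ - M.linEst K N w‖
      ≤ √N * (32 * C ^ 2 / c ^ 2 * (C * (1 + q)) * (k * s ^ 2)) :=
        mul_le_mul_of_nonneg_left key (Real.sqrt_nonneg _)
    _ = 32 * C ^ 2 / c ^ 2 * (C * (1 + q)) * (k * (√N * s) * s) := by ring
    _ = 32 * C ^ 2 / c ^ 2 * (C * (1 + q)) * (s * k ^ 2) := by rw [hNs]; ring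

end
end Model
end MNAR

/-! ### Consistency of the estimator of `γ`. -/

namespace MNAR

/-- Markov's inequality along a sequence. -/
lemma tendsto_measure_lt_of_integral_le {Ω : Type*} [MeasurableSpace Ω] {P : Measure Ω}
    [IsFiniteMeasure P] {X : ℕ → Ω → ℝ} {b : ℕ → ℝ} (h0 : ∀ N, 0 ≤ᵐ[P] X N)
    (hX : ∀ᶠ N in atTop, Integrable (X N) P ∧ ∫ ω, X N ω ∂P ≤ b N) (hb : Tendsto b atTop (𝓝 0))
    {t : ℝ} (ht : 0 < t) : Tendsto (fun N => P {ω | t < X N ω}) atTop (𝓝 0) := by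
  have h1 : Tendsto (fun N => ENNReal.ofReal (b N / t)) atTop (𝓝 0) := by
    have := ENNReal.tendsto_ofReal (hb.div_const t)
    simpa using this
  refine tendsto_of_tendsto_of_tendsto_of_le_of_le' tendsto_const_nhds h1
    (Eventually.of_forall fun _ => zero_le) ?_
  filter_upwards [hX] with N hN
  have h2 := mul_meas_ge_le_integral_of_nonneg (h0 N) hN.1 t
  have h3 : P.real {ω | t < X N ω} ≤ b N / t := by
    rw [le_div_iff₀ ht, mul_comm]
    refine le_trans ?_ (h2.trans hN.2)
    exact mul_le_mul_of_nonneg_left (measureReal_mono fun ω (hω : t < X N ω) => hω.le) ht.le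
  rw [← ofReal_measureReal]
  exact ENNReal.ofReal_le_ofReal h3

/-- The weak law of large numbers. -/
lemma tendsto_measure_emean_sub {𝒲 Ω : Type*} [MeasurableSpace 𝒲] [MeasurableSpace Ω]
    {μ : Measure 𝒲} {P : Measure Ω} [IsProbabilityMeasure μ] [IsProbabilityMeasure P]
    {W : ℕ → Ω → 𝒲} (hlaw : ∀ i, HasLaw (W i) μ P) (hindep : iIndepFun W P) {f : 𝒲 → ℝ}
    (hf : MemLp f 2 μ) {t : ℝ} (ht : 0 < t) :
    Tendsto (fun N => P {ω | t < |emean f N (fun i => W i ω) - ∫ x, f x ∂μ|}) atTop (𝓝 0) := by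
  have h1 := tendsto_measure_lt_of_integral_le (P := P)
    (X := fun N ω => (emean f N (fun i => W i ω) - ∫ x, f x ∂μ) ^ 2)
    (b := fun N => (∫ x, f x ^ 2 ∂μ) / N) (fun N => Eventually.of_forall fun _ => sq_nonneg _) ?_ ?_
    (t := t ^ 2) (by positivity)
  · refine h1.congr fun N => ?_
    congr 1; ext ω
    simp only [Set.mem_ofPred_eq]
    rw [sq_lt_sq, abs_of_pos ht]
  · filter_upwards [eventually_ne_atTop 0] with N hN
    exact ⟨((memLp_emean hlaw hf N).sub (memLp_const _)).integrable_sq,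
      integral_emean_sub_sq_le hlaw hindep hf hN⟩
  · exact tendsto_const_nhds.div_atTop tendsto_natCast_atTop_atTop

namespace Model
variable {p r₁ r₂ : ℕ} {M : Model p r₁ r₂} [IsProbabilityMeasure M.law]

lemma continuousOn_rho (hp : M.Propensity) {w : Obs r₁ r₂} (hw : w.X ∈ M.suppX) :
    ContinuousOn (fun γ => M.rho γ w) M.Γ := by
  obtain ⟨c, hc, -, h⟩ := exists_pi_bounds hp
  refine continuousOn_const.sub (continuousOn_const.div
    (hp.contDiff w.X hw w.Y).continuousOn fun γ hγ => ?_)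
  exact (hc.trans_le (h γ hγ w.X hw w.Y).1).ne'

/-- A measurable modulus of continuity of `γ ↦ 1 - T / π(Z; γ)` at a parameter. -/
lemma exists_modulus (hb : M.Basic) (hp : M.Propensity) {γ₁ : Par p} (hγ₁ : γ₁ ∈ M.Γ) :
    ∃ m : ℕ → Obs r₁ r₂ → ℝ, (∀ n, Measurable (m n)) ∧
      (∃ C : ℝ, ∀ n w, w.X ∈ M.suppX → |m n w| ≤ C) ∧
      (∀ w, w.X ∈ M.suppX → Tendsto (fun n => m n w) atTop (𝓝 0)) ∧
      ∀ (n : ℕ) w, w.X ∈ M.suppX → ∀ γ ∈ M.Γ, dist γ γ₁ < 1 / ((n : ℝ) + 1) →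
        |M.rho γ w - M.rho γ₁ w| ≤ m n w := by
  classical
  have : Nonempty M.Γ := ⟨⟨γ₁, hγ₁⟩⟩
  obtain ⟨C, hC, hbd⟩ := exists_rho_bound hp
  set d : ℕ → M.Γ := TopologicalSpace.denseSeq M.Γ with hd
  -- The modulus is the supremum over a countable dense set of parameters near `γ₁`, which keeps it
  -- measurable although `rho` is only measurable for each fixed `γ`.
  set q : ℕ → Obs r₁ r₂ → ℕ → ℝ := fun n w k =>
    if dist (d k : Par p) γ₁ < 1 / ((n : ℝ) + 1) then |M.rho (d k) w - M.rho γ₁ w| else 0 with hq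
  have hq0 : ∀ n w k, 0 ≤ q n w k := fun n w k => by
    simp only [hq]; split_ifs <;> positivity
  have hqC : ∀ n w, w.X ∈ M.suppX → ∀ k, q n w k ≤ C + C := fun n w hw k => by
    simp only [hq]
    split_ifs
    · exact (abs_sub _ _).trans (add_le_add (hbd _ (d k).2 w hw) (hbd _ hγ₁ w hw))
    · positivity
  have hbdd : ∀ n w, w.X ∈ M.suppX → BddAbove (Set.range (q n w)) := fun n w hw =>
    ⟨C + C, by rintro _ ⟨k, rfl⟩; exact hqC n w hw k⟩
  have h0 : ∀ n w, 0 ≤ ⨆ k, q n w k := fun n w => Real.iSup_nonneg fun k => hq0 n w k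
  refine ⟨fun n w => ⨆ k, q n w k, fun n => Measurable.iSup fun k => ?_, ⟨C + C, fun n w hw => ?_⟩,
    fun w hw => ?_, fun n w hw γ hγ hdist => ?_⟩
  · simp only [hq]
    split_ifs
    · exact ((measurable_rho hb (d k).2).sub (measurable_rho hb hγ₁)).abs
    · exact measurable_const
  · rw [abs_of_nonneg (h0 n w)]
    exact ciSup_le (hqC n w hw)
  · rw [Metric.tendsto_atTop]
    intro ε hε
    obtain ⟨δ, hδ, hcont⟩ := Metric.continuousOn_iff.1 (continuousOn_rho hp hw) γ₁ hγ₁ (ε / 2)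
      (by positivity)
    obtain ⟨n₀, hn₀⟩ := exists_nat_one_div_lt hδ
    refine ⟨n₀, fun n hn => ?_⟩
    rw [Real.dist_eq, sub_zero, abs_of_nonneg (h0 n w)]
    refine lt_of_le_of_lt (ciSup_le fun k => ?_) (half_lt_self hε)
    simp only [hq]
    split_ifs with hk
    · have h1 : (1 : ℝ) / (n + 1) ≤ 1 / (n₀ + 1) := by gcongr
      have := hcont (d k) (d k).2 (hk.trans_le (h1.trans hn₀.le))
      rw [Real.dist_eq] at this
      exact this.le
    · positivity
  -- The strict inequality would hold on a nonempty open set of parameters by continuity, hence at a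
  -- point of the dense sequence.
  · by_contra! hlt
    have hcont : Continuous fun γ : M.Γ => |M.rho γ w - M.rho γ₁ w| :=
      ((continuousOn_rho hp hw).domRestrict.sub continuous_const).abs
    have hopen : IsOpen {γ : M.Γ | dist (γ : Par p) γ₁ < 1 / ((n : ℝ) + 1) ∧
        ⨆ k, q n w k < |M.rho γ w - M.rho γ₁ w|} :=
      (isOpen_lt (continuous_subtype_val.dist continuous_const) continuous_const).inter
        (isOpen_lt continuous_const hcont)
    obtain ⟨k, hk1, hk2⟩ := (TopologicalSpace.denseRange_denseSeq M.Γ).exists_mem_open hopen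
      ⟨⟨γ, hγ⟩, hdist, hlt⟩
    have h1 := le_ciSup (hbdd n w hw) k
    simp only [hq] at h1 hk2
    rw [if_pos hk1] at h1
    exact absurd hk2 (not_lt.2 h1)

/-- A function of the covariates that detects a wrong parameter. -/
lemma exists_test_function (hb : M.Basic) (hi : M.Identification) (hp : M.Propensity) {γ : Par p}
    (hγ : γ ∈ M.Γ) (hne : γ ≠ M.γ₀) :
    ∃ f : Cov r₁ r₂ → ℝ, MemLp f 2 M.lawX ∧ 0 < ∫ w, M.rho γ w * f w.X ∂M.law := by
  obtain ⟨C, hC, hbd⟩ := exists_rho_bound hp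
  have hrho : MemLp (M.rho γ) 2 M.law := by
    refine MemLp.of_bound (measurable_rho hb hγ).aestronglyMeasurable C ?_
    filter_upwards [ae_X_mem_suppX] with w hw using hbd γ hγ w hw
  have hle : sigmaX r₁ r₂ ≤ (inferInstance : MeasurableSpace (Obs r₁ r₂)) :=
    Obs.measurable_X.comap_le
  set E := M.law[M.rho γ | sigmaX r₁ r₂] with hE
  have hEm : StronglyMeasurable[sigmaX r₁ r₂] E := stronglyMeasurable_condExp
  obtain ⟨f, hf, hfE⟩ := hEm.measurable.exists_eq_measurable_comp
  have hE2 : MemLp E 2 M.law := hrho.condExp one_le_two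
  have hfX : MemLp (fun w : Obs r₁ r₂ => f w.X) 2 M.law := by
    have : (fun w : Obs r₁ r₂ => f w.X) = E := hfE.symm
    rwa [this]
  refine ⟨f, (memLp_map_measure_iff hf.aestronglyMeasurable Obs.measurable_X.aemeasurable).2 hfX, ?_⟩
  have hEf : (fun w => M.rho γ w * f w.X) = M.rho γ * E := by
    rw [hfE]; rfl
  -- The test function is the conditional expectation of `rho` given `X`. Pairing with it gives the
  -- integral of its square, which vanishes only for `γ₀` by identification.
  have h1 : ∫ w, M.rho γ w * f w.X ∂M.law = ∫ w, E w ^ 2 ∂M.law := by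
    rw [hEf, ← integral_condExp hle]
    refine integral_congr_ae ?_
    filter_upwards [condExp_mul_of_stronglyMeasurable_right hEm (hrho.integrable_mul hE2)
      (hrho.integrable one_le_two)] with w hw
    rw [hw, Pi.mul_apply, pow_two]
  rw [h1]
  refine (integral_nonneg fun _ => sq_nonneg _).lt_of_ne' fun h0 => hne (hi.unique γ hγ ?_)
  rw [integral_eq_zero_iff_of_nonneg (fun _ => sq_nonneg _) hE2.integrable_sq] at h0
  filter_upwards [h0] with w hw
  simpa using hw

/-- A combination `v` of the moments is the inner product of the embedded moments with `embed (D
v)`. The latter represents the same combination at the true parameter, so its norm is controlled by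
the second moment of the combined basis functions. -/
lemma abs_emean_rho_mul_le (h : M.Regular) {K N : ℕ} (hK : p ≤ K) {C : ℝ} (hC : 0 ≤ C)
    (hbd : ∀ᵐ w ∂M.law, |M.rho M.γ₀ w| ≤ C) (w : ℕ → Obs r₁ r₂) (c : Fin K → ℝ) (γ : Par p)
    (θ : ℝ) :
    |emean (fun x => M.rho γ x * ∑ k, c k * M.u K k x.X) N w|
      ≤ C * √(∫ x, (∑ k, c k * M.u K k x.X) ^ 2 ∂M.law) * ‖M.embed K (M.moment K N w γ θ)‖ := by
  set v : Fin K ⊕ Unit → ℝ := Sum.elim c 0 with hv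
  have hsum : ∀ (γ : Par p) (θ : ℝ) (x : Obs r₁ r₂),
      ∑ a, v a * M.g K γ θ x a = M.rho γ x * ∑ k, c k * M.u K k x.X := fun γ θ x => by
    simp [hv, g, Finset.mul_sum, mul_left_comm]
  have hcu : MemLp (fun x : Obs r₁ r₂ => ∑ k, c k * M.u K k x.X) 2 M.law :=
    memLp_sum_mul (fun k => memLp_phi h.basic h.basis hK (Sum.inl k)) c
  have h1 : emean (fun x => M.rho γ x * ∑ k, c k * M.u K k x.X) N w
      = inner ℝ (M.embed K ((M.D K).mulVec v)) (M.embed K (M.moment K N w γ θ)) := by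
    rw [inner_embed h hK, ← D_inv_symm, Matrix.mulVec_mulVec,
      Matrix.nonsing_inv_mul _ (isUnit_det_D h hK), Matrix.one_mulVec]
    simp only [← hsum γ θ, emean_sum, emean_const_mul]
    rfl
  have h2 : ‖M.embed K ((M.D K).mulVec v)‖
      ≤ C * √(∫ x, (∑ k, c k * M.u K k x.X) ^ 2 ∂M.law) := by
    rw [← Real.sqrt_sq hC, ← Real.sqrt_mul (sq_nonneg C)]
    refine Real.le_sqrt_of_sq_le ?_
    rw [← real_inner_self_eq_norm_sq, inner_embed h hK, ← D_inv_symm, Matrix.mulVec_mulVec,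
      Matrix.nonsing_inv_mul _ (isUnit_det_D h hK), Matrix.one_mulVec,
      D_quad h.basic h.ident h.basis h.prop hK]
    simp only [hsum, ← pow_two]
    exact integral_bdd_mul_sq_le (measurable_rho h.basic h.ident.γ₀_mem_Γ).aestronglyMeasurable
      hbd hcu
  rw [h1]
  exact (abs_real_inner_le_norm _ _).trans (mul_le_mul_of_nonneg_right h2 (norm_nonneg _))

/-- Three replacements: `γ₁` by the minimizer `γ` (the modulus `m`), `f` by its basis approximation
(Cauchy–Schwarz), and the moments at the minimizer by those at the truth (minimality). -/
lemma emean_test_le (h : M.Regular) {K N : ℕ} (hK : p ≤ K) (hN : N ≠ 0) {C : ℝ} (hC : 0 ≤ C)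
    (hbd : ∀ γ ∈ M.Γ, ∀ w : Obs r₁ r₂, w.X ∈ M.suppX → |M.rho γ w| ≤ C) {w : ℕ → Obs r₁ r₂}
    (hw : ∀ i, (w i).X ∈ M.suppX) (c : Fin K → ℝ) {γ γ₁ : Par p} {θ : ℝ}
    (hmin : M.IsBestGMM K N w γ θ) {m : Obs r₁ r₂ → ℝ}
    (hm : ∀ i, |M.rho γ (w i) - M.rho γ₁ (w i)| ≤ m (w i)) (f : Cov r₁ r₂ → ℝ) :
    emean (fun x => M.rho γ₁ x * f x.X) N w ≤ emean (fun x => m x * |f x.X|) N w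
      + C * √(emean (fun x => (f x.X - ∑ k, c k * M.u K k x.X) ^ 2) N w)
      + C * √(∫ x, (∑ k, c k * M.u K k x.X) ^ 2 ∂M.law) * ‖M.embed K (M.moment₀ K N w)‖ := by
  have hbd₀ : ∀ᵐ w ∂M.law, |M.rho M.γ₀ w| ≤ C := by
    filter_upwards [ae_X_mem_suppX] with w hw using hbd _ h.ident.γ₀_mem_Γ w hw
  have h1 := abs_emean_rho_mul_le h hK (N := N) hC hbd₀ w c γ θ
  have h2 : ‖M.embed K (M.moment K N w γ θ)‖ ≤ ‖M.embed K (M.moment₀ K N w)‖ :=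
    hmin.norm_embed_le h hK hN h.ident.γ₀_mem_Γ (interior_subset h.ident.θ₀_mem)
  have h3 := (le_abs_self _).trans (h1.trans (mul_le_mul_of_nonneg_left h2
    (mul_nonneg hC (Real.sqrt_nonneg _))))
  have h4 : emean (fun x => |f x.X - ∑ k, c k * M.u K k x.X|) N w
      ≤ √(emean (fun x => (f x.X - ∑ k, c k * M.u K k x.X) ^ 2) N w) := by
    refine Real.le_sqrt_of_sq_le ((sq_emean_le _ _ _).trans_eq ?_)
    simp only [sq_abs]
  have h5 : emean (fun x => M.rho γ₁ x * f x.X) N w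
      ≤ emean (fun x => m x * |f x.X| + C * |f x.X - ∑ k, c k * M.u K k x.X|
        + M.rho γ x * ∑ k, c k * M.u K k x.X) N w := by
    refine emean_mono fun i => ?_
    set F := f (w i).X
    set G := ∑ k, c k * M.u K k (w i).X
    have g1 : (M.rho γ₁ (w i) - M.rho γ (w i)) * F ≤ m (w i) * |F| := by
      refine (le_abs_self _).trans ?_
      rw [abs_mul, abs_sub_comm]
      exact mul_le_mul_of_nonneg_right (hm i) (abs_nonneg _)
    have g2 : M.rho γ (w i) * (F - G) ≤ C * |F - G| := by
      refine (le_abs_self _).trans ?_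
      rw [abs_mul]
      exact mul_le_mul_of_nonneg_right (hbd γ hmin.1 _ (hw i)) (abs_nonneg _)
    linarith
  rw [emean_add, emean_add, emean_const_mul] at h5
  have h6 := mul_le_mul_of_nonneg_left h4 hC
  linarith

/-- The coefficients in `span` may depend on `ε`. Choosing for each `K` a minimizer up to `1/(K +
1)` gives one sequence that works for all `ε`. -/
lemma exists_approx (hB : M.Basis) {f : Cov r₁ r₂ → ℝ} (hf : MemLp f 2 M.lawX) :
    ∃ c : ∀ K : ℕ, Fin K → ℝ, Tendsto (fun K =>
      ∫ w, (f w.X - ∑ k, c K k * M.u K k w.X) ^ 2 ∂M.law) atTop (𝓝 0) := by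
  have h1 : ∀ K : ℕ, ∃ c : Fin K → ℝ, ∀ c' : Fin K → ℝ,
      ∫ w, (f w.X - ∑ k, c k * M.u K k w.X) ^ 2 ∂M.law
        ≤ ∫ w, (f w.X - ∑ k, c' k * M.u K k w.X) ^ 2 ∂M.law + 1 / ((K : ℝ) + 1) := fun K => by
    have hb : BddBelow (Set.range fun c : Fin K → ℝ =>
        ∫ w, (f w.X - ∑ k, c k * M.u K k w.X) ^ 2 ∂M.law) :=
      ⟨0, by rintro _ ⟨c, rfl⟩; exact integral_nonneg fun _ => sq_nonneg _⟩
    obtain ⟨c, hc⟩ := exists_lt_of_ciInf_lt (f := fun c : Fin K → ℝ =>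
      ∫ w, (f w.X - ∑ k, c k * M.u K k w.X) ^ 2 ∂M.law)
      (lt_add_of_pos_right _ (by positivity : (0 : ℝ) < 1 / ((K : ℝ) + 1)))
    exact ⟨c, fun c' => hc.le.trans (by gcongr; exact ciInf_le hb c')⟩
  choose c hc using h1
  refine ⟨c, ?_⟩
  rw [Metric.tendsto_atTop]
  intro ε hε
  obtain ⟨n₀, hn₀⟩ := exists_nat_one_div_lt (half_pos hε)
  obtain ⟨K₁, hK₁⟩ := eventually_atTop.1 ((hB.span f hf (ε / 2) (half_pos hε)).and
    (eventually_ge_atTop p))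
  refine ⟨max n₀ K₁, fun K hK => ?_⟩
  obtain ⟨⟨c', hc'⟩, hpK⟩ := hK₁ K (le_of_max_le_right hK)
  rw [Real.dist_eq, sub_zero, abs_of_nonneg (integral_nonneg fun _ => sq_nonneg _)]
  have h2 : ∫ w, (f w.X - ∑ k, c' k * M.u K k w.X) ^ 2 ∂M.law
      = ∫ x, (f x - ∑ k, c' k * M.u K k x) ^ 2 ∂M.lawX := by
    rw [lawX, integral_map Obs.measurable_X.aemeasurable]
    exact ((hf.sub (memLp_sum_mul (fun k => hB.memLp K hpK k) c')).integrable_sq).aestronglyMeasurable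
  have h3 : (1 : ℝ) / (K + 1) ≤ 1 / (n₀ + 1) := by
    have : n₀ ≤ K := le_of_max_le_left hK
    gcongr
  have h4 := hc K c'
  rw [h2] at h4
  linarith

end Model
end MNAR

namespace MNAR
namespace Model
variable {p r₁ r₂ : ℕ} {M : Model p r₁ r₂}

lemma noise_nonneg (K N : ℕ) (w : ℕ → Obs r₁ r₂) : 0 ≤ M.noise K N w :=
  le_trans (mul_nonneg (by positivity) (Finset.sum_nonneg fun _ _ => sq_nonneg _))
    (noise_bounds (M := M) le_rfl).1

variable [IsProbabilityMeasure M.law] {Ω : Type*} [MeasurableSpace Ω] {P : Measure Ω}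
  [IsProbabilityMeasure P] {W : ℕ → Ω → Obs r₁ r₂}

lemma ae_forall_mem_suppX (hlaw : ∀ i, HasLaw (W i) M.law P) :
    ∀ᵐ ω ∂P, ∀ i, (W i ω).X ∈ M.suppX := by
  refine ae_all_iff.2 fun i => ?_
  have h : ∀ᵐ w ∂(P.map (W i)), w.X ∈ M.suppX := by
    rw [(hlaw i).map_eq]; exact ae_X_mem_suppX
  exact ae_of_ae_map (hlaw i).aemeasurable h

/-- The squared norm is at most a constant times `(K + 1)/N` times the noise, whose expectation is
bounded. -/
lemma tendsto_measure_embed_moment₀ (h : M.Regular) (hlaw : ∀ i, HasLaw (W i) M.law P)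
    (hindep : iIndepFun W P) {K : ℕ → ℕ} (hK : Tendsto K atTop atTop)
    (hKN : Tendsto (fun N : ℕ => ((K N : ℝ) + 1) / N) atTop (𝓝 0)) {t : ℝ} (ht : 0 < t) :
    Tendsto (fun N => P {ω | t < ‖M.embed (K N) (M.moment₀ (K N) N fun i => W i ω)‖}) atTop
      (𝓝 0) := by
  obtain ⟨C, hC, hnoise⟩ := exists_integral_noise_le h hlaw hindep
  obtain ⟨Ce, hCe, hembed⟩ := exists_embed_bound h
  have h1 := tendsto_measure_lt_of_integral_le (P := P)
    (X := fun N ω => Ce * (((K N : ℝ) + 1) / N) * M.noise (K N) N fun i => W i ω)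
    (b := fun N => Ce * (((K N : ℝ) + 1) / N) * C) (fun N => Eventually.of_forall fun ω =>
      mul_nonneg (by positivity) (noise_nonneg _ _ _)) ?_ ?_ (t := t ^ 2) (by positivity)
  · refine tendsto_of_tendsto_of_tendsto_of_le_of_le' tendsto_const_nhds h1
      (Eventually.of_forall fun _ => zero_le) ?_
    filter_upwards [hK.eventually_ge_atTop p, eventually_ne_atTop 0] with N hN hN0
    refine measure_mono fun ω (hω : t < _) => ?_
    change t ^ 2 < _
    refine lt_of_lt_of_le (pow_lt_pow_left₀ hω ht.le two_ne_zero) ?_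
    refine ((hembed _ hN _).1).trans ?_
    rw [mul_assoc]
    refine mul_le_mul_of_nonneg_left ?_ hCe.le
    have h2 := (noise_bounds (M := M) (K := K N) (N := N) (w := fun i => W i ω) le_rfl).1
    have hN' : (0 : ℝ) < N := by positivity
    have hK' : (0 : ℝ) < (K N : ℝ) + 1 := by positivity
    rw [div_mul_eq_mul_div, div_le_iff₀ hK'] at h2
    rw [div_mul_eq_mul_div, le_div_iff₀ hN']
    linarith
  · filter_upwards [hK.eventually_ge_atTop p, eventually_ne_atTop 0] with N hN hN0
    obtain ⟨hi, hb⟩ := hnoise (K N) hN N hN0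
    refine ⟨hi.const_mul _, ?_⟩
    rw [integral_const_mul]
    exact mul_le_mul_of_nonneg_left hb (by positivity)
  · have := (hKN.const_mul Ce).mul_const C
    simpa using this

/-- A wrong parameter has a neighbourhood that contains no minimizers, with high probability. -/
lemma exists_ball_tendsto (h : M.Regular) (hlaw : ∀ i, HasLaw (W i) M.law P)
    (hindep : iIndepFun W P) {K : ℕ → ℕ} (hK : Tendsto K atTop atTop)
    (hKN : Tendsto (fun N : ℕ => ((K N : ℝ) + 1) / N) atTop (𝓝 0)) {γ₁ : Par p} (hγ₁ : γ₁ ∈ M.Γ)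
    (hne : γ₁ ≠ M.γ₀) : ∃ δ : ℝ, 0 < δ ∧ Tendsto (fun N => P {ω | ∃ γ θ, dist γ γ₁ < δ ∧
      M.IsBestGMM (K N) N (fun i => W i ω) γ θ}) atTop (𝓝 0) := by
  obtain ⟨f, hf, ha⟩ := exists_test_function h.basic h.ident h.prop hγ₁ hne
  obtain ⟨m, hmm, ⟨Cm, hCm⟩, hm0, hmod⟩ := exists_modulus h.basic h.prop hγ₁
  obtain ⟨C, hC, hbd⟩ := exists_rho_bound h.prop
  obtain ⟨c, hc⟩ := exists_approx h.basis hf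
  obtain ⟨a, hadef⟩ : ∃ a, a = ∫ w, M.rho γ₁ w * f w.X ∂M.law := ⟨_, rfl⟩
  rw [← hadef] at ha
  have hfX : MemLp (fun w : Obs r₁ r₂ => f w.X) 2 M.law :=
    hf.comp_of_map Obs.measurable_X.aemeasurable
  have hmf : ∀ n, MemLp (fun w : Obs r₁ r₂ => m n w * |f w.X|) 2 M.law := fun n =>
    memLp_bdd_mul (hmm n).aestronglyMeasurable
      (by filter_upwards [ae_X_mem_suppX] with w hw using hCm n w hw) hfX.abs
  have hlim : Tendsto (fun n => ∫ w, m n w * |f w.X| ∂M.law) atTop (𝓝 0) := by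
    have h1 := tendsto_integral_of_dominated_convergence (μ := M.law)
      (F := fun n w => m n w * |f w.X|) (f := fun _ => 0) (fun w : Obs r₁ r₂ => Cm * |f w.X|)
      (fun n => (hmf n).aestronglyMeasurable) ((hfX.abs.integrable one_le_two).const_mul _)
      (fun n => by
        filter_upwards [ae_X_mem_suppX] with w hw
        rw [norm_mul, Real.norm_eq_abs, Real.norm_eq_abs, abs_abs]
        exact mul_le_mul_of_nonneg_right (hCm n w hw) (abs_nonneg _))
      (by
        filter_upwards [ae_X_mem_suppX] with w hw
        simpa using (hm0 w hw).mul_const |f w.X|)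
    simpa using h1
  -- The radius `1/(n + 1)` is fixed here, before `N` grows, by making the mean of the modulus times
  -- `|f|` less than `a/8`.
  obtain ⟨n, hn⟩ := (hlim.eventually (gt_mem_nhds (by positivity : 0 < a / 8))).exists
  obtain ⟨s, hs⟩ : ∃ s, s = √(2 * (∫ w, f w.X ^ 2 ∂M.law) + 2) := ⟨_, rfl⟩
  have hs0 : 0 < s := by
    have : 0 ≤ ∫ w, f w.X ^ 2 ∂M.law := integral_nonneg fun _ => sq_nonneg _
    rw [hs]; positivity
  have t1 := tendsto_measure_emean_sub hlaw hindep
    (memLp_rho_mul h.basic h.prop hγ₁ hfX) (by positivity : 0 < a / 8)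
  have t2 := tendsto_measure_emean_sub hlaw hindep (hmf n) (by positivity : 0 < a / 8)
  have hres : ∀ K, p ≤ K → MemLp (fun w : Obs r₁ r₂ => f w.X - ∑ k, c K k * M.u K k w.X) 2 M.law :=
    fun K hK => hfX.sub
      (memLp_sum_mul (fun k => memLp_phi h.basic h.basis hK (Sum.inl k)) (c K))
  have t3 := tendsto_measure_lt_of_integral_le (P := P)
    (X := fun N ω => emean (fun x => (f x.X - ∑ k, c (K N) k * M.u (K N) k x.X) ^ 2) N
      fun i => W i ω)
    (b := fun N => ∫ w, (f w.X - ∑ k, c (K N) k * M.u (K N) k w.X) ^ 2 ∂M.law)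
    (fun N => Eventually.of_forall fun ω => emean_nonneg (fun _ => sq_nonneg _) _ _)
    (by
      filter_upwards [hK.eventually_ge_atTop p, eventually_ne_atTop 0] with N hN hN0
      have hi := (hres (K N) hN).integrable_sq
      exact ⟨integrable_emean hlaw hi N, (integral_emean hlaw hi hN0).le⟩)
    (hc.comp hK) (t := (a / (8 * C)) ^ 2) (by positivity)
  have t4 := tendsto_measure_embed_moment₀ h hlaw hindep hK hKN
    (by positivity : 0 < a / (8 * C * s))
  refine ⟨1 / ((n : ℝ) + 1), by positivity, ?_⟩
  have hsum := ((t1.add t2).add t3).add t4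
  simp only [add_zero] at hsum
  refine tendsto_of_tendsto_of_tendsto_of_le_of_le' tendsto_const_nhds hsum
    (Eventually.of_forall fun _ => zero_le) ?_
  have hI1 : ∀ᶠ K : ℕ in atTop, ∫ w, (f w.X - ∑ k, c K k * M.u K k w.X) ^ 2 ∂M.law < 1 :=
    hc.eventually (gt_mem_nhds one_pos)
  filter_upwards [hK.eventually_ge_atTop p, eventually_ne_atTop 0, hK.eventually hI1]
    with N hN hN0 hI
  refine le_trans (measure_mono_ae ?_) ((measure_union_le _ _).trans (add_le_add
    ((measure_union_le _ _).trans (add_le_add (measure_union_le _ _) le_rfl)) le_rfl))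
  filter_upwards [ae_forall_mem_suppX hlaw] with ω hω
  rintro ⟨γ, θ, hdist, hmin⟩
  by_contra hnot
  have hnot' : ¬(((a / 8 < |emean (fun x => M.rho γ₁ x * f x.X) N (fun i => W i ω)
      - ∫ w, M.rho γ₁ w * f w.X ∂M.law| ∨
      a / 8 < |emean (fun x => m n x * |f x.X|) N (fun i => W i ω)
      - ∫ w, m n w * |f w.X| ∂M.law|) ∨
      (a / (8 * C)) ^ 2 < emean (fun x => (f x.X - ∑ k, c (K N) k * M.u (K N) k x.X) ^ 2) N
        fun i => W i ω) ∨
      a / (8 * C * s) < ‖M.embed (K N) (M.moment₀ (K N) N fun i => W i ω)‖) := hnot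
  push Not at hnot'
  obtain ⟨⟨⟨e1, e2⟩, e3⟩, e4⟩ := hnot'
  have key := emean_test_le h hN hN0 hC.le hbd hω (c (K N)) hmin
    (fun i => hmod n (W i ω) (hω i) γ hmin.1 hdist) f
  have b1 := (abs_le.1 e1).1
  have b2 := (abs_le.1 e2).2
  have b3 : C * √(emean (fun x => (f x.X - ∑ k, c (K N) k * M.u (K N) k x.X) ^ 2) N
      fun i => W i ω) ≤ a / 8 := by
    have : √(emean (fun x => (f x.X - ∑ k, c (K N) k * M.u (K N) k x.X) ^ 2) N
      fun i => W i ω) ≤ a / (8 * C) := by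
      rw [← Real.sqrt_sq (by positivity : 0 ≤ a / (8 * C))]
      exact Real.sqrt_le_sqrt e3
    calc _ ≤ C * (a / (8 * C)) := mul_le_mul_of_nonneg_left this hC.le
      _ = _ := by field_simp
  have b4 : √(∫ x, (∑ k, c (K N) k * M.u (K N) k x.X) ^ 2 ∂M.law) ≤ s := by
    rw [hs]
    refine Real.sqrt_le_sqrt ?_
    have hi := (hres (K N) hN).integrable_sq
    have hu : MemLp (fun x : Obs r₁ r₂ => ∑ k, c (K N) k * M.u (K N) k x.X) 2 M.law :=
      memLp_sum_mul (fun k => memLp_phi h.basic h.basis hN (Sum.inl k)) (c (K N))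
    have h1 : ∫ x, (∑ k, c (K N) k * M.u (K N) k x.X) ^ 2 ∂M.law
        ≤ ∫ x, (2 * f x.X ^ 2 + 2 * (f x.X - ∑ k, c (K N) k * M.u (K N) k x.X) ^ 2) ∂M.law := by
      refine integral_mono hu.integrable_sq
        ((hfX.integrable_sq.const_mul _).add (hi.const_mul _)) fun x => ?_
      have := sq_nonneg (2 * f x.X - ∑ k, c (K N) k * M.u (K N) k x.X)
      nlinarith
    rw [integral_add (hfX.integrable_sq.const_mul _) (hi.const_mul _), integral_const_mul,
      integral_const_mul] at h1
    linarith
  have b5 : C * √(∫ x, (∑ k, c (K N) k * M.u (K N) k x.X) ^ 2 ∂M.law)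
      * ‖M.embed (K N) (M.moment₀ (K N) N fun i => W i ω)‖ ≤ a / 8 := by
    calc _ ≤ C * s * (a / (8 * C * s)) := mul_le_mul (mul_le_mul_of_nonneg_left b4 hC.le) e4
          (norm_nonneg _) (by positivity)
      _ = _ := by field_simp
  -- Off the four exceptional events the left side of `key` is at least `7a/8`, while the right side
  -- is at most `a/2`: two eighths from the modulus, one from the approximation and one from the
  -- moments.
  rw [← hadef] at b1
  linarith

/-- Consistency of the minimizers of the criterion. -/
theorem tendsto_measure_lt_dist (h : M.Regular) (hlaw : ∀ i, HasLaw (W i) M.law P)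
    (hindep : iIndepFun W P) {K : ℕ → ℕ} (hK : Tendsto K atTop atTop)
    (hKN : Tendsto (fun N : ℕ => ((K N : ℝ) + 1) / N) atTop (𝓝 0)) {τ : ℝ} (hτ : 0 < τ) :
    Tendsto (fun N => P {ω | ∃ γ θ, τ < ‖γ - M.γ₀‖ ∧
      M.IsBestGMM (K N) N (fun i => W i ω) γ θ}) atTop (𝓝 0) := by
  have hcomp : IsCompact (M.Γ \ Metric.ball M.γ₀ τ) := h.ident.isCompact_Γ.diff Metric.isOpen_ball
  have hloc : ∀ γ₁ ∈ M.Γ \ Metric.ball M.γ₀ τ, ∃ δ : ℝ, 0 < δ ∧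
      Tendsto (fun N => P {ω | ∃ γ θ, dist γ γ₁ < δ ∧
        M.IsBestGMM (K N) N (fun i => W i ω) γ θ}) atTop (𝓝 0) := fun γ₁ hγ₁ =>
    exists_ball_tendsto h hlaw hindep hK hKN hγ₁.1 fun e => hγ₁.2 (e ▸ Metric.mem_ball_self hτ)
  choose! δ hδ hlim using hloc
  obtain ⟨t, ht, hcov⟩ := hcomp.elim_nhds_subcover (fun γ => Metric.ball γ (δ γ))
    fun γ hγ => Metric.ball_mem_nhds γ (hδ γ hγ)
  have hsum := tendsto_finsetSum t fun γ₁ hγ₁ => hlim γ₁ (ht γ₁ hγ₁)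
  rw [Finset.sum_const_zero] at hsum
  refine tendsto_of_tendsto_of_tendsto_of_le_of_le tendsto_const_nhds hsum (fun _ => zero_le)
    fun N => le_trans (measure_mono ?_) (measure_biUnion_finset_le t _)
  rintro ω ⟨γ, θ, hγ, hmin⟩
  have hmem : γ ∈ M.Γ \ Metric.ball M.γ₀ τ :=
    ⟨hmin.1, by rw [Metric.mem_ball, dist_eq_norm]; exact not_lt.2 hγ.le⟩
  obtain ⟨γ₁, hγ₁, hball⟩ := Set.mem_iUnion₂.1 (hcov hmem)
  exact Set.mem_biUnion hγ₁ ⟨γ, θ, hball, hmin⟩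

end Model
end MNAR

/-! ### Convergence of the standardizing matrices and of the linearization. -/

namespace MNAR

lemma norm_toLp_mulVec_le {ι : Type*} [Fintype ι] (A : Matrix ι ι ℝ) (v : ι → ℝ) :
    ‖WithLp.toLp 2 (A.mulVec v)‖ ≤ (∑ i, ∑ j, |A i j|) * ‖WithLp.toLp 2 v‖ := by
  have h1 : ∀ i, |A.mulVec v i| ≤ (∑ j, |A i j|) * ‖WithLp.toLp 2 v‖ := fun i => by
    rw [Matrix.mulVec, dotProduct, Finset.sum_mul]
    refine (Finset.abs_sum_le_sum_abs _ _).trans (Finset.sum_le_sum fun j _ => ?_)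
    rw [abs_mul]
    exact mul_le_mul_of_nonneg_left (PiLp.norm_apply_le (WithLp.toLp 2 v) j) (abs_nonneg _)
  rw [EuclideanSpace.norm_eq, Finset.sum_mul]
  have h2 : 0 ≤ ∑ i, (∑ j, |A i j|) * ‖WithLp.toLp 2 v‖ := Finset.sum_nonneg fun i _ =>
    (abs_nonneg _).trans (h1 i)
  refine Real.sqrt_le_left h2 |>.2 ?_
  calc ∑ i, ‖A.mulVec v i‖ ^ 2 ≤ (∑ i, |A.mulVec v i|) ^ 2 :=
        Finset.sum_sq_le_sq_sum_of_nonneg fun i _ => abs_nonneg _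
    _ ≤ _ := pow_le_pow_left₀ (Finset.sum_nonneg fun _ _ => abs_nonneg _)
        (Finset.sum_le_sum fun i _ => h1 i) 2

/-- Square roots of convergent inverse matrices. -/
lemma tendsto_sqrt_inv {ι : Type*} [Fintype ι] [DecidableEq ι] {A : ℕ → Matrix ι ι ℝ}
    {G : Matrix ι ι ℝ} (hA : ∀ᶠ k in atTop, (A k).PosSemidef) (hG : G.PosDef)
    (hAG : Tendsto A atTop (𝓝 G)) : ∃ R : Matrix ι ι ℝ, R.transpose = R ∧ R * G * R = 1 ∧
      Tendsto (fun k => CFC.sqrt (A k)⁻¹) atTop (𝓝 R) ∧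
      Tendsto (fun k => (CFC.sqrt (A k)⁻¹)⁻¹) atTop (𝓝 R⁻¹) ∧
      ∀ᶠ k in atTop, IsUnit (A k).det → (CFC.sqrt (A k)⁻¹)⁻¹ * (A k)⁻¹ = CFC.sqrt (A k)⁻¹ := by
  have hinv : ∀ {B : ℕ → Matrix ι ι ℝ} {H : Matrix ι ι ℝ}, H.det ≠ 0 → Tendsto B atTop (𝓝 H) →
      Tendsto (fun k => (B k)⁻¹) atTop (𝓝 H⁻¹) := fun hH hB => by
    refine (continuousAt_matrix_inv _ ?_).tendsto.comp hB
    rw [Ring.inverse_eq_inv']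
    exact continuousAt_inv₀ hH
  have hdet : G.det ≠ 0 := hG.det_pos.ne'
  have hGi : (G⁻¹).PosSemidef := hG.inv.posSemidef
  have hsq : CFC.sqrt G⁻¹ * CFC.sqrt G⁻¹ = G⁻¹ := CFC.sqrt_mul_sqrt_self _ hGi.nonneg
  -- One identity gives both that the limiting root is invertible and, by commuting inverses, that
  -- it whitens `G`.
  have h1 : CFC.sqrt G⁻¹ * (CFC.sqrt G⁻¹ * G) = 1 := by
    rw [← Matrix.mul_assoc, hsq, Matrix.nonsing_inv_mul _ (Ne.isUnit hdet)]
  have hRp : (CFC.sqrt G⁻¹).PosSemidef := Matrix.nonneg_iff_posSemidef.1 (CFC.sqrt_nonneg _)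
  have hlim := tendsto_matrix_sqrt (hA.mono fun k hk => hk.inv) (hinv hdet hAG)
  have hRdet : (CFC.sqrt G⁻¹).det ≠ 0 := fun h0 => by
    have := congrArg Matrix.det h1
    rw [Matrix.det_mul, h0] at this
    simp at this
  refine ⟨CFC.sqrt G⁻¹, ?_, mul_eq_one_comm.1 h1, hlim, hinv hRdet hlim, ?_⟩
  · have := hRp.1
    rwa [Matrix.IsHermitian, Matrix.conjTranspose_eq_transpose_of_trivial] at this
  · filter_upwards [hA] with k hk hu
    have h2 : CFC.sqrt (A k)⁻¹ * CFC.sqrt (A k)⁻¹ = (A k)⁻¹ :=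
      CFC.sqrt_mul_sqrt_self _ hk.inv.nonneg
    have h3 : IsUnit (CFC.sqrt (A k)⁻¹).det := by
      have h4 : IsUnit ((A k)⁻¹).det := Matrix.isUnit_nonsing_inv_det _ hu
      rw [← h2, Matrix.det_mul] at h4
      exact isUnit_of_mul_isUnit_left h4
    calc _ = (CFC.sqrt (A k)⁻¹)⁻¹ * (CFC.sqrt (A k)⁻¹ * CFC.sqrt (A k)⁻¹) :=
          congrArg ((CFC.sqrt (A k)⁻¹)⁻¹ * ·) h2.symm
      _ = _ := Matrix.nonsing_inv_mul_cancel_left _ _ h3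

namespace Model
variable {p r₁ r₂ : ℕ} {M : Model p r₁ r₂} [IsProbabilityMeasure M.law]

lemma info_eq_gram (h : M.Regular) {K : ℕ} (hK : p ≤ K) :
    M.info K = Matrix.gram ℝ fun j => (M.momentSpan K).starProjection (toL2 M.law (M.psi j)) := by
  ext i j
  rw [info_apply h hK, Matrix.gram_apply, embed_B_eq h hK, embed_B_eq h hK]

lemma sum_smul_psi (L : Lp ℝ 2 M.law →L[ℝ] Lp ℝ 2 M.law) (x : Fin p ⊕ Unit → ℝ) :
    ∑ i, x i • L (toL2 M.law (M.psi i)) = L (M.psiL2 (WithLp.toLp 2 x)) := by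
  rw [psiL2_apply]; simp

/-- The standardizing matrices converge. -/
lemma exists_limit_sqrt (h : M.Regular) (hV : ∀ᶠ K in atTop, IsUnit (M.info K).det)
    {Q : Lp ℝ 2 M.law →L[ℝ] Lp ℝ 2 M.law}
    (hQ : ∀ v, Tendsto (fun k => (M.momentSpan k).starProjection v) atTop (𝓝 (Q v)))
    (hQ' : ∀ k, p ≤ k → ∀ v, ‖(M.momentSpan k).starProjection v‖ ≤ ‖Q v‖) :
    ∃ R : Matrix (Fin p ⊕ Unit) (Fin p ⊕ Unit) ℝ,
      (∀ t : FullPar p, ‖Q (M.psiL2 (WithLp.toLp 2 (R.mulVec t)))‖ ^ 2 = ‖t‖ ^ 2) ∧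
      R.transpose = R ∧ Tendsto (fun K => CFC.sqrt (M.V K)) atTop (𝓝 R) ∧
      Tendsto M.invSqrtV atTop (𝓝 R⁻¹) ∧
      ∀ᶠ K in atTop, M.invSqrtV K * M.V K = CFC.sqrt (M.V K) := by
  obtain ⟨c, hc, hlow, -⟩ := exists_deriv_lower h hV hQ hQ'
  set G := Matrix.gram ℝ fun j => Q (toL2 M.law (M.psi j)) with hG
  have hquad : ∀ x : Fin p ⊕ Unit → ℝ,
      dotProduct x (G.mulVec x) = ‖Q (M.psiL2 (WithLp.toLp 2 x))‖ ^ 2 := fun x => by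
    have := Matrix.star_dotProduct_gram_mulVec (𝕜 := ℝ) (fun j => Q (toL2 M.law (M.psi j))) x x
    rw [sum_smul_psi, real_inner_self_eq_norm_sq, star_trivial] at this
    exact this
  have hpd : G.PosDef := by
    refine Matrix.PosDef.of_dotProduct_mulVec_pos (Matrix.isHermitian_gram ℝ _) fun x hx => ?_
    rw [star_trivial, hquad]
    have h1 : 0 < ‖(WithLp.toLp 2 x : FullPar p)‖ := norm_pos_iff.2 fun h0 => hx (by
      simpa using h0)
    have h2 := hlow (WithLp.toLp 2 x)
    have h3 : 0 < ‖Q (M.psiL2 (WithLp.toLp 2 x))‖ := lt_of_lt_of_le (by positivity) h2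
    positivity
  have hlim : Tendsto M.info atTop (𝓝 G) := by
    refine tendsto_pi_nhds.2 fun i => tendsto_pi_nhds.2 fun j => ?_
    refine ((hQ (toL2 M.law (M.psi i))).inner (hQ (toL2 M.law (M.psi j)))).congr' ?_
    filter_upwards [eventually_ge_atTop p] with K hK
    rw [info_eq_gram h hK]; rfl
  obtain ⟨R, hR, hRG, h1, h2, h3⟩ := tendsto_sqrt_inv (A := M.info)
    (by
      filter_upwards [eventually_ge_atTop p] with K hK
      rw [info_eq_gram h hK]; exact Matrix.posSemidef_gram ℝ _) hpd hlim
  refine ⟨R, fun t => ?_, hR, h1, h2, ?_⟩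
  · rw [← hquad, dotProduct_comm, Matrix.dotProduct_mulVec, ← Matrix.mulVec_transpose, hR,
      Matrix.mulVec_mulVec, Matrix.mulVec_mulVec, hRG, Matrix.one_mulVec,
      EuclideanSpace.real_norm_sq_eq]
    simp only [dotProduct, pow_two]
  · filter_upwards [h3, hV] with K h3 hV using h3 hV

lemma coeFn_embed_B (h : M.Regular) {K : ℕ} (hK : p ≤ K) (l : Fin p ⊕ Unit) :
    (M.momentSpan K).starProjection (toL2 M.law (M.psi l))
      =ᵐ[M.law] fun x => ∑ a, M.coef K l a * M.g K M.γ₀ M.θ₀ x a := by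
  rw [← embed_B_eq h hK]
  exact coeFn_sum_smul_toL2 (fun a => memLp_moment h hK a) _

lemma memLp_coef_g (h : M.Regular) {K : ℕ} (hK : p ≤ K) (l : Fin p ⊕ Unit) :
    MemLp (fun x => ∑ a, M.coef K l a * M.g K M.γ₀ M.θ₀ x a) 2 M.law :=
  memLp_sum_mul (fun a => memLp_moment h hK a) _

lemma integral_coef_g (h : M.Regular) {K : ℕ} (hK : p ≤ K) (l : Fin p ⊕ Unit) :
    ∫ x, ∑ a, M.coef K l a * M.g K M.γ₀ M.θ₀ x a ∂M.law = 0 := by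
  rw [integral_finsetSum _ fun a _ =>
    ((memLp_moment h hK a).integrable one_le_two).const_mul _]
  simp [integral_const_mul, integral_g h.basic h.ident h.basis h.prop hK]

lemma integral_coef_g_sub_sq (h : M.Regular) {K : ℕ} (hK : p ≤ K) (l : Fin p ⊕ Unit)
    (ζ : Lp ℝ 2 M.law) :
    ∫ x, (∑ a, M.coef K l a * M.g K M.γ₀ M.θ₀ x a - ζ x) ^ 2 ∂M.law
      = ‖(M.momentSpan K).starProjection (toL2 M.law (M.psi l)) - ζ‖ ^ 2 := by
  rw [norm_sq_eq_integral]
  refine integral_congr_ae ?_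
  filter_upwards [coeFn_embed_B h hK l,
    Lp.coeFn_sub ((M.momentSpan K).starProjection (toL2 M.law (M.psi l))) ζ] with x h1 h2
  rw [h2, Pi.sub_apply, h1]

/-- The mean is the inner product with the constant `1`, hence continuous in `L²`, and every
projection of `psi l` with `K ≥ p` is a combination of centred moments. -/
lemma integral_limit_eq_zero (h : M.Regular) {Q : Lp ℝ 2 M.law →L[ℝ] Lp ℝ 2 M.law}
    (hQ : ∀ v, Tendsto (fun k => (M.momentSpan k).starProjection v) atTop (𝓝 (Q v)))
    (l : Fin p ⊕ Unit) : ∫ x, Q (toL2 M.law (M.psi l)) x ∂M.law = 0 := by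
  have hone : MemLp (fun _ : Obs r₁ r₂ => (1 : ℝ)) 2 M.law := memLp_const 1
  have hint : ∀ v : Lp ℝ 2 M.law, inner ℝ (toL2 M.law fun _ => (1 : ℝ)) v = ∫ x, v x ∂M.law := by
    intro v
    rw [L2.inner_def]
    refine integral_congr_ae ?_
    filter_upwards [coeFn_toL2 hone] with x hx
    rw [hx]; simp
  have h1 : Tendsto (fun k => inner ℝ (toL2 M.law fun _ => (1 : ℝ))
      ((M.momentSpan k).starProjection (toL2 M.law (M.psi l)))) atTop
      (𝓝 (inner ℝ (toL2 M.law fun _ => (1 : ℝ)) (Q (toL2 M.law (M.psi l))))) :=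
    tendsto_const_nhds.inner (hQ _)
  rw [← hint]
  refine tendsto_nhds_unique (h1.congr' ?_) tendsto_const_nhds
  filter_upwards [eventually_ge_atTop p] with K hK
  rw [hint, integral_congr_ae (coeFn_embed_B h hK l), integral_coef_g h hK]

variable {Ω : Type*} [MeasurableSpace Ω] {P : Measure Ω} [IsProbabilityMeasure P]
  {W : ℕ → Ω → Obs r₁ r₂}

/-- The variance of `√N` times a centred mean is the variance of one summand, so functions changing
with `N` are negligible as soon as their second moments vanish. -/
lemma tendsto_measure_norm_emean (hlaw : ∀ i, HasLaw (W i) M.law P) (hindep : iIndepFun W P)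
    {ι : Type*} [Fintype ι] {q : ℕ → ι → Obs r₁ r₂ → ℝ}
    (hq : ∀ᶠ N in atTop, ∀ l, MemLp (q N l) 2 M.law ∧ ∫ x, q N l x ∂M.law = 0)
    (hlim : Tendsto (fun N => ∑ l, ∫ x, q N l x ^ 2 ∂M.law) atTop (𝓝 0)) {t : ℝ} (ht : 0 < t) :
    Tendsto (fun N : ℕ => P {ω | t < ‖(WithLp.toLp 2 fun l => √N * emean (q N l) N fun i => W i ω :
      EuclideanSpace ℝ ι)‖}) atTop (𝓝 0) := by
  have h1 := tendsto_measure_lt_of_integral_le (P := P)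
    (X := fun N ω => ∑ l, (N : ℝ) * (emean (q N l) N fun i => W i ω) ^ 2)
    (fun N => Eventually.of_forall fun ω => Finset.sum_nonneg fun l _ => by positivity) ?_ hlim
    (t := t ^ 2) (by positivity)
  · refine h1.congr fun N => ?_
    congr 1; ext ω
    simp only [Set.mem_ofPred_eq]
    rw [← sq_lt_sq₀ ht.le (norm_nonneg _), EuclideanSpace.real_norm_sq_eq]
    simp only [mul_pow, Real.sq_sqrt (Nat.cast_nonneg N)]
  · filter_upwards [hq, eventually_ne_atTop 0] with N hN hN0
    have hN' : (0 : ℝ) < N := by positivity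
    have hi : ∀ l, Integrable (fun ω => (N : ℝ) * (emean (q N l) N fun i => W i ω) ^ 2) P :=
      fun l => (memLp_emean hlaw (hN l).1 N).integrable_sq.const_mul _
    refine ⟨integrable_finsetSum _ fun l _ => hi l, ?_⟩
    rw [integral_finsetSum _ fun l _ => hi l]
    refine Finset.sum_le_sum fun l _ => ?_
    have h2 := integral_emean_sub_sq_le hlaw hindep (hN l).1 hN0
    simp only [(hN l).2, sub_zero] at h2
    rw [integral_const_mul]
    rwa [le_div_iff₀ hN', mul_comm] at h2

/-- The estimator is asymptotically equivalent to its linear approximation. -/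
theorem tendsto_measure_diff_sub_linEst (h : M.Regular)
    (hV : ∀ᶠ K in atTop, IsUnit (M.info K).det) (hlaw : ∀ i, HasLaw (W i) M.law P)
    (hindep : iIndepFun W P) {K : ℕ → ℕ} (hK : Tendsto K atTop atTop)
    (hKN : Tendsto (fun N : ℕ => √(((K N : ℝ) + 1) ^ 3 / N)) atTop (𝓝 0))
    (hKN' : Tendsto (fun N : ℕ => ((K N : ℝ) + 1) / N) atTop (𝓝 0))
    {γbar : ℕ → Ω → Par p} {θbar : ℕ → Ω → ℝ}
    (hmin : ∀ N, p ≤ K N →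
      ∀ᵐ ω ∂P, M.IsBestGMM (K N) N (fun i => W i ω) (γbar N ω) (θbar N ω)) {t : ℝ} (ht : 0 < t) :
    Tendsto (fun N : ℕ => P {ω | t < √N * ‖M.diff (γbar N ω) (θbar N ω)
      - M.linEst (K N) N fun i => W i ω‖}) atTop (𝓝 0) := by
  obtain ⟨C, hC, hnoise⟩ := exists_integral_noise_le h hlaw hindep
  rw [ENNReal.tendsto_nhds_zero]
  intro ε hε
  obtain ⟨η, hη, hηε⟩ := ENNReal.lt_iff_exists_real_btwn.1 hε
  have hη0 : 0 < η := ENNReal.ofReal_pos.1 hηε.1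
  -- With expected noise at most `C`, Markov's inequality leaves probability `η/2` above this level.
  -- The other `η/2` is spent on inconsistency.
  obtain ⟨τ, hτ, ε₁, hε₁, C₁, hrate⟩ := exists_rate h hV (A := 2 * C / η) (by positivity)
  have hcons := tendsto_measure_lt_dist h hlaw hindep hK hKN' hτ
  have hsmall : ∀ᶠ N : ℕ in atTop, C₁ * √(((K N : ℝ) + 1) ^ 3 / N) ≤ t := by
    have := hKN.const_mul C₁
    rw [mul_zero] at this
    exact (this.eventually (gt_mem_nhds ht)).mono fun N hN => hN.le
  have hcons' := hcons.eventually (Iic_mem_nhds (ENNReal.ofReal_pos.2 (half_pos hη0)))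
  filter_upwards [hK.eventually hrate, hK.eventually_ge_atTop p, eventually_ne_atTop 0, hsmall,
    hKN.eventually (Iic_mem_nhds hε₁), hcons'] with N hN hpK hN0 hs hε₁N hc
  have hmarkov : P {ω | 2 * C / η < M.noise (K N) N fun i => W i ω} ≤ ENNReal.ofReal (η / 2) := by
    obtain ⟨hi, hb⟩ := hnoise (K N) hpK N hN0
    have h2 := mul_meas_ge_le_integral_of_nonneg
      (Eventually.of_forall fun ω => noise_nonneg (M := M) (K N) N fun i => W i ω) hi (2 * C / η)
    rw [← ofReal_measureReal]
    have h6 : P.real {ω | 2 * C / η < M.noise (K N) N fun i => W i ω}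
        ≤ P.real {ω | 2 * C / η ≤ M.noise (K N) N fun i => W i ω} :=
      measureReal_mono fun ω (hω : 2 * C / η < M.noise (K N) N fun i => W i ω) => hω.le
    refine ENNReal.ofReal_le_ofReal (h6.trans ?_)
    have h3 := h2.trans hb
    rw [div_mul_eq_mul_div, div_le_iff₀ hη0] at h3
    have h4 : C * (2 * P.real {ω | 2 * C / η ≤ M.noise (K N) N fun i => W i ω}) ≤ C * η := by
      linarith
    have h5 := le_of_mul_le_mul_left h4 hC
    linarith
  have hsub : P {ω | t < √N * ‖M.diff (γbar N ω) (θbar N ω) - M.linEst (K N) N fun i => W i ω‖}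
      ≤ P ({ω | 2 * C / η < M.noise (K N) N fun i => W i ω} ∪ {ω | ∃ γ θ, τ < ‖γ - M.γ₀‖ ∧
        M.IsBestGMM (K N) N (fun i => W i ω) γ θ}) := by
    refine measure_mono_ae ?_
    filter_upwards [hmin N hpK, ae_forall_mem_suppX hlaw] with ω hω hX
    intro (hlt : t < _)
    by_contra hnot
    have hnot' : ¬(2 * C / η < M.noise (K N) N (fun i => W i ω) ∨ ∃ γ θ, τ < ‖γ - M.γ₀‖ ∧
        M.IsBestGMM (K N) N (fun i => W i ω) γ θ) := hnot
    push Not at hnot'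
    have hγ : ‖γbar N ω - M.γ₀‖ ≤ τ := by
      by_contra! hγ
      exact hnot'.2 _ _ hγ hω
    exact absurd hlt (not_lt.2 ((hN N hN0 hε₁N _ hX hnot'.1 _ _ hω hγ).trans hs))
  refine (hsub.trans (measure_union_le _ _)).trans ((add_le_add hmarkov hc).trans ?_)
  rw [← ENNReal.ofReal_add (by positivity) (by positivity), add_halves]
  exact hηε.2.le

end Model
end MNAR

/-! ### Asymptotic normality. -/

namespace MNAR
namespace Model
variable {p r₁ r₂ : ℕ} {M : Model p r₁ r₂} [IsProbabilityMeasure M.law]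

/-- The standardized estimator as a perturbation of a normalized sum. -/
lemma standardized_eq {K N : ℕ} {R : Matrix (Fin p ⊕ Unit) (Fin p ⊕ Unit) ℝ}
    (hS : M.invSqrtV K * M.V K = CFC.sqrt (M.V K)) (w : ℕ → Obs r₁ r₂) (γ : Par p) (θ : ℝ)
    (ζ : Fin p ⊕ Unit → Obs r₁ r₂ → ℝ) :
    M.standardized K N γ θ
      - (√(N : ℝ))⁻¹ • ∑ i ∈ Finset.range N, WithLp.toLp 2 (-R.mulVec fun l => ζ l (w i))
      = WithLp.toLp 2 ((M.invSqrtV K).mulVec (√(N : ℝ) • (M.diff γ θ - M.linEst K N w)))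
        - WithLp.toLp 2 ((CFC.sqrt (M.V K)).mulVec fun l => √N * emean (fun x =>
          ∑ a, M.coef K l a * M.g K M.γ₀ M.θ₀ x a - ζ l x) N w)
        - WithLp.toLp 2 ((CFC.sqrt (M.V K) - R).mulVec fun l => √N * emean (ζ l) N w) := by
  have e1 : M.standardized K N γ θ
      = WithLp.toLp 2 ((M.invSqrtV K).mulVec (√(N : ℝ) • (M.diff γ θ).ofLp)) := by
    rw [standardized]
    congr 2
    ext j
    rcases j with j | _ <;> simp [diff]
  have e2 : (M.linEst K N w).ofLp = -(M.V K).mulVec fun l =>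
      emean (fun x => ∑ a, M.coef K l a * M.g K M.γ₀ M.θ₀ x a) N w := by
    simp only [linEst, dotProduct, sum_mul_moment₀]
  have e3 : (√(N : ℝ))⁻¹ • ∑ i ∈ Finset.range N, (WithLp.toLp 2 (-R.mulVec fun l => ζ l (w i)) :
      FullPar p) = WithLp.toLp 2 (-R.mulVec fun l => √N * emean (ζ l) N w) := by
    have hs : (√(N : ℝ))⁻¹ = √N * (N : ℝ)⁻¹ := by
      rcases Nat.eq_zero_or_pos N with rfl | hN
      · simp
      · have : (N : ℝ) ≠ 0 := by positivity
        have h2 : √(N : ℝ) ≠ 0 := by positivity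
        field_simp
        rw [Real.sq_sqrt (Nat.cast_nonneg N)]
    have h1 : (fun l => √N * emean (ζ l) N w)
        = (√(N : ℝ))⁻¹ • ∑ i ∈ Finset.range N, fun l => ζ l (w i) := by
      ext l
      simp [hs, emean, mul_assoc]
    rw [h1, Matrix.mulVec_smul, Matrix.mulVec_sum, ← WithLp.toLp_sum, Finset.sum_neg_distrib,
      ← smul_neg, WithLp.toLp_smul]
  have e4 : (fun l => √N * emean (fun x => ∑ a, M.coef K l a * M.g K M.γ₀ M.θ₀ x a - ζ l x) N w)
      = √(N : ℝ) • (fun l => emean (fun x => ∑ a, M.coef K l a * M.g K M.γ₀ M.θ₀ x a) N w)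
        - fun l => √N * emean (ζ l) N w := by
    ext l
    simp [emean_sub, mul_sub]
  -- By `hS`, standardizing `linEst` turns `V^{-1/2} V` into `V^{1/2}`. The three errors then come
  -- from the nonlinearity, from the projection at finite `K` in place of its limit, and from
  -- `V^{1/2}` in place of `R`.
  rw [e1, e3, e4, e2, ← WithLp.toLp_sub, ← WithLp.toLp_sub,
    ← WithLp.toLp_sub]
  congr 1
  simp only [sub_neg_eq_add, Matrix.mulVec_add, Matrix.mulVec_sub,
    Matrix.sub_mulVec, Matrix.mulVec_smul, Matrix.mulVec_mulVec, hS, smul_add]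
  abel

/-- The normalized sums that approximate the standardized estimator are asymptotically normal. -/
lemma tendstoInDistribution_linear (h : M.Regular)
    {Ω : Type*} [MeasurableSpace Ω] {P : Measure Ω} [IsProbabilityMeasure P]
    {W : ℕ → Ω → Obs r₁ r₂} (hlaw : ∀ i, HasLaw (W i) M.law P) (hindep : iIndepFun W P)
    {Q : Lp ℝ 2 M.law →L[ℝ] Lp ℝ 2 M.law}
    (hQ : ∀ v, Tendsto (fun k => (M.momentSpan k).starProjection v) atTop (𝓝 (Q v)))
    {R : Matrix (Fin p ⊕ Unit) (Fin p ⊕ Unit) ℝ} (hR : R.transpose = R)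
    (hRQ : ∀ t : FullPar p, ‖Q (M.psiL2 (WithLp.toLp 2 (R.mulVec t)))‖ ^ 2 = ‖t‖ ^ 2) :
    TendstoInDistribution (fun (N : ℕ) (ω : Ω) => (√(N : ℝ))⁻¹ • ∑ i ∈ Finset.range N,
      (WithLp.toLp 2 (-R.mulVec fun l => Q (toL2 M.law (M.psi l)) (W i ω)) : FullPar p)) atTop
      (id : FullPar p → FullPar p) (fun _ => P) (stdGaussian (FullPar p)) := by
  have hζ : ∀ l, MemLp (Q (toL2 M.law (M.psi l))) 2 M.law := fun l => Lp.memLp _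
  have hsum : ∀ v : Fin p ⊕ Unit → ℝ,
      ∫ x, (∑ l, v l * Q (toL2 M.law (M.psi l)) x) ^ 2 ∂M.law
        = ‖Q (M.psiL2 (WithLp.toLp 2 v))‖ ^ 2 := fun v => by
    have e : ∀ l, toL2 M.law (Q (toL2 M.law (M.psi l))) = Q (toL2 M.law (M.psi l)) := fun l => by
      conv_lhs => rw [toL2, dif_pos (hζ l)]
      exact Lp.toLp_coeFn _ _
    rw [← sum_smul_psi, norm_sq_eq_integral]
    refine integral_congr_ae ?_
    have h1 := coeFn_sum_smul_toL2 hζ v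
    simp only [e] at h1
    filter_upwards [h1] with x hx
    rw [hx]
  refine tendstoInDistribution_stdGaussian hlaw hindep
    (fun x => WithLp.toLp 2 (-R.mulVec fun l => Q (toL2 M.law (M.psi l)) x)) (fun j => ?_)
    (fun j => ?_) fun t => ?_
  · exact (memLp_sum_mul hζ (R j)).neg
  · change ∫ x, -∑ l, R j l * Q (toL2 M.law (M.psi l)) x ∂M.law = 0
    rw [integral_neg, integral_finsetSum _ fun l _ =>
      ((hζ l).integrable one_le_two).const_mul _]
    simp [integral_const_mul, integral_limit_eq_zero h hQ]
  -- Since `R` is symmetric, the projection on `t` is minus the combination of the limit functions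
  -- with coefficients `R t`. Its variance is `‖t‖²` because `R` whitens their Gram matrix.
  · rw [← hRQ t, ← hsum]
    refine integral_congr_ae (Eventually.of_forall fun x => ?_)
    have e : inner ℝ (WithLp.toLp 2 (-R.mulVec fun l => Q (toL2 M.law (M.psi l)) x) : FullPar p) t
        = -∑ l, R.mulVec t l * Q (toL2 M.law (M.psi l)) x := by
      have e1 : inner ℝ (WithLp.toLp 2 (-R.mulVec fun l => Q (toL2 M.law (M.psi l)) x) :
          FullPar p) t = -dotProduct t.ofLp (R.mulVec fun l => Q (toL2 M.law (M.psi l)) x) := by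
        rw [PiLp.inner_apply, dotProduct, ← Finset.sum_neg_distrib]
        exact Finset.sum_congr rfl fun l _ => by simp
      rw [e1, Matrix.dotProduct_mulVec, ← Matrix.mulVec_transpose, hR]
      rfl
    simp only [e, neg_sq]

lemma aemeasurable_standardized {Ω : Type*} [MeasurableSpace Ω] {P : Measure Ω} (K N : ℕ)
    {γ : Ω → Par p} {θ : Ω → ℝ} (hγ : AEMeasurable γ P) (hθ : AEMeasurable θ P) :
    AEMeasurable (fun ω => M.standardized K N (γ ω) (θ ω)) P := by
  have hv : Continuous fun x : Par p × ℝ => (Sum.elim (fun j => √(N : ℝ) * (x.1 j - M.γ₀ j))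
      (fun _ => √(N : ℝ) * (x.2 - M.θ₀)) : Fin p ⊕ Unit → ℝ) := by
    refine continuous_pi fun j => ?_
    rcases j with j | _ <;> simp only [Sum.elim_inl, Sum.elim_inr] <;> fun_prop
  have hA : Continuous fun x : Par p × ℝ => (M.invSqrtV K).mulVec
      (Sum.elim (fun j => √(N : ℝ) * (x.1 j - M.γ₀ j)) (fun _ => √(N : ℝ) * (x.2 - M.θ₀))) :=
    Continuous.matrix_mulVec continuous_const hv
  have hc : Continuous fun x : Par p × ℝ => M.standardized K N x.1 x.2 :=
    (PiLp.continuous_toLp 2 (fun _ : Fin p ⊕ Unit => ℝ)).comp hA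
  exact Measurable.comp_aemeasurable (g := fun x : Par p × ℝ => M.standardized K N x.1 x.2)
    (f := fun ω => (γ ω, θ ω)) hc.measurable (hγ.prodMk hθ)

lemma tendsto_sum_abs {ι : Type*} [Fintype ι] {A : ℕ → Matrix ι ι ℝ} {B : Matrix ι ι ℝ}
    (h : Tendsto A atTop (𝓝 B)) :
    Tendsto (fun k => ∑ i, ∑ j, |A k i j|) atTop (𝓝 (∑ i, ∑ j, |B i j|)) :=
  tendsto_finsetSum _ fun i _ => tendsto_finsetSum _ fun j _ =>
    (tendsto_pi_nhds.1 (tendsto_pi_nhds.1 h i) j).abs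

end Model

end MNAR

theorem theorem2 {p r₁ r₂ : ℕ} (M : MNAR.Model p r₁ r₂) [IsProbabilityMeasure M.law]
    (hbasic : M.Basic) (hident : M.Identification) (hrel : M.InstrumentRelevant)
    (hsupp : M.BoxSupport) (hbasis : M.Basis) (hprop : M.Propensity)
    (hV : ∀ᶠ K in atTop, IsUnit (M.info K).det)
    (K : ℕ → ℕ) (hK : Tendsto K atTop atTop)
    (hKN : Tendsto (fun N : ℕ => (K N : ℝ) ^ 3 / (N : ℝ)) atTop (𝓝 0))
    {Ω : Type*} [MeasurableSpace Ω] (Pr : Measure Ω) [IsProbabilityMeasure Pr]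
    (W : ℕ → Ω → MNAR.Obs r₁ r₂) (hlaw : ∀ i, HasLaw (W i) M.law Pr) (hindep : iIndepFun W Pr)
    (γbar : ℕ → Ω → MNAR.Par p) (θbar : ℕ → Ω → ℝ)
    (hγ : ∀ N, AEMeasurable (γbar N) Pr) (hθ : ∀ N, AEMeasurable (θbar N) Pr)
    (hmin : ∀ N, p ≤ K N →
      ∀ᵐ ω ∂Pr, M.IsBestGMM (K N) N (fun i => W i ω) (γbar N ω) (θbar N ω)) :
    TendstoInDistribution
      (fun (N : ℕ) (ω : Ω) => M.standardized (K N) N (γbar N ω) (θbar N ω)) atTop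
      (id : MNAR.FullPar p → MNAR.FullPar p) (fun _ => Pr)
      (stdGaussian (MNAR.FullPar p)) := by
  have h : M.Regular := ⟨hbasic, hident, hbasis, hprop⟩
  obtain ⟨Q, hQ, hQ'⟩ := MNAR.Model.exists_limit_projection h
  obtain ⟨R, hRQ, hR, hsqrt, hinv, hS⟩ := MNAR.Model.exists_limit_sqrt h hV hQ hQ'
  -- Slutsky's theorem: the normalized sums of the fixed functions have the right limit, and the
  -- difference from the standardized estimator tends to zero in probability.
  refine tendstoInDistribution_of_tendstoInMeasure_sub _ _
    (MNAR.Model.tendstoInDistribution_linear h hlaw hindep hQ hR hRQ) ?_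
    fun N => MNAR.Model.aemeasurable_standardized (K N) N (hγ N) (hθ N)
  -- growth conditions
  have hKR : Tendsto (fun N => (K N : ℝ)) atTop atTop := tendsto_natCast_atTop_atTop.comp hK
  have hK1 : ∀ᶠ N in atTop, (1 : ℝ) ≤ K N := hKR.eventually_ge_atTop 1
  have hg3 : Tendsto (fun N : ℕ => ((K N : ℝ) + 1) ^ 3 / N) atTop (𝓝 0) := by
    have h8 := hKN.const_mul 8
    rw [mul_zero] at h8
    refine tendsto_of_tendsto_of_tendsto_of_le_of_le' tendsto_const_nhds h8
      (Eventually.of_forall fun N => by positivity) ?_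
    filter_upwards [hK1] with N hN
    rw [mul_div_assoc']
    refine div_le_div_of_nonneg_right ?_ (Nat.cast_nonneg N)
    calc ((K N : ℝ) + 1) ^ 3 ≤ (K N + K N) ^ 3 := by gcongr
      _ = _ := by ring
  have hg1 : Tendsto (fun N : ℕ => ((K N : ℝ) + 1) / N) atTop (𝓝 0) := by
    refine tendsto_of_tendsto_of_tendsto_of_le_of_le' tendsto_const_nhds hg3
      (Eventually.of_forall fun N => by positivity) (Eventually.of_forall fun N => ?_)
    refine div_le_div_of_nonneg_right ?_ (Nat.cast_nonneg N)
    have : (0 : ℝ) ≤ K N := by positivity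
    exact le_self_pow₀ (by linarith) (by norm_num)
  have hgs : Tendsto (fun N : ℕ => √(((K N : ℝ) + 1) ^ 3 / N)) atTop (𝓝 0) := by
    simpa using hg3.sqrt
  -- the three error terms
  have hdist : Tendsto (fun N => ∑ i, ∑ j, |(CFC.sqrt (M.V (K N)) - R) i j|) atTop (𝓝 0) := by
    have h1 := MNAR.Model.tendsto_sum_abs (hsqrt.sub_const R)
    simp only [sub_self, Matrix.zero_apply, abs_zero, Finset.sum_const_zero] at h1
    exact h1.comp hK
  obtain ⟨C, hC, hSC, hRC⟩ : ∃ C : ℝ, 0 < C ∧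
      (∀ᶠ N in atTop, ∑ i, ∑ j, |M.invSqrtV (K N) i j| ≤ C) ∧
      ∀ᶠ N in atTop, ∑ i, ∑ j, |CFC.sqrt (M.V (K N)) i j| ≤ C := by
    have h1 := (MNAR.Model.tendsto_sum_abs hinv).comp hK
    have h2 := (MNAR.Model.tendsto_sum_abs hsqrt).comp hK
    have z1 : 0 ≤ ∑ i, ∑ j, |R⁻¹ i j| :=
      Finset.sum_nonneg fun _ _ => Finset.sum_nonneg fun _ _ => abs_nonneg _
    have z2 : 0 ≤ ∑ i, ∑ j, |R i j| :=
      Finset.sum_nonneg fun _ _ => Finset.sum_nonneg fun _ _ => abs_nonneg _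
    refine ⟨∑ i, ∑ j, |R⁻¹ i j| + ∑ i, ∑ j, |R i j| + 1, by positivity,
      h1.eventually (Iic_mem_nhds (by linarith)), h2.eventually (Iic_mem_nhds (by linarith))⟩
  rw [tendstoInMeasure_iff_norm]
  intro ε hε
  have t1 := MNAR.Model.tendsto_measure_diff_sub_linEst h hV hlaw hindep hK hgs hg1 hmin
    (by positivity : 0 < ε / (4 * C))
  have hζ : ∀ l, MemLp (Q (MNAR.toL2 M.law (M.psi l))) 2 M.law := fun l => Lp.memLp _
  have hζ0 := MNAR.Model.integral_limit_eq_zero h hQ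
  have t2 := MNAR.Model.tendsto_measure_norm_emean hlaw hindep
    (q := fun N l x => ∑ a, M.coef (K N) l a * M.g (K N) M.γ₀ M.θ₀ x a
      - Q (MNAR.toL2 M.law (M.psi l)) x)
    (by
      filter_upwards [hK.eventually_ge_atTop p] with N hN l
      have h1 := MNAR.Model.memLp_coef_g h hN l
      refine ⟨h1.sub (hζ l), ?_⟩
      rw [integral_sub (h1.integrable one_le_two) ((hζ l).integrable one_le_two), hζ0,
        MNAR.Model.integral_coef_g h hN, sub_zero])
    (by
      have h1 : Tendsto (fun K => ∑ l, ‖(M.momentSpan K).starProjection (MNAR.toL2 M.law (M.psi l))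
          - Q (MNAR.toL2 M.law (M.psi l))‖ ^ 2) atTop (𝓝 0) := by
        have h2 := tendsto_finsetSum Finset.univ fun l (_ : l ∈ Finset.univ) =>
          (((hQ (MNAR.toL2 M.law (M.psi l))).sub_const
            (Q (MNAR.toL2 M.law (M.psi l)))).norm.pow 2)
        simpa using h2
      refine (h1.comp hK).congr' ?_
      filter_upwards [hK.eventually_ge_atTop p] with N hN
      exact Finset.sum_congr rfl fun l _ => (MNAR.Model.integral_coef_g_sub_sq h hN l _).symm)
    (by positivity : 0 < ε / (4 * C))
  -- The deterministic sum of absolute entries of `V^{1/2} - R` is absorbed into the functions,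
  -- whose second moments then vanish. Only bounded second moments of the limit functions are
  -- needed.
  have t3 := MNAR.Model.tendsto_measure_norm_emean hlaw hindep
    (q := fun N l x => (∑ i, ∑ j, |(CFC.sqrt (M.V (K N)) - R) i j|)
      * Q (MNAR.toL2 M.law (M.psi l)) x)
    (Eventually.of_forall fun N l => ⟨(hζ l).const_mul _, by
      rw [integral_const_mul, hζ0, mul_zero]⟩)
    (by
      simp only [mul_pow, integral_const_mul, ← Finset.mul_sum]
      simpa using (hdist.pow 2).mul_const _)
    (by positivity : 0 < ε / 4)
  have hsum := (t1.add t2).add t3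
  simp only [add_zero] at hsum
  refine tendsto_of_tendsto_of_tendsto_of_le_of_le' tendsto_const_nhds hsum
    (Eventually.of_forall fun _ => zero_le) ?_
  filter_upwards [hK.eventually hS, hSC, hRC] with N hSN hSCN hRCN
  refine le_trans (measure_mono ?_) ((measure_union_le _ _).trans
    (add_le_add (measure_union_le _ _) le_rfl))
  intro ω hω
  by_contra hnot
  simp only [Set.mem_union, Set.mem_ofPred_eq, not_or, not_lt] at hnot hω
  obtain ⟨⟨e1, e2⟩, e3⟩ := hnot
  rw [Pi.sub_apply, Pi.sub_apply, Pi.zero_apply, sub_zero,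
    MNAR.Model.standardized_eq hSN (fun i => W i ω)] at hω
  have hmul : ∀ {x y : ℝ}, x ≤ C → 0 ≤ y → y ≤ ε / (4 * C) → x * y ≤ ε / 4 :=
    fun {x y} hx hy0 hy => by
      calc x * y ≤ C * (ε / (4 * C)) := mul_le_mul hx hy hy0 hC.le
        _ = ε / 4 := by field_simp
  have b1 : ‖(WithLp.toLp 2 ((M.invSqrtV (K N)).mulVec (√(N : ℝ) •
      (M.diff (γbar N ω) (θbar N ω) - M.linEst (K N) N fun i => W i ω))) : MNAR.FullPar p)‖
      ≤ ε / 4 := by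
    refine (MNAR.norm_toLp_mulVec_le _ _).trans (hmul hSCN (norm_nonneg _) ?_)
    rw [← WithLp.ofLp_sub, ← WithLp.ofLp_smul, WithLp.toLp_ofLp, norm_smul,
      Real.norm_of_nonneg (Real.sqrt_nonneg _)]
    exact e1
  have b2 := (MNAR.norm_toLp_mulVec_le (CFC.sqrt (M.V (K N))) _).trans
    (hmul hRCN (norm_nonneg _) e2)
  have b3 : ‖(WithLp.toLp 2 ((CFC.sqrt (M.V (K N)) - R).mulVec fun l => √N * MNAR.emean
      (Q (MNAR.toL2 M.law (M.psi l))) N fun i => W i ω) : MNAR.FullPar p)‖ ≤ ε / 4 := by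
    refine (MNAR.norm_toLp_mulVec_le _ _).trans (le_trans (le_of_eq ?_) e3)
    have z : 0 ≤ ∑ i, ∑ j, |(CFC.sqrt (M.V (K N)) - R) i j| :=
      Finset.sum_nonneg fun _ _ => Finset.sum_nonneg fun _ _ => abs_nonneg _
    rw [← Real.norm_of_nonneg z, ← norm_smul, Real.norm_of_nonneg z, ← WithLp.toLp_smul]
    congr 2
    ext l
    rw [Pi.smul_apply, smul_eq_mul, MNAR.emean_const_mul]
    ring
  have b4 := hω.trans ((norm_sub_le _ _).trans (add_le_add ((norm_sub_le _ _).trans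
    (add_le_add b1 b2)) b3))
  linarith
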